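/- Let $p\in\mathbb N$. For a finite undirected graph $G$ on the node set $V=\{0,\dots,n-1\}$ (a symmetric relation $E\subseteq V\times V$), the symmetric conjunctive network on $G$ is the map $F_G:\{0,1\}^V\to\{0,1\}^V$ with $F_G(x)_v=\bigwedge_{u\in N(v)}x_u$ (an empty conjunction being $1$). Its periodic extension of period $p$ is the map $F_{G,p}$ on $Q'^V$, where $Q'=\{0,1\}\times\{0,\dots,p-1\}\times 2^{\{0,\dots,p-1\}}$, that sends $(x_v,c_v,s_v)_{v\in V}$ to $(x'_v,\,c_v+1 \bmod p,\,s_v)_{v\in V}$, where $x'_v=F_G(x)_v$ if $c_v\in s_v$ and $x'_v=x_v$ otherwise. The family of symmetric conjunctive networks under periodic update schedules of period $p$ consists of all the maps $F_{G,p}$. This family is neither dynamically nor computationally complex, in the following precise sense. 1. Transients have length $O(n^2)$: there is a constant $C$, depending only on $p$, such that for every $n$, every graph $G$ with $n$ nodes and every configuration $x\in Q'^V$ there is $\tau\le Cn^2$ for which $F_{G,p}^{\tau}(x)$ is a periodic point of $F_{G,p}$. 2. Unary prediction is in $\mathbf{NC}^2$: the language of the words that encode a graph $G$ (by its adjacency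 matrix), a configuration $x\in Q'^V$, a node $v$ and a time $t$ written in unary, such that $F_{G,p}^t(x)_v\ne x_v$, is decided by a logspace-uniform family of Boolean circuits of fan-in at most two, of polynomial size and of depth $O(\log^2 N)$, where $N$ is the length of the word. 3. Binary prediction is in polynomial time: the same language with the time $t$ written in binary is decided by a deterministic Turing machine in time polynomial in the length of the word. -/

import Mathlib

/-! ### Automata networks -/

/-- A finite undirected graph on the node set `{0, …, n - 1}`, given by its symmetric adjacency
relation `E ⊆ V × V`. -/
structure UGraph (n : ℕ) where
  adj : Fin n → Fin n → Bool
  symm : ∀ u v, adj u v = adj v u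

/-- A concrete symmetric automata network over the alphabet `Q`: an undirected graph, a map
`Q × 2^Q → Q` at each node, and a permutation of `Q` on each edge. -/
structure CSAN (n : ℕ) (Q : Type) where
  graph : UGraph n
  nodeLabel : Fin n → Q → Set Q → Q
  edgeLabel : Fin n → Fin n → Equiv.Perm Q
  edgeLabel_symm : ∀ u v, edgeLabel u v = edgeLabel v u

/-- The global map: every node sees its own state and the set of the (relabelled) states of its
neighbours. -/
def CSAN.globalMap {n : ℕ} {Q : Type} (A : CSAN n Q) (x : Fin n → Q) : Fin n → Q :=
  fun v => A.nodeLabel v (x v) {q | ∃ u, A.graph.adj v u = true ∧ A.edgeLabel v u (x u) = q}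

open Classical in
/-- The symmetric conjunctive network on a graph: `λ(q, X) = 0` if `0 ∈ X` and `1` otherwise at
every node, and the identity on every edge. -/
noncomputable def symConj {n : ℕ} (G : UGraph n) : CSAN n Bool where
  graph := G
  nodeLabel _ _ X := if false ∈ X then false else true
  edgeLabel _ _ := 1
  edgeLabel_symm _ _ := rfl

/-- The alphabet `Q × {0, …, p - 1} × 2^{0, …, p - 1}`: state, clock, and the set of the clock
values at which the node is updated. -/
abbrev PerState (Q : Type) (p : ℕ) : Type := Q × Fin p × Finset (Fin p)

/-- The periodic extension, with period `p`, of the automata network `F`. -/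
def periodicExtension {n : ℕ} {Q : Type} (p : ℕ) (F : (Fin n → Q) → (Fin n → Q))
    (x : Fin n → PerState Q p) : Fin n → PerState Q p :=
  fun v =>
    (if (x v).2.1 ∈ (x v).2.2 then F (fun u => (x u).1) v else (x v).1,
      ⟨((x v).2.1.val + 1) % p, Nat.mod_lt _ (x v).2.1.pos⟩,
      (x v).2.2)

/-- The member, given by the graph `G`, of the family of symmetric conjunctive networks under
periodic update schedules of period `p`. -/
noncomputable def symConjPeriodic (p : ℕ) {n : ℕ} (G : UGraph n) :
    (Fin n → PerState Bool p) → (Fin n → PerState Bool p) :=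
  periodicExtension p (symConj G).globalMap

/-! ### The prediction problems -/

/-- An instance of the prediction problem, before the choice of a representation of the time. -/
structure PredInstance (p : ℕ) where
  n : ℕ
  graph : UGraph n
  node : Fin n
  init : Fin n → PerState Bool p
  time : ℕ

/-- The question `F^t(x)_v ≠ x_v`. -/
def PredInstance.Changes {p : ℕ} (I : PredInstance p) : Prop :=
  ((symConjPeriodic p I.graph)^[I.time] I.init) I.node ≠ I.init I.node

/-- A state as a word of length `1 + 2p`: the Boolean state, the clock value as a one-hot vector,
the update set as a characteristic vector. -/
def stateWord {p : ℕ} (q : PerState Bool p) : List Bool :=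
  [q.1] ++ List.ofFn (fun i : Fin p => decide (i = q.2.1)) ++
    List.ofFn (fun i : Fin p => decide (i ∈ q.2.2))

/-- The input word: the number of nodes in unary followed by a `0`, the adjacency matrix row by
row, the configuration node by node, the node as a one-hot vector, and the word `timeWord` that
represents the time. -/
def PredInstance.word {p : ℕ} (I : PredInstance p) (timeWord : List Bool) : List Bool :=
  List.replicate I.n true ++ [false] ++
    (List.ofFn fun u => List.ofFn fun v => I.graph.adj u v).flatten ++
    (List.ofFn fun u => stateWord (I.init u)).flatten ++
    List.ofFn (fun u => decide (u = I.node)) ++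
    timeWord

/-- Unary prediction, as a language: the time `t` is written as `1^t`. -/
def unaryPrediction (p : ℕ) : Set (List Bool) :=
  {w | ∃ I : PredInstance p, w = I.word (Computability.unaryEncodeNat I.time) ∧ I.Changes}

/-- Binary prediction, as a language: the time is written in binary. -/
def binaryPrediction (p : ℕ) : Set (List Bool) :=
  {w | ∃ I : PredInstance p, w = I.word (Computability.encodeNat I.time) ∧ I.Changes}

/-! ### Polynomial time and linear space on Turing machines -/

/-- The language `L` is decided by a deterministic Turing machine in polynomial time. -/
def InPolyTime (L : Set (List Bool)) : Prop :=
  ∃ f : List Bool → Bool, (∀ w, f w = true ↔ w ∈ L) ∧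
    Nonempty (Turing.TM2ComputableInPolyTime (fun w : List Bool => w) Computability.encodeBool f)

/-- The space used by a configuration: the total height of all stacks, that of the input
included. -/
def stackSpace (M : Turing.FinTM2) (c : M.Cfg) : ℕ :=
  letI := M.kFin
  ∑ k : M.K, (Turing.TM2.Cfg.stk c k).length

/-- The function `f` is computed by a deterministic Turing machine whose space is at most linear
in the length of the input. -/
def TM2ComputableInLinearSpace {α β αΓ βΓ : Type} (ea : α → List αΓ) (eb : β → List βΓ)
    (f : α → β) : Prop :=
  ∃ (M : Turing.TM2ComputableAux αΓ βΓ) (c : ℕ), ∀ a : α,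
    Nonempty (Turing.TM2Outputs M.tm (List.map M.inputAlphabet.invFun (ea a))
      (some (List.map M.outputAlphabet.invFun (eb (f a))))) ∧
    ∀ cfg : M.tm.Cfg,
      StateTransition.Reaches M.tm.step
        (Turing.initList M.tm (List.map M.inputAlphabet.invFun (ea a))) cfg →
      stackSpace M.tm cfg ≤ c * ((ea a).length + 1)

/-! ### Boolean circuits and the class NC -/

/-- A gate of a Boolean circuit of fan-in at most two; `input k` reads the `k`-th input bit, the
arguments of the other gates are numbers of gates. -/
inductive Gate where
  | const (b : Bool)
  | input (k : ℕ)
  | not (j : ℕ)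
  | and (j k : ℕ)
  | or (j k : ℕ)

namespace Gate

/-- The gate can stand at place `i` of a circuit with `N` inputs: it uses only earlier gates. -/
def WellFormed (N i : ℕ) : Gate → Prop
  | const _ => True
  | input k => k < N
  | not j => j < i
  | and j k => j < i ∧ k < i
  | or j k => j < i ∧ k < i

/-- The output of the gate, from the input bits `w` and the values `v` of the other gates. -/
def eval (w v : ℕ → Bool) : Gate → Bool
  | const b => b
  | input k => w k
  | not j => !(v j)
  | and j k => v j && v k
  | or j k => v j || v k

/-- The depth of the gate, from the depths `d` of the other gates. -/
def depth (d : ℕ → ℕ) : Gate → ℕ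
  | const _ => 0
  | input _ => 0
  | not j => d j + 1
  | and j k => max (d j) (d k) + 1
  | or j k => max (d j) (d k) + 1

/-- The type of the gate and its arguments (`0` where there is none). -/
def data : Gate → Fin 6 × ℕ × ℕ
  | const false => (0, 0, 0)
  | const true => (1, 0, 0)
  | input k => (2, k, 0)
  | not j => (3, j, 0)
  | and j k => (4, j, k)
  | or j k => (5, j, k)

/-- A gate, or its absence, as a word: the type followed by the arguments in binary. -/
def optionWord : Option Gate → List (Fin 6 ⊕ (Bool ⊕ Bool))
  | none => []
  | some g => Sum.inl g.data.1 ::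
      ((Computability.encodingProd Computability.encodingNatBool
        Computability.encodingNatBool).encode g.data.2).map Sum.inr

end Gate

/-- A Boolean circuit with `N` inputs: a nonempty list of gates in topological order, the last of
which is the output. -/
structure BoolCircuit (N : ℕ) where
  gates : List Gate
  nonempty : gates ≠ []
  wellFormed : ∀ (i : ℕ) (g : Gate), gates[i]? = some g → g.WellFormed N i

namespace BoolCircuit

variable {N : ℕ} (C : BoolCircuit N)

/-- The number of gates. -/
def size : ℕ := C.gates.length

/-- The value of the `i`-th gate on the input bits `w`. -/
def gateValue (w : ℕ → Bool) (i : ℕ) : Bool :=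
  match C.gates[i]? with
  | none => false
  | some g => g.eval w (fun j => if _h : j < i then gateValue w j else false)
termination_by i

/-- The depth of the `i`-th gate: the length of a longest path from a source to it. -/
def gateDepth (i : ℕ) : ℕ :=
  match C.gates[i]? with
  | none => 0
  | some g => g.depth (fun j => if _h : j < i then gateDepth j else 0)
termination_by i

/-- The output of the circuit on the word `w`. -/
def output (w : List Bool) : Bool :=
  C.gateValue (fun k => w.getD k false) (C.size - 1)

/-- All gates have depth at most `d`. -/
def DepthAtMost (d : ℕ) : Prop := ∀ i < C.size, C.gateDepth i ≤ d

end BoolCircuit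

/-- Logarithmic-space uniformity. From `N` and `i`, written in binary, a Turing machine
finds the `i`-th gate of the circuit for `N` inputs, or that there is none, in space linear in the
length of `N` and `i`, hence in space `O(log N)` for the gates of a family of polynomial size. -/
def LogspaceUniform (C : ∀ N : ℕ, BoolCircuit N) : Prop :=
  TM2ComputableInLinearSpace
    (Computability.encodingProd Computability.encodingNatBool
      Computability.encodingNatBool).encode
    Gate.optionWord
    (fun a : ℕ × ℕ => (C a.1).gates[a.2]?)

/-- The class `NC^k`: languages decided by logspace-uniform families of Boolean circuits of
polynomial size and of depth `O(log^k N)`. -/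
def InNC (k : ℕ) (L : Set (List Bool)) : Prop :=
  ∃ C : ∀ N : ℕ, BoolCircuit N,
    (∀ w : List Bool, w ∈ L ↔ (C w.length).output w = true) ∧
    (∃ c : ℕ, ∀ N, (C N).size ≤ N ^ c + c) ∧
    (∃ c : ℕ, ∀ N, (C N).DepthAtMost (c * (Nat.log 2 N) ^ k + c)) ∧
    LogspaceUniform C

/-! Only the zeros of a configuration have to be followed. A node is zero at time t + 1 exactly if,
at time t, some neighbour is zero (when the node is updated) or the node itself is zero (when it is
not). Whether it is updated depends on t modulo p only. Hence, with the phase of the time added as a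
second component, zeros travel along a fixed relation on n p vertices, and the zeros at time t are
the ends of the walks of length t that start at the initial zeros.

Transients. Let R be a relation on N points. A walk of length at least N passes through a point w on
a cycle of some length l ≤ N. The sets of points reached from w in i, i + l, i + 2 l, ... steps
increase, and such a chain is stationary from N l on. Thus l steps can be removed from a long part
of the walk before or after w, and cycles at w can be inserted at will. So for L ≥ 3 N ^ 2 and m
divisible by all numbers up to N, walks of length L + m and of length L join the same pairs
(`walk_add_iff`). With N = n p this makes the transient at most 3 (n p) ^ 2
(`iterate_mem_periodicPts`).

Prediction. The relation "a zero of a leads to a zero of b after t steps" is a power of a Boolean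
matrix, computed by repeated squaring along the binary digits of t (`PredInstance.reach_bit`). One
squaring is a layer of disjunctions of conjunctions of polynomial fan-in, that is, of logarithmic
depth in gates of fan-in two. A time in unary has O(log N) digits, which gives depth O(log ^ 2 N). A
time in binary has at most N digits, which still gives a circuit of polynomial size. An additional
node that is always zero carries the phase, so that the clock is predicted by the same matrix. The
circuit sees only the length of the word; it therefore tries all n and v in parallel and conjoins
each answer with a check of the format of the word (`Prediction.output_iff`).

Machines. The description of the circuits (type and arguments of the i-th gate) is built from
arithmetic operations that are evaluated by loop programs with polynomially bounded registers
(`LoopComputable`). Such programs are compiled to stack machines that keep the registers in binary.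
Polynomially bounded registers have binary words of linear length, whence the logspace uniformity
(`linearSpace_of_loopComputable`). On the word itself the same programs run in polynomial time, and
a further loop evaluates the circuit gate by gate (`inPolyTime_of_loopComputable`). -/

/-! ### Structured programs for stack machines -/

namespace StackCode

open Turing Turing.TM2

variable {K : Type} {Γ : K → Type} {σ : Type}

/-- Replace the targets of the jumps of a statement. -/
def relabel {Λ Λ' : Type} (g : Λ → Λ') : Stmt Γ Λ σ → Stmt Γ Λ' σ
  | .push k f q => .push k f (relabel g q)
  | .peek k f q => .peek k f (relabel g q)
  | .pop k f q => .pop k f (relabel g q)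
  | .load f q => .load f (relabel g q)
  | .branch f q r => .branch f (relabel g q) (relabel g r)
  | .goto f => .goto fun v => g (f v)
  | .halt => .halt

theorem stepAux_relabel [DecidableEq K] {Λ Λ' : Type} (g : Λ → Λ') (q : Stmt Γ Λ σ) :
    ∀ (v : σ) (S : ∀ k, List (Γ k)), stepAux (relabel g q) v S =
      ⟨(stepAux q v S).l.map g, (stepAux q v S).var, (stepAux q v S).stk⟩ := by
  induction q with
  | branch f q r ihq ihr =>
    intro v S
    cases h : f v <;> simp [relabel, stepAux, h, ihq, ihr]
  | _ => intros; simp_all [relabel, stepAux]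

/-- Structured programs: `whil q c` runs the statement `q`, and, as long as this ends in a jump to
`true`, the program `c` and then `q` again. -/
inductive Code (Γ : K → Type) (σ : Type) : Type
  | skip
  | seq (c d : Code Γ σ)
  | whil (q : Stmt Γ Bool σ) (c : Code Γ σ)

namespace Code

/-- The labels of the machine that executes a structured program. -/
def Label : Code Γ σ → Type
  | skip => Empty
  | seq c d => c.Label ⊕ d.Label
  | whil _ c => Option c.Label

noncomputable instance labelFintype : ∀ c : Code Γ σ, Fintype c.Label
  | skip => inferInstanceAs (Fintype Empty)
  | seq c d =>
    letI := labelFintype c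
    letI := labelFintype d
    inferInstanceAs (Fintype (c.Label ⊕ d.Label))
  | whil _ c =>
    letI := labelFintype c
    inferInstanceAs (Fintype (Option c.Label))

variable {L : Type}

/-- The first label of a program whose labels are embedded by `f`, with exit `x`. -/
def entry : (c : Code Γ σ) → (c.Label → L) → L → L
  | skip, _, x => x
  | seq c d, f, x => c.entry (fun l => f (.inl l)) (d.entry (fun l => f (.inr l)) x)
  | whil _ _, f, _ => f none

/-- The statements at the labels of a program. -/
def stmt : (c : Code Γ σ) → (c.Label → L) → L → c.Label → Stmt Γ L σ
  | seq c d, f, x, .inl l =>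
    c.stmt (fun l => f (.inl l)) (d.entry (fun l => f (.inr l)) x) l
  | seq _ d, f, x, .inr l => d.stmt (fun l => f (.inr l)) x l
  | whil q c, f, x, none =>
    relabel (fun b : Bool => if b then c.entry (fun l => f (some l)) (f none) else x) q
  | whil _ c, f, _, some l => c.stmt (fun l => f (some l)) (f none) l

end Code

variable [DecidableEq K]

/-- `Runs Ok c S S' t`: from the stacks `S`, the program `c` ends with the stacks `S'` after at most
`t` steps, and every configuration on the way satisfies `Ok`. -/
inductive Runs (Ok : (∀ k, List (Γ k)) → Prop) :
    Code Γ σ → (∀ k, List (Γ k)) → (∀ k, List (Γ k)) → ℕ → Prop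
  | skip (S) (T : ℕ) : Runs Ok .skip S S T
  | seq {c d S S' S'' t t' T} : Runs Ok c S S' t → Runs Ok d S' S'' t' → t + t' ≤ T →
      Runs Ok (.seq c d) S S'' T
  | halt {q c S S' T} : Ok S → (∀ v, ∃ v', stepAux q v S = ⟨some false, v', S'⟩) → 1 ≤ T →
      Runs Ok (.whil q c) S S' T
  | loop {q c S S₁ S₂ S₃ t t' T} : Ok S → (∀ v, ∃ v', stepAux q v S = ⟨some true, v', S₁⟩) →
      Runs Ok c S₁ S₂ t → Runs Ok (.whil q c) S₂ S₃ t' → t + t' + 1 ≤ T →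
      Runs Ok (.whil q c) S S₃ T

theorem Runs.mono {Ok : (∀ k, List (Γ k)) → Prop} {c : Code Γ σ} {S S' t T}
    (h : Runs Ok c S S' t) (hT : t ≤ T) : Runs Ok c S S' T := by
  cases h with
  | skip => exact .skip _ _
  | seq h₁ h₂ h => exact .seq h₁ h₂ (h.trans hT)
  | halt h₁ h₂ h => exact .halt h₁ h₂ (h.trans hT)
  | loop h₁ h₂ h₃ h₄ h => exact .loop h₁ h₂ h₃ h₄ (h.trans hT)

/-- A path of configurations satisfying `Ok`, the last one excepted. -/
inductive Path {L : Type} (M : L → Stmt Γ L σ) (Ok : (∀ k, List (Γ k)) → Prop) :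
    Cfg Γ L σ → Cfg Γ L σ → ℕ → Prop
  | refl (c) : Path M Ok c c 0
  | head {c c' c'' t} : Ok c.stk → step M c = some c' → Path M Ok c' c'' t →
      Path M Ok c c'' (t + 1)

namespace Path

variable {L : Type} {M : L → Stmt Γ L σ} {Ok : (∀ k, List (Γ k)) → Prop}

theorem trans {a b c : Cfg Γ L σ} {s t : ℕ} (h : Path M Ok a b s) (h' : Path M Ok b c t) :
    Path M Ok a c (s + t) := by
  induction h with
  | refl => simpa using h'
  | head h₁ h₂ _ ih => simpa [Nat.add_right_comm] using Path.head h₁ h₂ (ih h')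

theorem iterate {a b : Cfg Γ L σ} {t : ℕ} (h : Path M Ok a b t) :
    (flip bind (step M))^[t] (some a) = some b := by
  induction h with
  | refl => rfl
  | head _ h₂ _ ih =>
    rw [Function.iterate_succ_apply]
    simpa [flip, h₂] using ih

/-- The machine is deterministic and stops at `b`, so that every reachable configuration lies on the
path. In this way a bound along one run becomes the bound on all reachable configurations that the
definition of linear space demands. -/
theorem ok_of_reaches {a b c : Cfg Γ L σ} {t : ℕ} (h : Path M Ok a b t) (hb : Ok b.stk)
    (hs : step M b = none) (hc : StateTransition.Reaches (step M) a c) : Ok c.stk := by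
  induction h with
  | refl b =>
    rcases Relation.ReflTransGen.cases_head hc with rfl | ⟨d, hd, -⟩
    · exact hb
    · simp [hs] at hd
  | head h₁ h₂ _ ih =>
    rcases Relation.ReflTransGen.cases_head hc with rfl | ⟨d, hd, hdc⟩
    · exact h₁
    · rw [h₂] at hd
      obtain rfl := Option.some_injective _ hd
      exact ih hb hs hdc

end Path

/-- A machine that contains the statements of a program executes it. -/
theorem Runs.exists_path {Ok : (∀ k, List (Γ k)) → Prop} {L : Type} {M : L → Stmt Γ L σ}
    {c : Code Γ σ} {S S' T} (h : Runs Ok c S S' T) :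
    ∀ (f : c.Label → L) (x : L), (∀ l, M (f l) = c.stmt f x l) →
      ∀ v, ∃ v', ∃ t ≤ T, Path M Ok ⟨some (c.entry f x), v, S⟩ ⟨some x, v', S'⟩ t := by
  induction h with
  | skip => exact fun f x _ v => ⟨v, 0, Nat.zero_le _, .refl _⟩
  | @seq c d _ _ _ _ _ _ _ _ hT ih₁ ih₂ =>
    intro f x hM v
    obtain ⟨v₁, t₁, ht₁, p₁⟩ := ih₁ (fun l => f (.inl l)) (d.entry (fun l => f (.inr l)) x)
      (fun l => hM (.inl l)) v
    obtain ⟨v₂, t₂, ht₂, p₂⟩ := ih₂ (fun l => f (.inr l)) x (fun l => hM (.inr l)) v₁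
    exact ⟨v₂, t₁ + t₂, by omega, p₁.trans p₂⟩
  | @halt q c S S' T hS hq hT =>
    intro f x hM v
    obtain ⟨v', hv⟩ := hq v
    refine ⟨v', 1, hT, .head hS ?_ (.refl _)⟩
    simp [Code.entry, hM none, Code.stmt, stepAux_relabel, hv]
  | @loop q c S S₁ S₂ S₃ t t' T hS hq _ _ hT ih₁ ih₂ =>
    intro f x hM v
    obtain ⟨v₁, hv⟩ := hq v
    obtain ⟨v₂, t₂, ht₂, p₂⟩ := ih₁ (fun l => f (some l)) (f none) (fun l => hM (some l)) v₁
    obtain ⟨v₃, t₃, ht₃, p₃⟩ := ih₂ f x hM v₂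
    refine ⟨v₃, t₂ + t₃ + 1, by omega, .head hS ?_ (p₂.trans p₃)⟩
    simp [Code.entry, hM none, Code.stmt, stepAux_relabel, hv]

end StackCode

/-! ### Binary representations -/

namespace StackCode

/-- The standard encoding passes through `Num`; all arithmetic below works on `Nat.bits`, least
significant digit first. -/
theorem encodeNat_eq_bits (n : ℕ) : Computability.encodeNat n = n.bits := by
  induction n using Nat.binaryRecFromOne with
  | zero => rfl
  | one => rfl
  | bit b n h ih =>
    rw [Nat.bits_append_bit n b (fun h' => absurd h' h), ← ih]
    have hb : ((Nat.bit b n : ℕ) : Num) = cond b Num.bit1 Num.bit0 (n : Num) := Num.ofNat'_bit b n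
    have hn : (n : Num) ≠ 0 := by
      intro h'
      apply h
      have := congrArg (fun m : Num => (m : ℕ)) h'
      simpa using this
    unfold Computability.encodeNat
    rw [hb]
    rcases hm : (n : Num) with _ | m
    · exact absurd hm hn
    · cases b <;> rfl

/-- The successor on binary words. -/
def incBits : List Bool → List Bool
  | [] => [true]
  | false :: l => true :: l
  | true :: l => false :: incBits l

/-- The predecessor on binary words. -/
def decBits : List Bool → List Bool
  | [] => []
  | [true] => []
  | true :: x :: l => false :: x :: l
  | false :: l => true :: decBits l

theorem bits_succ (n : ℕ) : (n + 1).bits = incBits n.bits := by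
  induction n using Nat.binaryRecFromOne with
  | zero => simp [incBits]
  | one => rfl
  | bit b n h ih =>
    rw [Nat.bits_append_bit n b (fun h' => absurd h' h)]
    cases b
    · rw [incBits, ← Nat.bits_append_bit n true (fun _ => rfl)]
      rfl
    · rw [incBits, ← ih, ← Nat.bits_append_bit (n + 1) false (fun h' => absurd h' n.succ_ne_zero)]
      congr 1

/-- The predecessor drops a leading zero that it creates, so it inverts the successor only on words
without leading zeros. The word `[false]`, which is mapped to `[true]` and then to `[]`, shows that
the hypothesis matters. -/
theorem decBits_incBits : ∀ l : List Bool, (∀ h : l ≠ [], l.getLast h = true) →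
    decBits (incBits l) = l
  | [], _ => rfl
  | false :: [], h => by simp at h
  | false :: x :: l, _ => rfl
  | true :: l, h => by
    have h' : ∀ h : l ≠ [], l.getLast h = true := by
      intro hl
      have := h (by simp)
      rwa [List.getLast_cons hl] at this
    rw [incBits, decBits, decBits_incBits l h']

theorem getLast_bits (n : ℕ) (h : n.bits ≠ []) : n.bits.getLast h = true := by
  induction n using Nat.binaryRecFromOne with
  | zero => simp at h
  | one => rfl
  | bit b n hn ih =>
    have hb := Nat.bits_append_bit n b (fun h' => absurd h' hn)
    have hne : n.bits ≠ [] := by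
      intro h0
      have := Nat.size_eq_bits_len n
      rw [h0] at this
      exact hn (Nat.size_eq_zero.1 this.symm)
    simp only [hb, List.getLast_cons hne]
    exact ih hne

theorem bits_pred (n : ℕ) : (n - 1).bits = decBits n.bits := by
  rcases n with _ | n
  · simp [decBits]
  · rw [bits_succ, decBits_incBits _ (getLast_bits n)]
    rfl

theorem bits_eq_nil {n : ℕ} : n.bits = [] ↔ n = 0 := by
  rw [← List.length_eq_zero_iff, Nat.size_eq_bits_len, Nat.size_eq_zero]

end StackCode

/-! ### Elementary programs on Boolean stacks -/

namespace StackCode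

open Turing Turing.TM2

/-- The stacks: an input stack, an output stack and stacks of bits. -/
inductive Stk (ι : Type) : Type
  | inp
  | out
  | bs (j : ι)
  deriving DecidableEq, Fintype

/-- The stack alphabets. -/
abbrev Alph (Γi Γo ι : Type) : Stk ι → Type
  | .inp => Γi
  | .out => Γo
  | .bs _ => Bool

/-- The internal state of the machine: the last symbol read. -/
abbrev Reg : Type := Option (Bool ⊕ Bool)

/-- The last bit read. -/
def bit : Reg → Bool
  | some (.inl x) => x
  | _ => false

variable {ι Γi Γo : Type}

/-- The contents of all stacks. -/
def stkOf (i : List Γi) (o : List Γo) (b : ι → List Bool) : ∀ k, List (Alph Γi Γo ι k)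
  | .inp => i
  | .out => o
  | .bs j => b j

section

variable (i : List Γi) (o : List Γo) (b : ι → List Bool)

@[simp] theorem stkOf_inp : stkOf i o b .inp = i := rfl
@[simp] theorem stkOf_out : stkOf i o b .out = o := rfl
@[simp] theorem stkOf_bs (j : ι) : stkOf i o b (.bs j) = b j := rfl

variable [DecidableEq ι]

@[simp] theorem update_stkOf_bs (j : ι) (l : List Bool) :
    Function.update (stkOf i o b) (.bs j) l = stkOf i o (Function.update b j l) := by
  funext k
  rcases k with _ | _ | m
  · simp
  · simp
  · by_cases h : m = j
    · subst h; simp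
    · simp [h]

@[simp] theorem update_stkOf_inp (l : List Γi) :
    Function.update (stkOf i o b) .inp l = stkOf l o b := by
  funext k; rcases k with _ | _ | m <;> simp

@[simp] theorem update_stkOf_out (l : List Γo) :
    Function.update (stkOf i o b) .out l = stkOf i l b := by
  funext k; rcases k with _ | _ | m <;> simp

end

/-- No stack is higher than `ℓ`. -/
def Bounded (ℓ : ℕ) (S : ∀ k, List (Alph Γi Γo ι k)) : Prop := ∀ k, (S k).length ≤ ℓ

theorem bounded_stkOf {ℓ : ℕ} {i : List Γi} {o : List Γo} {b : ι → List Bool} :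
    Bounded ℓ (stkOf i o b) ↔ i.length ≤ ℓ ∧ o.length ≤ ℓ ∧ ∀ j, (b j).length ≤ ℓ :=
  ⟨fun h => ⟨h .inp, h .out, fun j => h (.bs j)⟩,
    fun h k => match k with
      | .inp => h.1
      | .out => h.2.1
      | .bs j => h.2.2 j⟩

/-- Statements and programs over these stacks. -/
abbrev St (Γi Γo ι : Type) : Type := Stmt (Alph Γi Γo ι) Bool Reg
abbrev Pr (Γi Γo ι : Type) : Type := Code (Alph Γi Γo ι) Reg

/-- The two ways in which the body of a loop may end: another round, or the exit. -/
def again : St Γi Γo ι := .goto fun _ => true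
def done : St Γi Γo ι := .goto fun _ => false

/-- Read a bit. -/
def popBit (j : ι) (q : St Γi Γo ι) : St Γi Γo ι :=
  .pop (Stk.bs j) (fun _ x => x.map Sum.inl) q

def peekBit (j : ι) (q : St Γi Γo ι) : St Γi Γo ι :=
  .peek (Stk.bs j) (fun _ x => x.map Sum.inl) q

def pushBit (j : ι) (f : Reg → Bool) (q : St Γi Γo ι) : St Γi Γo ι := .push (Stk.bs j) f q

def ifBit (f : Reg → Bool) (q r : St Γi Γo ι) : St Γi Γo ι := .branch f q r

section

variable [DecidableEq ι] (i : List Γi) (o : List Γo) (b : ι → List Bool) (v : Reg)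
variable (q r : St Γi Γo ι)

@[simp] theorem stepAux_again : stepAux (again : St Γi Γo ι) v (stkOf i o b) =
    ⟨some true, v, stkOf i o b⟩ := rfl

@[simp] theorem stepAux_done : stepAux (done : St Γi Γo ι) v (stkOf i o b) =
    ⟨some false, v, stkOf i o b⟩ := rfl

@[simp] theorem stepAux_popBit (j : ι) : stepAux (popBit j q) v (stkOf i o b) =
    stepAux q ((b j).head?.map Sum.inl) (stkOf i o (Function.update b j (b j).tail)) := by
  simp [popBit, stepAux]

@[simp] theorem stepAux_peekBit (j : ι) : stepAux (peekBit j q) v (stkOf i o b) =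
    stepAux q ((b j).head?.map Sum.inl) (stkOf i o b) := rfl

@[simp] theorem stepAux_pushBit (j : ι) (f : Reg → Bool) :
    stepAux (pushBit j f q) v (stkOf i o b) =
      stepAux q v (stkOf i o (Function.update b j (f v :: b j))) := by
  simp [pushBit, stepAux]

@[simp] theorem stepAux_ifBit (f : Reg → Bool) : stepAux (ifBit f q r) v (stkOf i o b) =
    if f v then stepAux q v (stkOf i o b) else stepAux r v (stkOf i o b) := by
  cases h : f v <;> simp [ifBit, stepAux, h]

end

variable [DecidableEq ι]

/-- A statement that is executed once. -/
def once (q : St Γi Γo ι) : Pr Γi Γo ι := .whil q .skip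

/-- Push the last bit read onto all of the given stacks. -/
def pushAll : List ι → St Γi Γo ι → St Γi Γo ι
  | [], q => q
  | j :: js, q => pushBit j bit (pushAll js q)

theorem stepAux_pushAll (i : List Γi) (o : List Γo) (v : Reg) (q : St Γi Γo ι) :
    ∀ (js : List ι) (_ : js.Nodup) (b : ι → List Bool),
      stepAux (pushAll js q) v (stkOf i o b) =
        stepAux q v (stkOf i o (fun m => if m ∈ js then bit v :: b m else b m)) := by
  intro js
  induction js with
  | nil => intro _ b; simp [pushAll]
  | cons j js ih =>
    intro h b
    rw [List.nodup_cons] at h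
    rw [pushAll, stepAux_pushBit, ih h.2]
    congr 2
    funext m
    by_cases hm : m = j
    · subst hm; simp [h.1]
    · simp [hm]

/-- Empty the stack `j` onto the stacks `js`. -/
def drain (j : ι) (js : List ι) : Pr Γi Γo ι :=
  .whil (popBit j (ifBit Option.isSome (pushAll js again) done)) .skip

/-- The contents arrive in reverse order; two drains in succession therefore copy or move a stack
faithfully, and a drain without targets clears it. The time is one round per symbol and one for the
failing test. -/
theorem runs_drain {ℓ : ℕ} {i : List Γi} {o : List Γo} (hi : i.length ≤ ℓ) (ho : o.length ≤ ℓ)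
    {j : ι} {js : List ι} (hjs : (j :: js).Nodup) (l : List Bool) :
    ∀ b : ι → List Bool, b j = l → (∀ m, (b m).length ≤ ℓ) →
      (∀ m ∈ js, l.length + (b m).length ≤ ℓ) →
      Runs (Bounded ℓ) (drain j js) (stkOf i o b)
        (stkOf i o fun m => if m = j then [] else if m ∈ js then l.reverse ++ b m else b m)
        (l.length + 1) := by
  rw [List.nodup_cons] at hjs
  induction l with
  | nil =>
    intro b hb hl _
    refine .halt (bounded_stkOf.2 ⟨hi, ho, hl⟩) (fun v => ⟨none, ?_⟩) (by simp)
    simp only [stepAux_popBit, hb, stepAux_ifBit]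
    simp only [List.head?_nil, Option.map_none, Option.isSome_none, Bool.false_eq_true, if_false,
      stepAux_done]
    congr 2
    funext m
    by_cases h : m = j <;> simp [h]
  | cons x l ih =>
    intro b hb hl hs
    let b₁ : ι → List Bool := fun m =>
      if m ∈ js then x :: Function.update b j l m else Function.update b j l m
    have hb₁ : b₁ j = l := by simp [b₁, hjs.1]
    have hb₁' : ∀ m, m ≠ j → b₁ m = if m ∈ js then x :: b m else b m := by
      intro m hm
      simp [b₁, hm]
    have key := ih b₁ hb₁ (by
        intro m
        by_cases h : m = j
        · subst h
          rw [hb₁]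
          have := hl m
          rw [hb] at this
          simp at this
          omega
        · rw [hb₁' m h]
          split_ifs with h'
          · have := hs m h'
            simp at this ⊢
            omega
          · exact hl m) (by
        intro m hm
        have hne : m ≠ j := fun h => hjs.1 (h ▸ hm)
        have := hs m hm
        rw [hb₁' m hne, if_pos hm]
        simp at this ⊢
        omega)
    refine .loop (bounded_stkOf.2 ⟨hi, ho, hl⟩) (fun v => ⟨some (.inl x), ?_⟩) (.skip _ 0)
      (S₁ := stkOf i o b₁) ?_ (t' := l.length + 1) (by simp)
    · simp only [stepAux_popBit, hb, stepAux_ifBit]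
      simp only [List.head?_cons, Option.map_some, Option.isSome_some, if_true,
        stepAux_pushAll _ _ _ _ js hjs.2, stepAux_again, List.tail_cons]
      rfl
    · convert key using 2
      · rfl
      funext m
      by_cases h : m = j
      · simp [h]
      · simp only [if_neg h, hb₁' m h]
        split_ifs <;> simp

/-- Increment the binary number on the stack `r`. -/
def incCode (aux r : ι) : Pr Γi Γo ι :=
  .seq (.whil (popBit r (ifBit (fun v => decide (v = some (.inl true)))
    (pushBit aux (fun _ => false) again) (pushBit r (fun _ => true) done))) .skip)
    (drain aux [r])

/-- Decrement the binary number on the stack `r`. -/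
def decCode (aux r : ι) : Pr Γi Γo ι :=
  .seq (.whil (popBit r (ifBit (fun v => decide (v = some (.inl false)))
    (pushBit aux (fun _ => true) again)
    (ifBit (fun v => decide (v = some (.inl true)))
      (peekBit r (ifBit Option.isSome (pushBit r (fun _ => false) done) done)) done))) .skip)
    (drain aux [r])

theorem update_update_eq {aux r : ι} (har : aux ≠ r) (b : ι → List Bool) (l : List Bool)
    (c : ι → List Bool) (hr : c r = l) (ha : c aux = []) (h : ∀ m, m ≠ r → m ≠ aux → c m = b m)
    (hb : b aux = []) : c = Function.update b r l := by
  funext m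
  by_cases h₁ : m = r
  · subst h₁; simp [hr]
  · by_cases h₂ : m = aux
    · subst h₂; simp [har, ha, hb]
    · simp [h₁, h m h₁ h₂]

/-- A loop that turns the stack `r` into another one, using the stack `aux`, followed by the return
of the contents of `aux`. -/
theorem runs_seq_drain {ℓ : ℕ} {i : List Γi} {o : List Γo} (hi : i.length ≤ ℓ)
    (ho : o.length ≤ ℓ) {aux r : ι} (har : aux ≠ r) {c : Pr Γi Γo ι} {g : List Bool → List Bool}
    {m : ℕ} (hm : m ≤ ℓ)
    (hc : ∀ (l : List Bool) (b : ι → List Bool), b r = l → (∀ j, (b j).length ≤ ℓ) →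
      l.length + (b aux).length + 1 ≤ m →
      ∃ l' a', Runs (Bounded ℓ) c (stkOf i o b)
        (stkOf i o (Function.update (Function.update b r l') aux a')) (l.length + 1) ∧
        a'.reverse ++ l' = (b aux).reverse ++ g l ∧
        l'.length + a'.length ≤ m ∧ a'.length ≤ (b aux).length + l.length)
    (b : ι → List Bool) (hb : ∀ j, (b j).length ≤ ℓ) (ha : b aux = [])
    (hr : (b r).length + 1 ≤ m) :
    Runs (Bounded ℓ) (.seq c (drain aux [r])) (stkOf i o b)
      (stkOf i o (Function.update b r (g (b r)))) (2 * (b r).length + 2) := by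
  obtain ⟨l', a', h₁, h₂, h₃, h₄⟩ := hc (b r) b rfl hb (by simpa [ha] using hr)
  rw [ha] at h₂ h₄
  have h₅ := runs_drain (i := i) (o := o) hi ho (j := aux) (js := [r]) (by simp [har]) a'
    (Function.update (Function.update b r l') aux a') (by simp) (by
      intro j
      by_cases hj : j = aux
      · subst hj; simp; omega
      · by_cases hj' : j = r
        · subst hj'; simp [hj]; omega
        · simpa [hj, hj'] using hb j) (by
      intro j hj
      rw [List.mem_singleton] at hj
      subst hj
      simp [har.symm]; omega)
  refine .seq h₁ (S'' := _) ?_ (t' := a'.length + 1) (by simp at h₄; omega)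
  convert h₅ using 2
  symm
  apply update_update_eq har
  · simpa [har.symm] using h₂
  · simp
  · intro m h₁ h₂
    simp [h₁, h₂]
  · exact ha

theorem runs_incCode {ℓ : ℕ} {i : List Γi} {o : List Γo} (hi : i.length ≤ ℓ)
    (ho : o.length ≤ ℓ) {aux r : ι} (har : aux ≠ r) (b : ι → List Bool)
    (hb : ∀ j, (b j).length ≤ ℓ) (ha : b aux = []) (hr : (b r).length + 1 ≤ ℓ) :
    Runs (Bounded ℓ) (incCode aux r) (stkOf i o b)
      (stkOf i o (Function.update b r (incBits (b r)))) (2 * (b r).length + 2) := by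
  -- The loop is treated for arbitrary contents of `aux`: when the induction on `l` recurs, the
  -- digits passed by the carry have already been collected there.
  refine runs_seq_drain hi ho har le_rfl ?_ b hb ha hr
  intro l
  induction l with
  | nil =>
    intro b hr hb hl
    refine ⟨[true], b aux, .halt (bounded_stkOf.2 ⟨hi, ho, hb⟩) (fun v => ⟨none, ?_⟩) (by simp),
      by simp [incBits], by simp at hl ⊢; omega, by simp⟩
    simp [hr]
    congr 1
    rw [← Function.update_of_ne har [true] b]
    simp
  | cons x l ih =>
    intro b hr hb hl
    simp only [List.length_cons] at hl
    cases x
    · refine ⟨true :: l, b aux, .halt (bounded_stkOf.2 ⟨hi, ho, hb⟩)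
        (fun v => ⟨some (.inl false), ?_⟩) (by simp),
        by simp [incBits], by simp; omega, by simp⟩
      simp [hr]
      congr 1
      rw [← Function.update_of_ne har (true :: l) b]
      simp
    · obtain ⟨l', a', h₁, h₂, h₃, h₄⟩ := ih
        (Function.update (Function.update b r l) aux (false :: b aux))
        (by simp [har.symm]) (by
          intro j
          by_cases hj : j = aux
          · subst hj; simp; omega
          · by_cases hj' : j = r
            · subst hj'; simp [hj]; omega
            · simpa [hj, hj'] using hb j) (by simp; omega)
      refine ⟨l', a', .loop (bounded_stkOf.2 ⟨hi, ho, hb⟩) (fun v => ⟨some (.inl true), ?_⟩)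
        (.skip _ 0) (t' := l.length + 1) (S₁ := stkOf i o
          (Function.update (Function.update b r l) aux (false :: b aux))) ?_ (by simp), ?_, h₃, ?_⟩
      · simp [hr, har]
      · convert h₁ using 2
        funext m
        by_cases hm : m = aux
        · subst hm; simp
        · by_cases hm' : m = r
          · subst hm'; simp [hm]
          · simp [hm, hm']
      · simpa [incBits] using h₂
      · simp at h₄ ⊢; omega

theorem runs_decCode {ℓ : ℕ} {i : List Γi} {o : List Γo} (hi : i.length ≤ ℓ)
    (ho : o.length ≤ ℓ) {aux r : ι} (har : aux ≠ r) (b : ι → List Bool)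
    (hb : ∀ j, (b j).length ≤ ℓ) (ha : b aux = []) (hr : (b r).length + 1 ≤ ℓ) :
    Runs (Bounded ℓ) (decCode aux r) (stkOf i o b)
      (stkOf i o (Function.update b r (decBits (b r)))) (2 * (b r).length + 2) := by
  refine runs_seq_drain hi ho har le_rfl ?_ b hb ha hr
  intro l
  induction l with
  | nil =>
    intro b hr hb hl
    refine ⟨[], b aux, .halt (bounded_stkOf.2 ⟨hi, ho, hb⟩) (fun v => ⟨none, ?_⟩) (by simp),
      by simp [decBits], by simp at hl ⊢; omega, by simp⟩
    simp [hr]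
    congr 1
    rw [← Function.update_of_ne har [] b]
    simp
  | cons x l ih =>
    intro b hr hb hl
    simp only [List.length_cons] at hl
    cases x
    · obtain ⟨l', a', h₁, h₂, h₃, h₄⟩ := ih
        (Function.update (Function.update b r l) aux (true :: b aux))
        (by simp [har.symm]) (by
          intro j
          by_cases hj : j = aux
          · subst hj; simp; omega
          · by_cases hj' : j = r
            · subst hj'; simp [hj]; omega
            · simpa [hj, hj'] using hb j) (by simp; omega)
      refine ⟨l', a', .loop (bounded_stkOf.2 ⟨hi, ho, hb⟩) (fun v => ⟨some (.inl false), ?_⟩)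
        (.skip _ 0) (t' := l.length + 1) (S₁ := stkOf i o
          (Function.update (Function.update b r l) aux (true :: b aux))) ?_ (by simp), ?_, h₃, ?_⟩
      · simp [hr, har]
      · convert h₁ using 2
        funext m
        by_cases hm : m = aux
        · subst hm; simp
        · by_cases hm' : m = r
          · subst hm'; simp [hm]
          · simp [hm, hm']
      · simpa [decBits] using h₂
      · simp at h₄ ⊢; omega
    · rcases l with _ | ⟨y, l⟩
      · refine ⟨[], b aux, .halt (bounded_stkOf.2 ⟨hi, ho, hb⟩)
          (fun v => ⟨none, ?_⟩) (by simp),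
          by simp [decBits], by simp at hl ⊢; omega, by simp⟩
        simp [hr]
        congr 1
        rw [← Function.update_of_ne har [] b]
        simp
      · refine ⟨false :: y :: l, b aux, .halt (bounded_stkOf.2 ⟨hi, ho, hb⟩)
          (fun v => ⟨some (.inl y), ?_⟩) (by simp),
          by simp [decBits], by simp at hl ⊢; omega, by simp⟩
        simp [hr]
        congr 1
        rw [← Function.update_of_ne har (false :: y :: l) b]
        simp

end StackCode

/-! ### Loop programs -/

namespace StackCode

open Turing Turing.TM2

/-- The memory of a loop program: registers for natural numbers, a list `A` and a second list `T`
that gives access to the inner elements of `A`. -/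
structure Store where
  reg : ℕ → ℕ
  A : List Bool
  T : List Bool

/-- Loop programs. -/
inductive Prog : Type
  | inc (r : ℕ)
  | dec (r : ℕ)
  | seq (p q : Prog)
  | loop (r : ℕ) (p : Prog)
  | moveAT
  | moveTA
  | peek (r : ℕ)
  | push (r : ℕ)

namespace Prog

/-- The effect of a program. The number of rounds of a loop is fixed at its beginning. -/
def run : Prog → Store → Store
  | inc r, s => { s with reg := Function.update s.reg r (s.reg r + 1) }
  | dec r, s => { s with reg := Function.update s.reg r (s.reg r - 1) }
  | seq p q, s => q.run (p.run s)
  | loop r p, s => p.run^[s.reg r] s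
  | moveAT, s => { s with A := s.A.tail, T := s.A.head?.toList ++ s.T }
  | moveTA, s => { s with T := s.T.tail, A := s.T.head?.toList ++ s.A }
  | peek r, s => { s with reg := Function.update s.reg r (s.A.headD false).toNat }
  | push r, s => { s with A := decide (s.reg r ≠ 0) :: s.A }

/-- No register exceeds `V`, and no list the length `Λ`, in the course of the execution. -/
def Safe (V Λ : ℕ) : Prog → Store → Prop
  | inc r, s => s.reg r < V
  | seq p q, s => p.Safe V Λ s ∧ q.Safe V Λ (p.run s)
  | loop r p, s => ∀ i < s.reg r, p.Safe V Λ (p.run^[i] s)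
  | peek _, _ => 1 ≤ V
  | push _, s => s.A.length + s.T.length < Λ
  | _, _ => True

/-- The program uses only registers below `k`, and its loops are nested to a depth at most
`k - d`. -/
def Fits (k : ℕ) : ℕ → Prog → Prop
  | _, inc r => r < k
  | _, dec r => r < k
  | d, seq p q => p.Fits k d ∧ q.Fits k d
  | d, loop r p => r < k ∧ d < k ∧ p.Fits k (d + 1)
  | _, peek r => r < k
  | _, push r => r < k
  | _, _ => True

theorem Fits.mono {k k' : ℕ} (h : k ≤ k') {p : Prog} : ∀ {d : ℕ}, p.Fits k d → p.Fits k' d := by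
  induction p with
  | seq p q ihp ihq => exact fun hp => ⟨ihp hp.1, ihq hp.2⟩
  | loop r p ih => exact fun hp => ⟨by have := hp.1; omega, by have := hp.2.1; omega, ih hp.2.2⟩
  | moveAT => exact fun _ => trivial
  | moveTA => exact fun _ => trivial
  | _ => intro d hp; simp only [Fits] at hp ⊢; omega

theorem exists_fits (p : Prog) : ∀ d : ℕ, ∃ k, p.Fits k d := by
  induction p with
  | inc r => exact fun _ => ⟨r + 1, r.lt_succ_self⟩
  | dec r => exact fun _ => ⟨r + 1, r.lt_succ_self⟩
  | peek r => exact fun _ => ⟨r + 1, r.lt_succ_self⟩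
  | push r => exact fun _ => ⟨r + 1, r.lt_succ_self⟩
  | moveAT => exact fun _ => ⟨0, trivial⟩
  | moveTA => exact fun _ => ⟨0, trivial⟩
  | seq p q ihp ihq =>
    intro d
    obtain ⟨k, hk⟩ := ihp d
    obtain ⟨k', hk'⟩ := ihq d
    exact ⟨max k k', hk.mono (le_max_left _ _), hk'.mono (le_max_right _ _)⟩
  | loop r p ih =>
    intro d
    obtain ⟨k, hk⟩ := ih (d + 1)
    exact ⟨max k (max (r + 1) (d + 1)), by omega, by omega, hk.mono (le_max_left _ _)⟩

theorem Safe.mono {V V' Λ Λ' : ℕ} (hV : V ≤ V') (hΛ : Λ ≤ Λ') {p : Prog} :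
    ∀ {s : Store}, p.Safe V Λ s → p.Safe V' Λ' s := by
  induction p with
  | inc r => exact fun h => lt_of_lt_of_le h hV
  | seq p q ihp ihq => exact fun h => ⟨ihp h.1, ihq h.2⟩
  | loop r p ih => exact fun h i hi => ih (h i hi)
  | peek r => exact fun h => le_trans h hV
  | push r => exact fun h => lt_of_lt_of_le h hΛ
  | _ => exact fun _ => trivial

/-- The bounds of `Safe`, for a single memory. -/
def Within (V Λ : ℕ) (s : Store) : Prop := (∀ r, s.reg r ≤ V) ∧ s.A.length + s.T.length ≤ Λ

/-- `Safe` only constrains the operations that can exceed the bounds; together with the bounds at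
the beginning it yields the bounds at the end. -/
theorem Safe.within {V Λ : ℕ} {p : Prog} :
    ∀ {s : Store}, p.Safe V Λ s → Within V Λ s → Within V Λ (p.run s) := by
  induction p with
  | inc r =>
    intro s h hs
    refine ⟨fun r' => ?_, hs.2⟩
    by_cases hr : r' = r
    · subst hr; simpa [run, Safe, Nat.succ_le_iff] using h
    · simpa [run, hr] using hs.1 r'
  | dec r =>
    intro s h hs
    refine ⟨fun r' => ?_, hs.2⟩
    by_cases hr : r' = r
    · subst hr; have := hs.1 r'; simp [run]; omega
    · simpa [run, hr] using hs.1 r'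
  | seq p q ihp ihq => exact fun h hs => ihq h.2 (ihp h.1 hs)
  | loop r p ih =>
    intro s h hs
    have : ∀ i ≤ s.reg r, Within V Λ (p.run^[i] s) := by
      intro i
      induction i with
      | zero => exact fun _ => hs
      | succ i ihi =>
        intro hi
        rw [Function.iterate_succ_apply']
        exact ih (h i hi) (ihi (by omega))
    exact this _ le_rfl
  | moveAT =>
    intro s _ hs
    refine ⟨hs.1, le_trans (le_of_eq ?_) hs.2⟩
    rcases hA : s.A with _ | ⟨x, l⟩ <;> simp [run, hA]
    omega
  | moveTA =>
    intro s _ hs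
    refine ⟨hs.1, le_trans (le_of_eq ?_) hs.2⟩
    rcases hA : s.T with _ | ⟨x, l⟩ <;> simp [run, hA]
    omega
  | peek r =>
    intro s h hs
    refine ⟨fun r' => ?_, hs.2⟩
    by_cases hr : r' = r
    · subst hr; simp only [run, Function.update_self]; exact (Bool.toNat_le _).trans h
    · simpa [run, hr] using hs.1 r'
  | push r =>
    intro s h hs
    exact ⟨hs.1, by simp only [run, Safe, List.length_cons] at h ⊢; omega⟩

/-- A bound on the time a machine needs for a program, in terms of a bound on the registers. -/
noncomputable def time : Prog → Polynomial ℕ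
  | seq p q => p.time + q.time
  | loop _ p => 2 * .X + 3 + .X * (2 * .X + 3 + p.time)
  | _ => 2 * .X + 2

end Prog

/-- The stacks of bits of the machine for a loop program. -/
inductive Bst (k : ℕ) : Type
  | aux
  | A
  | T
  | reg (j : Fin k)
  | hid (j : Fin k)
  deriving DecidableEq, Fintype

/-- The stacks that represent a memory and the counters of the loops. -/
def rep (k : ℕ) (s : Store) (h : ℕ → ℕ) : Bst k → List Bool
  | .aux => []
  | .A => s.A
  | .T => s.T
  | .reg j => (s.reg j).bits
  | .hid j => (h j).bits

/-- The number `r`, as an index below `k`. -/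
def idx (k : ℕ) [NeZero k] (r : ℕ) : Fin k := Fin.ofNat k r

section rep

variable {k : ℕ} [NeZero k] (s : Store) (h : ℕ → ℕ) {r : ℕ} (n : ℕ)

theorem idx_val (hr : r < k) : (idx k r : ℕ) = r := Nat.mod_eq_of_lt hr

theorem eq_idx_iff (hr : r < k) (j : Fin k) : j = idx k r ↔ (j : ℕ) = r := by
  rw [Fin.ext_iff, idx_val hr]

theorem rep_reg (hr : r < k) : rep k s h (.reg (idx k r)) = (s.reg r).bits := by
  simp [rep, idx_val hr]

theorem rep_hid (hr : r < k) : rep k s h (.hid (idx k r)) = (h r).bits := by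
  simp [rep, idx_val hr]

theorem update_rep_reg (hr : r < k) :
    Function.update (rep k s h) (.reg (idx k r)) n.bits =
      rep k { s with reg := Function.update s.reg r n } h := by
  funext j
  rcases j with _ | _ | _ | j | j
  · simp [rep]
  · simp [rep]
  · simp [rep]
  · by_cases hj : (j : ℕ) = r
    · have := (eq_idx_iff hr j).2 hj
      simp [rep, ← this, hj]
    · have : j ≠ idx k r := fun h' => hj ((eq_idx_iff hr j).1 h')
      simp [rep, this, hj]
  · simp [rep]

theorem update_rep_hid (hr : r < k) :
    Function.update (rep k s h) (.hid (idx k r)) n.bits =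
      rep k s (Function.update h r n) := by
  funext j
  rcases j with _ | _ | _ | j | j
  · simp [rep]
  · simp [rep]
  · simp [rep]
  · simp [rep]
  · by_cases hj : (j : ℕ) = r
    · have := (eq_idx_iff hr j).2 hj
      simp [rep, ← this, hj]
    · have : j ≠ idx k r := fun h' => hj ((eq_idx_iff hr j).1 h')
      simp [rep, this, hj]

end rep

theorem update_rep_A {k : ℕ} (s : Store) (h : ℕ → ℕ) (l : List Bool) :
    Function.update (rep k s h) .A l = rep k { s with A := l } h := by
  funext j; rcases j with _ | _ | _ | j | j <;> simp [rep]

theorem update_rep_T {k : ℕ} (s : Store) (h : ℕ → ℕ) (l : List Bool) :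
    Function.update (rep k s h) .T l = rep k { s with T := l } h := by
  funext j; rcases j with _ | _ | _ | j | j <;> simp [rep]


variable {Γi Γo : Type}

/-- The machine program for a loop program; `d` is the depth of the surrounding loops. -/
def compile (k : ℕ) [NeZero k] : ℕ → Prog → Pr Γi Γo (Bst k)
  | _, .inc r => incCode .aux (.reg (idx k r))
  | _, .dec r => decCode .aux (.reg (idx k r))
  | d, .seq p q => .seq (compile k d p) (compile k d q)
  | d, .loop r p =>
    .seq (.seq (drain (.reg (idx k r)) [.aux])
      (drain .aux [.reg (idx k r), .hid (idx k d)]))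
    (.whil (peekBit (.hid (idx k d)) (ifBit Option.isSome again done))
      (.seq (decCode .aux (.hid (idx k d))) (compile k (d + 1) p)))
  | _, .moveAT => once (popBit .A (ifBit Option.isSome (pushBit .T bit done) done))
  | _, .moveTA => once (popBit .T (ifBit Option.isSome (pushBit .A bit done) done))
  | _, .peek r => .seq (drain (.reg (idx k r)) [])
    (once (peekBit .A (ifBit bit (pushBit (.reg (idx k r)) (fun _ => true) done) done)))
  | _, .push r => once (peekBit (.reg (idx k r)) (pushBit .A Option.isSome done))

theorem size_le_self (n : ℕ) : n.size ≤ n := Nat.size_le.2 Nat.lt_two_pow_self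

theorem bounded_rep {k ℓ V Λ : ℕ} {i : List Γi} {o : List Γo} (hi : i.length ≤ ℓ)
    (ho : o.length ≤ ℓ) (hV : V.size + 1 ≤ ℓ) (hΛ : Λ ≤ ℓ) {s : Store} {h : ℕ → ℕ}
    (hs : Prog.Within V Λ s) (hh : ∀ j, h j ≤ V) :
    Bounded ℓ (stkOf i o (rep k s h)) := by
  refine bounded_stkOf.2 ⟨hi, ho, fun j => ?_⟩
  have h₂ := hs.2
  rcases j with _ | _ | _ | j | j
  · simp [rep]
  · simp only [rep]; omega
  · simp only [rep]; omega
  · have := Nat.size_le_size (hs.1 j)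
    simp only [rep, Nat.size_eq_bits_len]; omega
  · have := Nat.size_le_size (hh j)
    simp only [rep, Nat.size_eq_bits_len]; omega

/-- A loop at depth `d` counts on the hidden stack `d`. The invariant is that the counters from `d`
on are zero before and after, while those of the surrounding loops are unchanged. The counter is a
copy of the register, because the body may alter the register but not the number of rounds. -/
theorem runs_compile {k ℓ V Λ : ℕ} [NeZero k] {i : List Γi} {o : List Γo} (hi : i.length ≤ ℓ)
    (ho : o.length ≤ ℓ) (hV : V.size + 1 ≤ ℓ) (hΛ : Λ ≤ ℓ) (p : Prog) :
    ∀ (d : ℕ) (s : Store) (h : ℕ → ℕ), p.Fits k d → p.Safe V Λ s → Prog.Within V Λ s →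
      (∀ j, h j ≤ V) → (∀ j, d ≤ j → h j = 0) →
      Runs (Bounded ℓ) (compile k d p) (stkOf i o (rep k s h)) (stkOf i o (rep k (p.run s) h))
        (p.time.eval V) := by
  have hVV := size_le_self V
  have len : ∀ {n : ℕ}, n ≤ V → n.bits.length ≤ V.size := fun hn => by
    rw [Nat.size_eq_bits_len]; exact Nat.size_le_size hn
  induction p with
  | inc r =>
    intro d s h hf hS hs hh h0
    have hb := bounded_rep (k := k) hi ho hV hΛ hs hh
    have := runs_incCode hi ho (aux := Bst.aux) (r := .reg (idx k r)) (by simp)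
      (rep k s h) (bounded_stkOf.1 hb).2.2 rfl (by
        rw [rep_reg _ _ hf]; have := len (hs.1 r); omega)
    rw [rep_reg _ _ hf, ← bits_succ, update_rep_reg _ _ _ hf] at this
    refine this.mono ?_
    have := len (hs.1 r)
    simp [Prog.time]; omega
  | dec r =>
    intro d s h hf hS hs hh h0
    have hb := bounded_rep (k := k) hi ho hV hΛ hs hh
    have := runs_decCode hi ho (aux := Bst.aux) (r := .reg (idx k r)) (by simp)
      (rep k s h) (bounded_stkOf.1 hb).2.2 rfl (by
        rw [rep_reg _ _ hf]; have := len (hs.1 r); omega)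
    rw [rep_reg _ _ hf, ← bits_pred, update_rep_reg _ _ _ hf] at this
    refine this.mono ?_
    have := len (hs.1 r)
    simp [Prog.time]; omega
  | seq p q ihp ihq =>
    intro d s h hf hS hs hh h0
    exact .seq (ihp d s h hf.1 hS.1 hs hh h0) (ihq d _ h hf.2 hS.2 (hS.1.within hs) hh h0)
      (by simp [Prog.time])
  | loop r p ih =>
    intro d s h hf hS hs hh h0
    obtain ⟨hr, hd, hf⟩ := hf
    have hb := bounded_rep (k := k) hi ho hV hΛ hs hh
    have hlen := len (hs.1 r)
    -- the loop, from the value `m` of the counter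
    have key : ∀ (m : ℕ) (s : Store), m ≤ V → Prog.Within V Λ s →
        (∀ i < m, p.Safe V Λ (p.run^[i] s)) →
        Runs (Bounded ℓ) (.whil (peekBit (.hid (idx k d)) (ifBit Option.isSome again done))
          (.seq (decCode .aux (.hid (idx k d))) (compile k (d + 1) p)))
          (stkOf i o (rep k s (Function.update h d m))) (stkOf i o (rep k (p.run^[m] s) h))
          (m * (2 * V + 3 + p.time.eval V) + 1) := by
      intro m
      induction m with
      | zero =>
        intro s _ hs _
        have h0' : Function.update h d 0 = h := by
          rw [← h0 d le_rfl]; exact Function.update_eq_self d h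
        rw [h0']
        refine .halt (bounded_rep hi ho hV hΛ hs hh) (fun v => ⟨none, ?_⟩) (by simp)
        rw [stepAux_peekBit, rep_hid _ _ hd, h0 d le_rfl]
        simp
      | succ m ihm =>
        intro s hm hs hS
        have hh' : ∀ n ≤ V, ∀ j, Function.update h d n j ≤ V := by
          intro n hn j
          by_cases hj : j = d
          · subst hj; simpa using hn
          · simpa [hj] using hh j
        have hb := bounded_rep (k := k) hi ho hV hΛ hs (hh' _ hm)
        have h₁ := runs_decCode hi ho (aux := Bst.aux) (r := .hid (idx k d)) (by simp)
          (rep k s (Function.update h d (m + 1))) (bounded_stkOf.1 hb).2.2 rfl (by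
            rw [rep_hid _ _ hd, Function.update_self]
            have := len hm
            omega)
        rw [rep_hid _ _ hd, Function.update_self, ← bits_pred, update_rep_hid _ _ _ hd,
          Function.update_idem, Nat.add_sub_cancel] at h₁
        have h₂ := ih (d + 1) s (Function.update h d m) hf (hS 0 (by omega)) hs
          (hh' m (by omega)) (by
            intro j hj
            rw [Function.update_of_ne (by omega)]
            exact h0 j (by omega))
        have h₃ := ihm (p.run s) (by omega) ((hS 0 (by omega)).within hs) (by
          intro i hi
          have := hS (i + 1) (by omega)
          rwa [Function.iterate_succ_apply] at this)
        rw [← Function.iterate_succ_apply] at h₃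
        have hl := len hm
        refine .loop hb (fun v => ⟨((m + 1).bits.head?).map Sum.inl, ?_⟩) (.seq h₁ h₂ le_rfl) h₃ ?_
        · rw [stepAux_peekBit, rep_hid _ _ hd, Function.update_self]
          have hne : (m + 1).bits ≠ [] := by simp [bits_eq_nil]
          rcases hx : (m + 1).bits with _ | ⟨x, l⟩
          · exact absurd hx hne
          · simp
        · ring_nf
          ring_nf at hl
          omega
    have hfinal := key (s.reg r) s (hs.1 r) hs hS
    refine .seq (S' := stkOf i o (rep k s (Function.update h d (s.reg r))))
      (t := 2 * V + 2) ?_ hfinal ?_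
    · have hne : (Bst.reg (idx k r) : Bst k) ≠ .aux := by simp
      -- The first drain reverses the digits onto `aux`; the second restores their order in the
      -- register and in the hidden counter at once.
      have h₁ := runs_drain hi ho (j := .reg (idx k r)) (js := [Bst.aux]) (by simp)
        (s.reg r).bits (rep k s h) (rep_reg _ _ hr) (bounded_stkOf.1 hb).2.2 (by
          intro m hm
          rw [List.mem_singleton] at hm
          subst hm
          simp [rep]; omega)
      refine .seq h₁ (t' := (s.reg r).bits.length + 1) ?_ (by omega)
      have h₂ := runs_drain hi ho (j := Bst.aux)
        (js := [Bst.reg (idx k r), .hid (idx k d)]) (by simp)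
        (s.reg r).bits.reverse (fun m => if m = .reg (idx k r) then [] else
          if m ∈ [Bst.aux] then (s.reg r).bits.reverse ++ rep k s h m else rep k s h m)
        (by simp [rep]) (by
          intro m
          have := (bounded_stkOf.1 hb).2.2 m
          by_cases h₁ : m = .reg (idx k r)
          · simp [h₁]
          · by_cases h₂ : m = .aux
            · subst h₂; simp [rep]; omega
            · simpa [h₁, h₂] using this) (by
          intro m hm
          simp only [List.mem_cons, List.not_mem_nil, or_false] at hm
          rcases hm with rfl | rfl
          · simp; omega
          · simp [rep_hid _ _ hd, h0 d le_rfl]; omega)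
      rw [List.length_reverse] at h₂
      convert h₂ using 2
      funext m
      rcases m with _ | _ | _ | j | j
      · simp [rep]
      · simp [rep]
      · simp [rep]
      · by_cases hj : (j : ℕ) = r
        · have := (eq_idx_iff hr j).2 hj
          simp [rep, ← this, hj]
        · have : j ≠ idx k r := fun h' => hj ((eq_idx_iff hr j).1 h')
          simp [rep, this]
      · by_cases hj : (j : ℕ) = d
        · have := (eq_idx_iff hd j).2 hj
          simp [rep, ← this, hj, h0 d le_rfl]
        · have : j ≠ idx k d := fun h' => hj ((eq_idx_iff hd j).1 h')
          simp [rep, this, hj]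
    · have h₁ := Nat.mul_le_mul_right (2 * V + 3 + p.time.eval V) (hs.1 r)
      simp [Prog.time]
      omega
  | moveAT =>
    intro d s h hf hS hs hh h0
    refine .halt (bounded_rep hi ho hV hΛ hs hh) (fun v => ⟨s.A.head?.map Sum.inl, ?_⟩)
      (by simp [Prog.time])
    rcases hA : s.A with _ | ⟨x, l⟩
    · simp [rep, hA, update_rep_A, Prog.run]
    · simp [rep, hA, update_rep_A, update_rep_T, Prog.run, bit]
  | moveTA =>
    intro d s h hf hS hs hh h0
    refine .halt (bounded_rep hi ho hV hΛ hs hh) (fun v => ⟨s.T.head?.map Sum.inl, ?_⟩)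
      (by simp [Prog.time])
    rcases hA : s.T with _ | ⟨x, l⟩
    · simp [rep, hA, update_rep_T, Prog.run]
    · simp [rep, hA, update_rep_A, update_rep_T, Prog.run, bit]
  | peek r =>
    intro d s h hf hS hs hh h0
    have hb := bounded_rep (k := k) hi ho hV hΛ hs hh
    have hlen := len (hs.1 r)
    have h₁ := runs_drain hi ho (j := .reg (idx k r)) (js := ([] : List (Bst k))) (by simp)
        (s.reg r).bits (rep k s h) (rep_reg _ _ hf) (bounded_stkOf.1 hb).2.2 (by simp)
    have h₂ : (fun m => if m = Bst.reg (idx k r) then [] else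
        if m ∈ [] then (s.reg r).bits.reverse ++ rep k s h m else rep k s h m) =
        rep k { s with reg := Function.update s.reg r 0 } h := by
      rw [← update_rep_reg _ _ _ hf]
      funext m
      by_cases hm : m = Bst.reg (idx k r) <;> simp [hm]
    rw [h₂] at h₁
    refine .seq h₁ (t' := 1) (.halt (bounded_rep hi ho hV hΛ
      ⟨fun j => ?_, hs.2⟩ hh) (fun v => ⟨s.A.head?.map Sum.inl, ?_⟩) le_rfl) ?_
    · by_cases hj : j = r
      · subst hj; simp
      · simpa [hj] using hs.1 j
    · have h1 : [true] = (1 : ℕ).bits := by simp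
      rcases hA : s.A with _ | ⟨x, l⟩
      · simp [rep, hA, Prog.run, bit]
      · cases x
        · simp [rep, hA, Prog.run, bit]
        · simp only [stepAux_peekBit, rep, hA, List.head?_cons, Option.map_some, stepAux_ifBit, bit,
            if_true, stepAux_pushBit, Prog.run, stepAux_done]
          rw [idx_val hf, Function.update_self, Nat.zero_bits, h1, update_rep_reg _ _ _ hf]
          simp
    · simp [Prog.time]; omega
  | push r =>
    intro d s h hf hS hs hh h0
    refine .halt (bounded_rep hi ho hV hΛ hs hh) (fun v => ⟨(s.reg r).bits.head?.map Sum.inl, ?_⟩)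
      (by simp [Prog.time])
    -- A number is nonzero exactly if its binary word is nonempty, so a look at the top of the stack
    -- decides it.
    have : ((s.reg r).bits.head?.map (Sum.inl : Bool → Bool ⊕ Bool)).isSome =
        decide (s.reg r ≠ 0) := by
      rcases hx : (s.reg r).bits with _ | ⟨x, l⟩
      · simp [bits_eq_nil.1 hx]
      · have : s.reg r ≠ 0 := fun h' => by simp [h'] at hx
        simp [this]
    simp only [stepAux_peekBit, rep_reg _ _ hf, stepAux_pushBit, this, stepAux_done, update_rep_A,
      Prog.run]
    rfl

end StackCode

/-! ### Functions computed by loop programs with polynomially bounded registers -/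

namespace StackCode

namespace Prog

theorem iterate_inc (r n : ℕ) (s : Store) :
    (inc r).run^[n] s = { s with reg := Function.update s.reg r (s.reg r + n) } := by
  induction n with
  | zero => simp
  | succ n ih => rw [Function.iterate_succ_apply', ih]; simp [run, add_assoc]

theorem iterate_dec (r n : ℕ) (s : Store) :
    (dec r).run^[n] s = { s with reg := Function.update s.reg r (s.reg r - n) } := by
  induction n with
  | zero => simp
  | succ n ih => rw [Function.iterate_succ_apply', ih]; simp [run, Nat.sub_sub]

/-- Set a register to `0`. -/
def clear (d : ℕ) : Prog := loop d (dec d)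

theorem run_clear (d : ℕ) (s : Store) :
    (clear d).run s = { s with reg := Function.update s.reg d 0 } := by
  rw [clear, run, iterate_dec, Nat.sub_self]

theorem safe_clear (d V Λ : ℕ) (s : Store) : (clear d).Safe V Λ s := fun _ _ => trivial

/-- Copy register `a` to register `d`. -/
def copy (a d : ℕ) : Prog := seq (clear d) (loop a (inc d))

theorem run_copy {a d : ℕ} (h : a ≠ d) (s : Store) :
    (copy a d).run s = { s with reg := Function.update s.reg d (s.reg a) } := by
  change (inc d).run^[((clear d).run s).reg a] ((clear d).run s) = _
  rw [run_clear, iterate_inc]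
  simp [h]

theorem safe_copy {a d : ℕ} (h : a ≠ d) {V Λ : ℕ} {s : Store} (hV : s.reg a ≤ V) :
    (copy a d).Safe V Λ s := by
  refine ⟨safe_clear _ _ _ _, fun i hi => ?_⟩
  rw [run_clear] at hi ⊢
  simp only [ne_eq, h, not_false_eq_true, Function.update_of_ne] at hi
  rw [iterate_inc]
  simp only [Safe, Function.update_self]
  omega

end Prog

/-- The function `f` is computed, from the registers `ρ i` and with result in register `d`, by loop
programs that change no register below `d`, with registers that are polynomially bounded. -/
def LoopComputable {v : ℕ} (f : (Fin v → ℕ) → ℕ) : Prop :=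
  ∃ e : ℕ, ∀ (ρ : Fin v → ℕ) (d : ℕ), (∀ i, ρ i < d) → ∃ p : Prog, ∀ s : Store,
    (∀ r < d, (p.run s).reg r = s.reg r) ∧ (p.run s).A = s.A ∧ (p.run s).T = s.T ∧
    (p.run s).reg d = f (fun i => s.reg (ρ i)) ∧
    ∀ m, (∀ i, s.reg (ρ i) ≤ m) →
      p.Safe ((m + 2) ^ e) 0 s ∧ f (fun i => s.reg (ρ i)) ≤ (m + 2) ^ e

/-- Functions bounded by a polynomial. -/
def PolyBounded {v : ℕ} (f : (Fin v → ℕ) → ℕ) : Prop :=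
  ∃ e : ℕ, ∀ (x : Fin v → ℕ) (m : ℕ), (∀ i, x i ≤ m) → f x ≤ (m + 2) ^ e

theorem pow_le_pow_of_le (m : ℕ) {e e' : ℕ} (h : e ≤ e') : (m + 2) ^ e ≤ (m + 2) ^ e' :=
  Nat.pow_le_pow_right (by omega) h

variable {v : ℕ} {f g : (Fin v → ℕ) → ℕ}

namespace PolyBounded

theorem mono (hg : PolyBounded g) (h : ∀ x, f x ≤ g x) : PolyBounded f := by
  obtain ⟨e, he⟩ := hg
  exact ⟨e, fun x m hx => (h x).trans (he x m hx)⟩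

theorem add (hf : PolyBounded f) (hg : PolyBounded g) : PolyBounded fun x => f x + g x := by
  obtain ⟨e, he⟩ := hf
  obtain ⟨e', he'⟩ := hg
  refine ⟨e + e' + 1, fun x m hx => ?_⟩
  have h₁ := (he x m hx).trans (pow_le_pow_of_le m (Nat.le_add_right e e'))
  have h₂ := (he' x m hx).trans (pow_le_pow_of_le m (Nat.le_add_left e' e))
  rw [pow_succ]
  nlinarith

theorem mul (hf : PolyBounded f) (hg : PolyBounded g) : PolyBounded fun x => f x * g x := by
  obtain ⟨e, he⟩ := hf
  obtain ⟨e', he'⟩ := hg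
  exact ⟨e + e', fun x m hx => by rw [pow_add]; exact Nat.mul_le_mul (he x m hx) (he' x m hx)⟩

theorem const (c : ℕ) : PolyBounded fun _ : Fin v → ℕ => c :=
  ⟨c, fun _ m _ => (Nat.lt_two_pow_self).le.trans (Nat.pow_le_pow_left (by omega) c)⟩

end PolyBounded

namespace LoopComputable

theorem polyBounded (hf : LoopComputable f) : PolyBounded f := by
  obtain ⟨e, he⟩ := hf
  refine ⟨e, fun x m hx => ?_⟩
  obtain ⟨p, hp⟩ := he (fun i => i) v (fun i => i.2)
  have := ((hp ⟨fun r => if h : r < v then x ⟨r, h⟩ else 0, [], []⟩).2.2.2.2 m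
    (by simpa using hx)).2
  simpa using this

theorem congr (hf : LoopComputable f) (h : ∀ x, g x = f x) : LoopComputable g := by
  rwa [show g = f from funext h]

theorem proj (i : Fin v) : LoopComputable fun x => x i := by
  refine ⟨1, fun ρ d hd => ⟨.copy (ρ i) d, fun s => ?_⟩⟩
  have hne : ρ i ≠ d := (hd i).ne
  rw [Prog.run_copy hne]
  refine ⟨fun r hr => by simp [hr.ne], rfl, rfl, by simp, fun m hm => ⟨Prog.safe_copy hne ?_, ?_⟩⟩
  · exact (hm i).trans (by simp)
  · exact (hm i).trans (by simp)

theorem zero : LoopComputable fun _ : Fin v → ℕ => 0 :=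
  ⟨0, fun _ d _ => ⟨.clear d, fun s => ⟨fun r hr => by simp [Prog.run_clear, hr.ne],
    by rw [Prog.run_clear], by rw [Prog.run_clear], by simp [Prog.run_clear],
    fun _ _ => ⟨Prog.safe_clear _ _ _ _, Nat.zero_le _⟩⟩⟩⟩

theorem succ (hf : LoopComputable f) : LoopComputable fun x => f x + 1 := by
  obtain ⟨e, he⟩ := hf
  refine ⟨e + 1, fun ρ d hd => ?_⟩
  obtain ⟨p, hp⟩ := he ρ d hd
  refine ⟨.seq p (.inc d), fun s => ?_⟩
  obtain ⟨h₁, h₂, h₃, h₄, h₅⟩ := hp s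
  refine ⟨fun r hr => by simp [Prog.run, hr.ne, h₁ r hr], h₂, h₃, by simp [Prog.run, h₄],
    fun m hm => ?_⟩
  obtain ⟨h₆, h₇⟩ := h₅ m hm
  have h₈ : (m + 2) ^ e + 1 ≤ (m + 2) ^ (e + 1) := by
    have : 0 < (m + 2) ^ e := by positivity
    rw [pow_succ]; nlinarith
  refine ⟨⟨h₆.mono (by omega) le_rfl, ?_⟩, by dsimp only; omega⟩
  simp only [Prog.Safe, h₄]
  omega

theorem pred (hf : LoopComputable f) : LoopComputable fun x => f x - 1 := by
  obtain ⟨e, he⟩ := hf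
  refine ⟨e, fun ρ d hd => ?_⟩
  obtain ⟨p, hp⟩ := he ρ d hd
  refine ⟨.seq p (.dec d), fun s => ?_⟩
  obtain ⟨h₁, h₂, h₃, h₄, h₅⟩ := hp s
  refine ⟨fun r hr => by simp [Prog.run, hr.ne, h₁ r hr], h₂, h₃, by simp [Prog.run, h₄],
    fun m hm => ?_⟩
  obtain ⟨h₆, h₇⟩ := h₅ m hm
  exact ⟨⟨h₆, trivial⟩, by dsimp only; omega⟩

theorem rename {w : ℕ} (hf : LoopComputable f) (τ : Fin v → Fin w) :
    LoopComputable fun x : Fin w → ℕ => f fun i => x (τ i) := by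
  obtain ⟨e, he⟩ := hf
  refine ⟨e, fun ρ d hd => ?_⟩
  obtain ⟨p, hp⟩ := he (fun i => ρ (τ i)) d (fun i => hd _)
  refine ⟨p, fun s => ?_⟩
  obtain ⟨h₁, h₂, h₃, h₄, h₅⟩ := hp s
  exact ⟨h₁, h₂, h₃, h₄, fun m hm => h₅ m fun i => hm _⟩

theorem tail (hf : LoopComputable f) : LoopComputable fun y : Fin (v + 1) → ℕ => f (Fin.tail y) :=
  hf.rename Fin.succ

theorem const (c : ℕ) : LoopComputable fun _ : Fin v → ℕ => c := by
  induction c with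
  | zero => exact zero
  | succ c ih => exact ih.succ

/-- Iteration of a function whose iterates are polynomially bounded. -/
theorem iter {n i B : (Fin v → ℕ) → ℕ} {g : (Fin (v + 1) → ℕ) → ℕ} (hn : LoopComputable n)
    (hi : LoopComputable i) (hg : LoopComputable g) (hB : PolyBounded B)
    (h : ∀ x, ∀ j ≤ n x, (fun a => g (Fin.cons a x))^[j] (i x) ≤ B x) :
    LoopComputable fun x => (fun a => g (Fin.cons a x))^[n x] (i x) := by
  obtain ⟨en, hen⟩ := hn
  obtain ⟨ei, hei⟩ := hi
  obtain ⟨eg, heg⟩ := hg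
  obtain ⟨eb, heb⟩ := hB
  -- The initial value and the number of rounds account for `ei` and `en`. The body is applied to
  -- numbers up to `m + (m + 2) ^ eb`, and adding `2` to this gives at most `(m + 2) ^ (eb + 3)`;
  -- hence the product `(eb + 3) * eg`.
  refine ⟨en + ei + eb + (eb + 3) * eg, fun ρ d hd => ?_⟩
  have hd' : ∀ i, ρ i < d + 1 := fun i => (hd i).trans d.lt_succ_self
  obtain ⟨pi, hpi⟩ := hei ρ d hd
  obtain ⟨pn, hpn⟩ := hen ρ (d + 1) hd'
  obtain ⟨pg, hpg⟩ := heg (Fin.cons d ρ) (d + 1) (fun j => by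
    refine Fin.cases ?_ (fun j => ?_) j
    · simp
    · simpa using hd' j)
  -- Register `d` holds the iterate. Register `d + 1` holds first the number of rounds and then the
  -- values of `g`; it may be overwritten since the number of rounds is fixed when the loop begins.
  refine ⟨.seq pi (.seq pn (.loop (d + 1) (.seq pg (.copy (d + 1) d)))), fun s => ?_⟩
  obtain ⟨i₁, i₂, i₃, i₄, i₅⟩ := hpi s
  have hρ : (fun j => (pi.run s).reg (ρ j)) = fun j => s.reg (ρ j) :=
    funext fun j => i₁ _ (hd j)
  obtain ⟨n₁, n₂, n₃, n₄, n₅⟩ := hpn (pi.run s)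
  simp only [funext_iff] at hρ
  simp only [hρ] at n₄ n₅
  set x : Fin v → ℕ := fun j => s.reg (ρ j) with hx
  set t := pn.run (pi.run s) with ht
  have hcons : ∀ u : Store, (∀ r < d, u.reg r = s.reg r) →
      (fun j => u.reg ((Fin.cons d ρ : Fin (v + 1) → ℕ) j)) = Fin.cons (u.reg d) x := by
    intro u hu
    funext j
    refine Fin.cases ?_ (fun j => ?_) j
    · simp
    · simp [hu _ (hd j), hx]
  set q : Prog := .seq pg (.copy (d + 1) d) with hq
  have hne : d + 1 ≠ d := by omega
  have step : ∀ u : Store, (∀ r < d, u.reg r = s.reg r) →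
      (∀ r < d, (q.run u).reg r = s.reg r) ∧ (q.run u).A = u.A ∧ (q.run u).T = u.T ∧
      (q.run u).reg d = g (Fin.cons (u.reg d) x) := by
    intro u hu
    obtain ⟨g₁, g₂, g₃, g₄, -⟩ := hpg u
    rw [hcons u hu] at g₄
    simp only [hq, Prog.run, Prog.run_copy hne]
    refine ⟨fun r hr => ?_, g₂, g₃, by simpa using g₄⟩
    rw [Function.update_of_ne hr.ne, g₁ r (by omega), hu r hr]
  have key : ∀ j, (∀ r < d, (q.run^[j] t).reg r = s.reg r) ∧ (q.run^[j] t).A = s.A ∧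
      (q.run^[j] t).T = s.T ∧
      (q.run^[j] t).reg d = (fun a => g (Fin.cons a x))^[j] (i x) := by
    intro j
    induction j with
    | zero =>
      refine ⟨fun r hr => ?_, n₂.trans i₂, n₃.trans i₃, ?_⟩
      · exact (n₁ r (by omega)).trans (i₁ r hr)
      · exact (n₁ d (by omega)).trans i₄
    | succ j ih =>
      rw [Function.iterate_succ_apply', Function.iterate_succ_apply']
      obtain ⟨k₁, k₂, k₃, k₄⟩ := ih
      obtain ⟨s₁, s₂, s₃, s₄⟩ := step _ k₁
      exact ⟨s₁, s₂.trans k₂, s₃.trans k₃, by rw [s₄, k₄]⟩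
  have hrun : (Prog.run (.seq pi (.seq pn (.loop (d + 1) q))) s) = q.run^[n x] t := by
    simp only [Prog.run]
    rw [← ht, n₄]
  rw [hrun]
  obtain ⟨k₁, k₂, k₃, k₄⟩ := key (n x)
  refine ⟨k₁, k₂, k₃, k₄, fun m hm => ?_⟩
  have hBx := heb x m hm
  have hN : ∀ e, e ≤ en + ei + eb + (eb + 3) * eg →
      (m + 2) ^ e ≤ (m + 2) ^ (en + ei + eb + (eb + 3) * eg) := fun e he => pow_le_pow_of_le m he
  refine ⟨⟨(i₅ m hm).1.mono (hN _ (by omega)) le_rfl, (n₅ m hm).1.mono (hN _ (by omega)) le_rfl,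
    fun j hj => ?_⟩, ((h x _ le_rfl).trans hBx).trans (hN _ (by omega))⟩
  rw [← ht, n₄] at hj
  obtain ⟨k₁, k₂, k₃, k₄⟩ := key j
  obtain ⟨g₁, g₂, g₃, g₄, g₅⟩ := hpg (q.run^[j] t)
  rw [hcons _ k₁] at g₄ g₅
  have hpos : 0 < (m + 2) ^ eb := by positivity
  have hmle : m + 2 ≤ (m + 2) ^ eb * (m + 2) := Nat.le_mul_of_pos_left _ hpos
  have hM : m + (m + 2) ^ eb + 2 ≤ (m + 2) ^ (eb + 3) := by
    have h₁ : (m + 2) ^ (eb + 3) = (m + 2) ^ eb * (m + 2) * ((m + 2) * (m + 2)) := by ring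
    have h₂ : (m + 2) ^ eb ≤ (m + 2) ^ eb * (m + 2) := Nat.le_mul_of_pos_right _ (by omega)
    have h₃ : 2 ≤ (m + 2) * (m + 2) := by nlinarith
    rw [h₁]
    nlinarith [Nat.mul_le_mul_left ((m + 2) ^ eb * (m + 2)) h₃]
  have hle : (m + (m + 2) ^ eb + 2) ^ eg ≤ (m + 2) ^ (en + ei + eb + (eb + 3) * eg) := by
    refine (Nat.pow_le_pow_left hM eg).trans ?_
    rw [← pow_mul]
    exact hN _ (by omega)
  obtain ⟨g₆, g₇⟩ := g₅ (m + (m + 2) ^ eb) (fun l => by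
    refine Fin.cases ?_ (fun l => ?_) l
    · have := (h x j hj.le).trans hBx
      simp only [Fin.cons_zero, k₄]
      omega
    · have := hm l
      simp only [Fin.cons_succ, k₁ _ (hd l)]
      omega)
  refine ⟨g₆.mono hle le_rfl, Prog.safe_copy hne ?_⟩
  rw [g₄]
  exact g₇.trans hle

/-- Here and in the following operations, `iter` is applied to a simple step, and `key` gives the
iterates in closed form. The closed form identifies the result and supplies the bound that `iter`
requires. -/
theorem add (hf : LoopComputable f) (hg : LoopComputable g) :
    LoopComputable fun x => f x + g x := by
  have key : ∀ (x : Fin v → ℕ) (j : ℕ),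
      (fun a => (Fin.cons a x : Fin (v + 1) → ℕ) 0 + 1)^[j] (f x) = f x + j := by
    intro x j
    induction j with
    | zero => rfl
    | succ j ih => rw [Function.iterate_succ_apply', ih]; simp [add_assoc]
  refine (iter hg hf (proj 0).succ (hf.polyBounded.add hg.polyBounded) fun x j hj => ?_).congr
    fun x => (key x _).symm
  rw [key]
  omega

theorem sub (hf : LoopComputable f) (hg : LoopComputable g) :
    LoopComputable fun x => f x - g x := by
  have key : ∀ (x : Fin v → ℕ) (j : ℕ),
      (fun a => (Fin.cons a x : Fin (v + 1) → ℕ) 0 - 1)^[j] (f x) = f x - j := by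
    intro x j
    induction j with
    | zero => rfl
    | succ j ih => rw [Function.iterate_succ_apply', ih]; simp [Nat.sub_sub]
  refine (iter hg hf (proj 0).pred hf.polyBounded fun x j hj => ?_).congr
    fun x => (key x _).symm
  rw [key]
  omega

theorem mul (hf : LoopComputable f) (hg : LoopComputable g) :
    LoopComputable fun x => f x * g x := by
  have key : ∀ (x : Fin v → ℕ) (j : ℕ), (fun a => (Fin.cons a x : Fin (v + 1) → ℕ) 0 +
      f (Fin.tail (Fin.cons a x : Fin (v + 1) → ℕ)))^[j] 0 = f x * j := by
    intro x j
    induction j with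
    | zero => rfl
    | succ j ih => rw [Function.iterate_succ_apply', ih]; simp [mul_add]
  refine (iter hg zero ((proj 0).add hf.tail) (hf.polyBounded.mul hg.polyBounded)
    fun x j hj => ?_).congr fun x => (key x _).symm
  rw [key]
  exact Nat.mul_le_mul_left _ hj

/-- The test is a loop of `b x - a x` rounds, starting from `g x`, whose body returns `f x` whatever
it is given: it is executed at least once exactly if `a x < b x`. -/
theorem iflt {a b : (Fin v → ℕ) → ℕ} (ha : LoopComputable a) (hb : LoopComputable b)
    (hf : LoopComputable f) (hg : LoopComputable g) :
    LoopComputable fun x => if a x < b x then f x else g x := by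
  have key : ∀ (x : Fin v → ℕ) (j : ℕ),
      (fun a => f (Fin.tail (Fin.cons a x : Fin (v + 1) → ℕ)))^[j] (g x) =
        if 0 < j then f x else g x := by
    intro x j
    rcases j with _ | j
    · rfl
    · rw [Function.iterate_succ_apply']; simp
  refine (iter (hb.sub ha) hg hf.tail (hf.polyBounded.add hg.polyBounded)
    fun x j hj => ?_).congr fun x => ?_
  · rw [key]
    split_ifs <;> omega
  · simp only [key, Nat.sub_pos_iff_lt]

theorem ifeq {a b : (Fin v → ℕ) → ℕ} (ha : LoopComputable a) (hb : LoopComputable b)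
    (hf : LoopComputable f) (hg : LoopComputable g) :
    LoopComputable fun x => if a x = b x then f x else g x := by
  refine (iflt ha hb hg (iflt hb ha hg hf)).congr fun x => ?_
  split_ifs <;> first | rfl | omega

/-- A counter that returns to zero when it arrives at `g x` is advanced `f x` times. For `g x = 0`
it never returns, in accordance with `f x % 0 = f x`. -/
theorem mod (hf : LoopComputable f) (hg : LoopComputable g) :
    LoopComputable fun x => f x % g x := by
  have key : ∀ (x : Fin v → ℕ) (j : ℕ),
      (fun a => if (Fin.cons a x : Fin (v + 1) → ℕ) 0 + 1 =
        g (Fin.tail (Fin.cons a x : Fin (v + 1) → ℕ)) then 0 else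
        (Fin.cons a x : Fin (v + 1) → ℕ) 0 + 1)^[j] 0 = j % g x := by
    intro x j
    induction j with
    | zero => simp
    | succ j ih =>
      rw [Function.iterate_succ_apply', ih]
      simp only [Fin.cons_zero, Fin.tail_cons]
      rcases Nat.eq_zero_or_pos (g x) with h0 | h0
      · simp [h0]
      · have h₁ := Nat.mod_lt j h0
        split_ifs with h
        · rw [Nat.add_mod]
          rcases Nat.lt_or_ge 1 (g x) with h2 | h2
          · rw [Nat.mod_eq_of_lt h2, h, Nat.mod_self]
          · have : g x = 1 := by omega
            simp [this, Nat.mod_one]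
        · have : 1 < g x := by omega
          rw [Nat.add_mod, Nat.mod_eq_of_lt this, Nat.mod_eq_of_lt (a := j % g x + 1) (by omega)]
  refine (iter hf zero (ifeq (proj 0).succ hg.tail zero (proj 0).succ) hf.polyBounded
    fun x j hj => ?_).congr fun x => (key x _).symm
  rw [key]
  exact (Nat.mod_le _ _).trans hj

/-- The quotient is found by advancing a candidate as long as the next multiple of `g x` does not
exceed `f x`; `f x` rounds suffice. The bound `bd` on the iterates is needed for `g x = 0` too,
although the result is then replaced by `0`. -/
theorem div (hf : LoopComputable f) (hg : LoopComputable g) :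
    LoopComputable fun x => f x / g x := by
  have key : ∀ (x : Fin v → ℕ) (j : ℕ), 0 < g x →
      (fun a => if f (Fin.tail (Fin.cons a x : Fin (v + 1) → ℕ)) <
        ((Fin.cons a x : Fin (v + 1) → ℕ) 0 + 1) * g (Fin.tail (Fin.cons a x : Fin (v + 1) → ℕ))
        then (Fin.cons a x : Fin (v + 1) → ℕ) 0 else
        (Fin.cons a x : Fin (v + 1) → ℕ) 0 + 1)^[j] 0 = min j (f x / g x) := by
    intro x j h0
    induction j with
    | zero => simp
    | succ j ih =>
      rw [Function.iterate_succ_apply', ih]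
      simp only [Fin.cons_zero, Fin.tail_cons, ← Nat.div_lt_iff_lt_mul h0]
      split_ifs <;> omega
  have bd : ∀ (x : Fin v → ℕ) (j : ℕ),
      (fun a => if f (Fin.tail (Fin.cons a x : Fin (v + 1) → ℕ)) <
        ((Fin.cons a x : Fin (v + 1) → ℕ) 0 + 1) * g (Fin.tail (Fin.cons a x : Fin (v + 1) → ℕ))
        then (Fin.cons a x : Fin (v + 1) → ℕ) 0 else
        (Fin.cons a x : Fin (v + 1) → ℕ) 0 + 1)^[j] 0 ≤ j := by
    intro x j
    induction j with
    | zero => simp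
    | succ j ih =>
      rw [Function.iterate_succ_apply']
      simp only [Fin.cons_zero, Fin.tail_cons] at ih ⊢
      split_ifs <;> omega
  refine (iflt zero hg (iter hf zero (iflt hf.tail ((proj 0).succ.mul hg.tail) (proj 0)
    (proj 0).succ) hf.polyBounded fun x j hj => (bd x j).trans hj) zero).congr fun x => ?_
  split_ifs with h
  · rw [key x _ h]
    have := Nat.div_le_self (f x) (g x)
    omega
  · rw [show g x = 0 by omega, Nat.div_zero]

theorem min (hf : LoopComputable f) (hg : LoopComputable g) :
    LoopComputable fun x => min (f x) (g x) :=
  (iflt hf hg hf hg).congr fun x => by split_ifs <;> omega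

/-- A power of two is not polynomially bounded, so each doubling is cut off at `g x`; this does not
affect the minimum. -/
theorem powMin (hf : LoopComputable f) (hg : LoopComputable g) :
    LoopComputable fun x => Min.min (2 ^ f x) (g x) := by
  have key : ∀ (x : Fin v → ℕ) (j : ℕ),
      (fun a => Min.min (2 * (Fin.cons a x : Fin (v + 1) → ℕ) 0)
        (g (Fin.tail (Fin.cons a x : Fin (v + 1) → ℕ))))^[j] (Min.min 1 (g x)) =
        Min.min (2 ^ j) (g x) := by
    intro x j
    induction j with
    | zero => simp
    | succ j ih =>
      rw [Function.iterate_succ_apply', ih, pow_succ]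
      simp only [Fin.cons_zero, Fin.tail_cons]
      omega
  refine (iter hf ((const 1).min hg) (((const 2).mul (proj 0)).min hg.tail) hg.polyBounded
    fun x j hj => ?_).congr fun x => (key x _).symm
  rw [key]
  omega

/-- The exponent is advanced while the next power of two does not exceed `f x`. Cutting the power
off at `f x + 1` leaves this comparison unchanged. -/
theorem log (hf : LoopComputable f) : LoopComputable fun x => Nat.log 2 (f x) := by
  have key : ∀ (x : Fin v → ℕ) (j : ℕ),
      (fun a => if f (Fin.tail (Fin.cons a x : Fin (v + 1) → ℕ)) <
        Min.min (2 ^ ((Fin.cons a x : Fin (v + 1) → ℕ) 0 + 1))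
          (f (Fin.tail (Fin.cons a x : Fin (v + 1) → ℕ)) + 1)
        then (Fin.cons a x : Fin (v + 1) → ℕ) 0 else
        (Fin.cons a x : Fin (v + 1) → ℕ) 0 + 1)^[j] 0 = Min.min j (Nat.log 2 (f x)) := by
    intro x j
    induction j with
    | zero => simp
    | succ j ih =>
      rw [Function.iterate_succ_apply', ih]
      simp only [Fin.cons_zero, Fin.tail_cons]
      rcases Nat.eq_zero_or_pos (f x) with h0 | h0
      · simp [h0]
      · have := Nat.le_log_iff_pow_le (b := 2) (x := Min.min j (Nat.log 2 (f x)) + 1)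
          (by norm_num) h0.ne'
        split_ifs <;> omega
  refine (iter hf zero (iflt hf.tail ((proj 0).succ.powMin hf.tail.succ) (proj 0) (proj 0).succ)
    hf.polyBounded fun x j hj => ?_).congr fun x => ?_
  · rw [key]
    omega
  · rw [key]
    have := Nat.log_le_self 2 (f x)
    omega

end LoopComputable

end StackCode

/-! ### Machines for structured programs -/

namespace StackCode

open Turing Turing.TM2

variable {ι Γi Γo : Type} [DecidableEq ι]

/-- The machine that executes a structured program. -/
noncomputable def machine [Fintype ι] [Fintype Γi] (c : Pr Γi Γo ι) : FinTM2 where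
  K := Stk ι
  k₀ := .inp
  k₁ := .out
  Γ := Alph Γi Γo ι
  Λ := Option c.Label
  main := c.entry some none
  σ := Reg
  initialState := none
  Γk₀Fin := inferInstanceAs (Fintype Γi)
  m := fun l => match l with
    | some l => c.stmt some none l
    -- A final configuration in the sense of `haltList` has the initial internal state, which is
    -- restored here.
    | none => .load (fun _ => none) .halt

section machine

variable [Fintype ι] [Fintype Γi] (c : Pr Γi Γo ι)

theorem initList_machine (w : List Γi) :
    initList (machine c) w = ⟨some (c.entry some none), none, stkOf w [] fun _ => []⟩ := by
  unfold initList
  congr 1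
  funext k
  rcases k with _ | _ | j <;> rfl

theorem haltList_machine (w : List Γo) :
    haltList (machine c) w = ⟨none, none, stkOf [] w fun _ => []⟩ := by
  unfold haltList
  congr 1
  funext k
  rcases k with _ | _ | j <;> rfl

variable {c}

theorem Runs.path_machine {Ok : (∀ k, List (Alph Γi Γo ι k)) → Prop} {w : List Γi} {o : List Γo}
    {T : ℕ} (h : Runs Ok c (stkOf w [] fun _ => []) (stkOf [] o fun _ => []) T)
    (ho : Ok (stkOf [] o fun _ => [])) :
    ∃ t ≤ T + 1, Path (machine c).m Ok (initList (machine c) w) (haltList (machine c) o) t := by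
  rw [initList_machine, haltList_machine]
  obtain ⟨v, t, ht, hp⟩ := h.exists_path (M := (machine c).m) some none (fun l => rfl) none
  exact ⟨t + 1, by omega, hp.trans (.head ho rfl (.refl _))⟩

end machine

/-! ### Clearing stacks, writing the output and reading the input. -/

section codes

variable {ℓ : ℕ} {i : List Γi} {o : List Γo} {b : ι → List Bool}

/-- Empty all of the given stacks. -/
def clearAll : List ι → Pr Γi Γo ι
  | [] => .skip
  | j :: js => .seq (drain j []) (clearAll js)

theorem runs_clearAll (hi : i.length ≤ ℓ) (ho : o.length ≤ ℓ) (js : List ι) :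
    ∀ b : ι → List Bool, (∀ j, (b j).length ≤ ℓ) →
      Runs (Bounded ℓ) (clearAll js) (stkOf i o b)
        (stkOf i o fun m => if m ∈ js then [] else b m) (js.length * (ℓ + 1)) := by
  induction js with
  | nil => intro b _; simpa [clearAll] using Runs.skip (Ok := Bounded ℓ) (stkOf i o b) 0
  | cons j js ih =>
    intro b hb
    have h₁ := runs_drain hi ho (j := j) (js := []) (by simp) (b j) b rfl hb (by simp)
    have h₂ := ih (fun m => if m = j then [] else if m ∈ [] then (b j).reverse ++ b m else b m) (by
      intro m
      by_cases hm : m = j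
      · simp [hm]
      · simpa [hm] using hb m)
    refine .seq h₁ ?_ (t' := js.length * (ℓ + 1)) ?_
    · convert h₂ using 2
      funext m
      by_cases hm : m = j
      · simp [hm]
      · simp [hm]
    · have := hb j
      rw [List.length_cons, Nat.add_mul]
      omega

/-- Write the contents of the stack `r` to the output. -/
def emit (aux r : ι) (f : Bool → Γo) : Pr Γi Γo ι :=
  .seq (drain r [aux]) (.whil (popBit aux (ifBit Option.isSome
    (.push Stk.out (fun v => f (bit v)) again) done)) .skip)

theorem runs_emit_loop {aux : ι} (f : Bool → Γo) (hi : i.length ≤ ℓ) (l : List Bool) :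
    ∀ (o : List Γo) (b : ι → List Bool), b aux = l → (∀ j, (b j).length ≤ ℓ) →
      l.length + o.length ≤ ℓ →
      Runs (Bounded ℓ) (.whil (popBit aux (ifBit Option.isSome
        (.push Stk.out (fun v => f (bit v)) again) done)) .skip) (stkOf i o b)
        (stkOf i (l.reverse.map f ++ o) (Function.update b aux [])) (l.length + 1) := by
  induction l with
  | nil =>
    intro o b hb hl ho
    refine .halt (bounded_stkOf.2 ⟨hi, by simpa using ho, hl⟩) (fun v => ⟨none, ?_⟩) (by simp)
    simp [hb]
  | cons x l ih =>
    intro o b hb hl ho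
    simp only [List.length_cons] at ho
    have key := ih (f x :: o) (Function.update b aux l) (by simp) (fun j => by
      by_cases hj : j = aux
      · have := hl aux
        rw [hb, List.length_cons] at this
        simp [hj]; omega
      · simpa [hj] using hl j) (by simp; omega)
    refine .loop (bounded_stkOf.2 ⟨hi, by omega, hl⟩) (fun v => ⟨some (.inl x), ?_⟩) (.skip _ 0)
      (S₁ := stkOf i (f x :: o) (Function.update b aux l)) (t' := l.length + 1) ?_ (by simp)
    · simp only [stepAux_popBit, hb, List.head?_cons, Option.map_some, stepAux_ifBit,
        Option.isSome_some, if_true, List.tail_cons, stepAux, stkOf_out, update_stkOf_out,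
        stepAux_again, bit]
    · simpa using key

/-- The passage through `aux` reverses the word once and the writing onto the output stack reverses
it again. -/
theorem runs_emit {aux r : ι} (har : aux ≠ r) (f : Bool → Γo) (hi : i.length ≤ ℓ)
    (hb : ∀ j, (b j).length ≤ ℓ) (ha : b aux = []) (hl : (b r).length + o.length ≤ ℓ) :
    Runs (Bounded ℓ) (emit aux r f) (stkOf i o b)
      (stkOf i ((b r).map f ++ o) (Function.update b r [])) (2 * (b r).length + 2) := by
  have h₁ := runs_drain (ℓ := ℓ) (i := i) (o := o) hi (by omega) (j := r) (js := [aux])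
    (by simp [har.symm]) (b r) b rfl hb (by
      intro m hm
      rw [List.mem_singleton] at hm
      subst hm
      simpa [ha] using hb r)
  refine .seq h₁ (t' := (b r).length + 1) ?_ (by omega)
  have h₂ := runs_emit_loop (ℓ := ℓ) (i := i) (aux := aux) f hi (b r).reverse o
    (fun m => if m = r then [] else if m ∈ [aux] then (b r).reverse ++ b m else b m)
    (by simp [har, ha]) (by
      intro j
      by_cases hj : j = r
      · simp [hj]
      · by_cases hj' : j = aux
        · subst hj'
          simpa [hj, ha] using hb r
        · simpa [hj, hj'] using hb j) (by simpa using hl)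
  rw [List.reverse_reverse, List.length_reverse] at h₂
  convert h₂ using 2
  funext m
  by_cases hm : m = aux
  · subst hm; simp [har, ha]
  · by_cases hm' : m = r
    · subst hm'; simp [hm]
    · simp [hm, hm']

/-- Write a symbol to the output, if the stack `r` is not empty. -/
def emitFlag (r : ι) (γ : Γo) : Pr Γi Γo ι :=
  once (peekBit r (ifBit Option.isSome (.push Stk.out (fun _ => γ) done) done))

theorem runs_emitFlag (r : ι) (γ : Γo) (hb : Bounded ℓ (stkOf i o b)) :
    Runs (Bounded ℓ) (emitFlag r γ) (stkOf i o b)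
      (stkOf i (if b r = [] then o else γ :: o) b) 1 := by
  refine .halt hb (fun v => ⟨(b r).head?.map Sum.inl, ?_⟩) le_rfl
  rcases hr : b r with _ | ⟨x, l⟩ <;> simp [hr, stepAux]

/-- Read a symbol of the input. -/
def popInp (f : Γi → Bool ⊕ Bool) (q : St Γi Γo ι) : St Γi Γo ι :=
  .pop Stk.inp (fun _ x => x.map f) q

@[simp] theorem stepAux_popInp (f : Γi → Bool ⊕ Bool) (q : St Γi Γo ι) (v : Reg) :
    stepAux (popInp f q) v (stkOf i o b) =
      stepAux q (i.head?.map f) (stkOf i.tail o b) := by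
  simp [popInp, stepAux]

end codes

end StackCode

/-! ### Computation in linear space -/

namespace StackCode

open Turing Turing.TM2

/-- Evaluation of several functions into consecutive registers. -/
theorem exists_prog_list {v : ℕ} (fs : List ((Fin v → ℕ) → ℕ))
    (hfs : ∀ f ∈ fs, LoopComputable f) :
    ∃ e : ℕ, ∀ (ρ : Fin v → ℕ) (d : ℕ), (∀ i, ρ i < d) → ∃ p : Prog, ∀ s : Store,
      (∀ r < d, (p.run s).reg r = s.reg r) ∧ (p.run s).A = s.A ∧ (p.run s).T = s.T ∧
      (∀ j (h : j < fs.length), (p.run s).reg (d + j) = fs[j] (fun i => s.reg (ρ i))) ∧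
      ∀ m, (∀ i, s.reg (ρ i) ≤ m) → p.Safe ((m + 2) ^ e) 0 s := by
  induction fs with
  | nil =>
    exact ⟨0, fun ρ d hd => ⟨.clear d, fun s => ⟨fun r hr => by simp [Prog.run_clear, hr.ne],
      by rw [Prog.run_clear], by rw [Prog.run_clear], fun j h => absurd h (by simp),
      fun _ _ => Prog.safe_clear _ _ _ _⟩⟩⟩
  | cons f fs ih =>
    obtain ⟨e, he⟩ := ih fun g hg => hfs g (by simp [hg])
    obtain ⟨e', he'⟩ := hfs f (by simp)
    refine ⟨e + e', fun ρ d hd => ?_⟩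
    obtain ⟨p, hp⟩ := he' ρ d hd
    obtain ⟨q, hq⟩ := he ρ (d + 1) fun i => (hd i).trans d.lt_succ_self
    refine ⟨.seq p q, fun s => ?_⟩
    obtain ⟨p₁, p₂, p₃, p₄, p₅⟩ := hp s
    obtain ⟨q₁, q₂, q₃, q₄, q₅⟩ := hq (p.run s)
    have hρ : ∀ i, (p.run s).reg (ρ i) = s.reg (ρ i) := fun i => p₁ _ (hd i)
    simp only [hρ] at q₄ q₅
    refine ⟨fun r hr => (q₁ r (by omega)).trans (p₁ r hr), q₂.trans p₂, q₃.trans p₃, ?_,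
      fun m hm => ⟨(p₅ m hm).1.mono (pow_le_pow_of_le m (by omega)) le_rfl,
        (q₅ m hm).mono (pow_le_pow_of_le m (by omega)) le_rfl⟩⟩
    intro j hj
    rcases j with _ | j
    · exact (q₁ d (by omega)).trans p₄
    · have := q₄ j (by simpa using hj)
      simp only [List.getElem_cons_succ]
      rw [← this]
      congr 1
      omega

/-- Binary functions computed by loop programs with polynomially bounded registers. -/
def LoopComputable₂ (f : ℕ → ℕ → ℕ) : Prop := LoopComputable fun x : Fin 2 → ℕ => f (x 0) (x 1)

/-! ### Reading a pair of binary numbers. -/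

section parse

variable {ι Γo : Type} [DecidableEq ι]

/-- Distribute the input over two stacks. -/
def splitInput (j j' : ι) : Pr (Bool ⊕ Bool) Γo ι :=
  .whil (popInp id (.branch (fun v : Reg => decide (∃ x, v = some (.inl x)))
    (pushBit j (fun v => match v with | some (.inl x) => x | _ => false) again)
    (.branch (fun v : Reg => decide (∃ x, v = some (.inr x)))
    (pushBit j' (fun v => match v with | some (.inr x) => x | _ => false) again) done))) .skip

theorem runs_splitInput {ℓ : ℕ} {o : List Γo} (ho : o.length ≤ ℓ) {j j' : ι} (hj : j ≠ j')
    (w : List (Bool ⊕ Bool)) :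
    ∀ b : ι → List Bool, w.length ≤ ℓ → (∀ m, w.length + (b m).length ≤ ℓ) →
      Runs (Bounded ℓ) (splitInput j j') (stkOf w o b)
        (stkOf [] o (Function.update (Function.update b j ((w.filterMap Sum.getLeft?).reverse ++ b j))
          j' ((w.filterMap Sum.getRight?).reverse ++ b j'))) (w.length + 1) := by
  induction w with
  | nil =>
    intro b hw hb
    refine .halt (bounded_stkOf.2 ⟨hw, ho, by simpa using hb⟩) (fun v => ⟨none, ?_⟩) (by simp)
    simp [stepAux]
  | cons x w ih =>
    intro b hw hb
    simp only [List.length_cons] at hw hb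
    have hB : Bounded ℓ (stkOf (x :: w) o b) :=
      bounded_stkOf.2 ⟨hw, ho, fun m => by have := hb m; omega⟩
    rcases x with x | x
    · have key := ih (Function.update b j (x :: b j)) (by omega) (by
        intro m
        have := hb m
        by_cases hm : m = j
        · subst hm; simp; omega
        · simp [hm]; omega)
      refine .loop hB (fun v => ⟨some (.inl x), ?_⟩) (.skip _ 0)
        (S₁ := stkOf w o (Function.update b j (x :: b j))) (t' := w.length + 1) ?_ (by simp)
      · simp [stepAux]
      · convert key using 2
        · rfl
        simp [hj.symm, List.filterMap_cons]
    · have key := ih (Function.update b j' (x :: b j')) (by omega) (by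
        intro m
        have := hb m
        by_cases hm : m = j'
        · subst hm; simp; omega
        · simp [hm]; omega)
      refine .loop hB (fun v => ⟨some (.inr x), ?_⟩) (.skip _ 0)
        (S₁ := stkOf w o (Function.update b j' (x :: b j'))) (t' := w.length + 1) ?_ (by simp)
      · simp [stepAux]
      · convert key using 2
        · rfl
        funext m
        by_cases hm : m = j'
        · subst hm; simp
        · by_cases hm' : m = j
          · subst hm'; simp [hm, List.filterMap_cons]
          · simp [hm, hm']

/-- Read two binary numbers from the input. -/
def readPair (j j' c c' : ι) : Pr (Bool ⊕ Bool) Γo ι :=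
  .seq (splitInput c c') (.seq (drain c [j]) (drain c' [j']))

end parse

/-- The splitting leaves both numbers reversed on the stacks of registers `2` and `3`, which serve
as scratch space; the two drains put them right into registers `0` and `1`. Only space matters here,
so the time is left unspecified. -/
theorem runs_readPair {Γo : Type} {k ℓ : ℕ} [NeZero k] (hk : 4 ≤ k) {o : List Γo}
    (ho : o.length ≤ ℓ) (N i : ℕ)
    (hℓ : (N.bits.map Sum.inl ++ i.bits.map Sum.inr : List (Bool ⊕ Bool)).length ≤ ℓ) :
    ∃ T, Runs (Bounded ℓ) (readPair (.reg (idx k 0)) (.reg (idx k 1))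
        (.reg (idx k 2)) (.reg (idx k 3)))
      (stkOf (N.bits.map Sum.inl ++ i.bits.map Sum.inr) o fun _ : Bst k => [])
      (stkOf [] o (rep k ⟨fun r => if r = 0 then N else if r = 1 then i else 0, [], []⟩
        fun _ => 0)) T := by
  have hne : ∀ {a b : ℕ}, a < k → b < k → a ≠ b → (Bst.reg (idx k a) : Bst k) ≠ .reg (idx k b) := by
    intro a b ha hb hab h
    rw [Bst.reg.injEq, eq_idx_iff hb, idx_val ha] at h
    exact hab h
  have h20 := hne (a := 2) (b := 0) (by omega) (by omega) (by omega)
  have h31 := hne (a := 3) (b := 1) (by omega) (by omega) (by omega)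
  have h23 := hne (a := 2) (b := 3) (by omega) (by omega) (by omega)
  have h30 := hne (a := 3) (b := 0) (by omega) (by omega) (by omega)
  have h12 := hne (a := 1) (b := 2) (by omega) (by omega) (by omega)
  have h10 := hne (a := 1) (b := 0) (by omega) (by omega) (by omega)
  simp only [List.length_append, List.length_map] at hℓ
  have h₁ := runs_splitInput (ι := Bst k) (ℓ := ℓ) ho h23
    (N.bits.map Sum.inl ++ i.bits.map Sum.inr) (fun _ => []) (by simpa using hℓ)
    (fun m => by simpa using hℓ)
  have hl : (N.bits.map Sum.inl ++ i.bits.map Sum.inr : List (Bool ⊕ Bool)).filterMap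
      Sum.getLeft? = N.bits := by
    rw [List.filterMap_append, List.filterMap_map, List.filterMap_map,
      show (Sum.getLeft? ∘ Sum.inl : Bool → Option Bool) = some from rfl,
      show (Sum.getLeft? ∘ Sum.inr : Bool → Option Bool) = fun _ => none from rfl]
    simp
  have hr : (N.bits.map Sum.inl ++ i.bits.map Sum.inr : List (Bool ⊕ Bool)).filterMap
      Sum.getRight? = i.bits := by
    rw [List.filterMap_append, List.filterMap_map, List.filterMap_map,
      show (Sum.getRight? ∘ Sum.inl : Bool → Option Bool) = fun _ => none from rfl,
      show (Sum.getRight? ∘ Sum.inr : Bool → Option Bool) = some from rfl]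
    simp
  rw [hl, hr] at h₁
  simp only [List.append_nil] at h₁
  set b₁ : Bst k → List Bool := Function.update (Function.update (fun _ => []) (.reg (idx k 2))
    N.bits.reverse) (.reg (idx k 3)) i.bits.reverse with hb₁
  have hb₁l : ∀ j, (b₁ j).length ≤ ℓ := by
    intro j
    by_cases h3 : j = .reg (idx k 3)
    · subst h3; simp [hb₁]; omega
    · by_cases h2 : j = .reg (idx k 2)
      · subst h2; simp [hb₁, h3]; omega
      · simp [hb₁, h2, h3]
  have hb₁2 : b₁ (.reg (idx k 2)) = N.bits.reverse := by simp [hb₁, h23]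
  have hb₁3 : b₁ (.reg (idx k 3)) = i.bits.reverse := by simp [hb₁]
  have hb₁0 : ∀ j, j ≠ .reg (idx k 2) → j ≠ .reg (idx k 3) → b₁ j = [] := by
    intro j h2 h3
    simp [hb₁, h2, h3]
  have h₂ := runs_drain (ℓ := ℓ) (i := ([] : List (Bool ⊕ Bool))) (o := o) (by simp) ho
    (j := .reg (idx k 2)) (js := [Bst.reg (idx k 0)]) (by simpa using h20) _ b₁ hb₁2 hb₁l (by
      intro m hm
      rw [List.mem_singleton] at hm
      subst hm
      rw [hb₁0 _ h20.symm h30.symm]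
      simp; omega)
  have h₃ := runs_drain (ℓ := ℓ) (i := ([] : List (Bool ⊕ Bool))) (o := o) (by simp) ho
    (j := .reg (idx k 3)) (js := [Bst.reg (idx k 1)]) (by simpa using h31) i.bits.reverse
    (fun m => if m = .reg (idx k 2) then [] else if m ∈ [Bst.reg (idx k 0)] then
      N.bits.reverse.reverse ++ b₁ m else b₁ m) (by simp [h30, h23.symm, hb₁3]) (by
      intro m
      by_cases hm : m = .reg (idx k 2)
      · simp [hm]
      · by_cases hm' : m = .reg (idx k 0)
        · subst hm'
          simp [h20.symm, hb₁0 _ h20.symm h30.symm]; omega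
        · simpa [hm, hm'] using hb₁l m) (by
      intro m hm
      rw [List.mem_singleton] at hm
      subst hm
      simp [h12, h10, hb₁0 _ h12 h31.symm]; omega)
  refine ⟨_, .seq h₁ (.seq h₂ (t' := i.bits.reverse.length + 1) ?_ le_rfl) le_rfl⟩
  convert h₃ using 2
  have hreg : ∀ (j : Fin k) {a : ℕ}, a < k → ((Bst.reg j : Bst k) = .reg (idx k a) ↔ (j : ℕ) = a) :=
    fun j a ha => by rw [Bst.reg.injEq, eq_idx_iff ha]
  funext m
  have e0 : (0 : ℕ) < k := by omega
  have e1 : 1 < k := by omega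
  have e2 : 2 < k := by omega
  have e3 : 3 < k := by omega
  rcases m with _ | _ | _ | j | j
  · simp [rep, hb₁]
  · simp [rep, hb₁]
  · simp [rep, hb₁]
  · simp only [rep, hreg j e0, hreg j e1, hreg j e2, hreg j e3, List.mem_singleton, hb₁,
      Function.update_apply, List.reverse_reverse]
    rcases (j : ℕ) with _ | _ | _ | _ | n <;> simp
  · simp [rep, hb₁]

end StackCode

/-! ### Gates in linear space -/

namespace StackCode

open Turing Turing.TM2

/-- The output alphabet of a machine that finds gates. -/
abbrev GateSym : Type := Fin 6 ⊕ (Bool ⊕ Bool)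

/-- The symbol for the type of a gate. -/
def typeWord (t : ℕ) : List GateSym := if h : t < 6 then [.inl ⟨t, h⟩] else []

/-- Write the types whose flags are set. -/
def emitTypes {Γi : Type} {k : ℕ} [NeZero k] : List (Fin 6) → Pr Γi GateSym (Bst k)
  | [] => .skip
  | j :: js => .seq (emitFlag (.reg (idx k (4 + j))) (.inl j)) (emitTypes js)

/-- The type of a gate is computed as a number but has to be written as a single symbol. Six flags,
in the registers from `4` on, make the conversion; for a number outside the range none is set and
nothing is written. -/
theorem runs_emitTypes {Γi : Type} {k ℓ : ℕ} [NeZero k] {i : List Γi} {b : Bst k → List Bool}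
    {t : ℕ} (hi : i.length ≤ ℓ) (hb : ∀ j, (b j).length ≤ ℓ)
    (ht : ∀ j : Fin 6, b (.reg (idx k (4 + j))) = [] ↔ t ≠ j) (js : List (Fin 6)) :
    ∀ o : List GateSym, js.length + o.length ≤ ℓ →
      Runs (Bounded ℓ) (emitTypes js) (stkOf i o b)
        (stkOf i (((js.filter fun j : Fin 6 => decide (t = (j : ℕ))).reverse.map Sum.inl) ++ o) b) js.length := by
  induction js with
  | nil => intro o _; simpa [emitTypes] using Runs.skip (Ok := Bounded ℓ) (stkOf i o b) 0
  | cons j js ih =>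
    intro o ho
    rw [List.length_cons] at ho
    refine .seq (runs_emitFlag _ _ (bounded_stkOf.2 ⟨hi, by omega, hb⟩)) ?_
      (t' := js.length) (by rw [List.length_cons]; omega)
    by_cases h : t = j
    · have h' : b (.reg (idx k (4 + j))) ≠ [] := fun h'' => (ht j).1 h'' h
      have := ih (.inl j :: o) (by rw [List.length_cons]; omega)
      simpa [h', h] using this
    · have h' : b (.reg (idx k (4 + j))) = [] := (ht j).2 h
      have := ih o (by omega)
      simpa [h', h] using this

theorem typeWord_eq (t : ℕ) :
    (((List.finRange 6).filter fun j : Fin 6 => decide (t = (j : ℕ))).reverse.map Sum.inl : List GateSym) = typeWord t := by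
  rcases Nat.lt_or_ge t 6 with h | h
  · interval_cases t <;> rfl
  · have : (List.finRange 6).filter (fun j : Fin 6 => decide (t = j)) = [] := by
      rw [List.filter_eq_nil_iff]
      intro j _
      have := j.2
      simp; omega
    rw [this, typeWord, dif_neg (by omega)]
    rfl

/-- This turns a polynomial bound on the registers into a linear bound on the length of their binary
words, which is what makes the space linear. -/
theorem size_pow_le (m e : ℕ) : ((m + 2) ^ e).size ≤ e * (m.size + 2) + 1 := by
  rw [Nat.size_le]
  have h₁ : m + 2 ≤ 2 ^ (m.size + 2) := by
    have := Nat.lt_size_self m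
    rw [pow_add]
    have : 0 < 2 ^ m.size := by positivity
    omega
  calc (m + 2) ^ e ≤ (2 ^ (m.size + 2)) ^ e := Nat.pow_le_pow_left h₁ e
    _ = 2 ^ (e * (m.size + 2)) := by rw [← pow_mul, mul_comm]
    _ < 2 ^ (e * (m.size + 2) + 1) := Nat.pow_lt_pow_right (by norm_num) (by omega)

theorem size_add_le (m n : ℕ) : (m + n).size ≤ m.size + n.size + 1 := by
  rw [Nat.size_le, pow_succ, pow_add]
  have h₁ := Nat.lt_size_self m
  have h₂ := Nat.lt_size_self n
  nlinarith

/-- The machine reads `N` and `i`, runs a loop program for the arguments and the type flags, writes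
the gate and clears its stacks. All registers stay below a power of `N + i + 2` with a fixed
exponent, so every stack has linear height. -/
theorem linearSpace_of_loopComputable {f : ℕ × ℕ → Option Gate} {t a b : ℕ → ℕ → ℕ}
    (ht : LoopComputable₂ t) (ha : LoopComputable₂ a) (hb : LoopComputable₂ b)
    (hf : ∀ N i, Gate.optionWord (f (N, i)) = typeWord (t N i) ++
      ((a N i).bits.map (fun x => Sum.inr (Sum.inl x)) ++
        (b N i).bits.map fun x => Sum.inr (Sum.inr x))) :
    TM2ComputableInLinearSpace (Computability.encodingProd Computability.encodingNatBool
      Computability.encodingNatBool).encode Gate.optionWord f := by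
  obtain ⟨e, he⟩ := exists_prog_list (v := 2) ((fun x => a (x 0) (x 1)) :: (fun x => b (x 0) (x 1)) ::
    (List.finRange 6).map fun j : Fin 6 => fun x => if t (x 0) (x 1) = j then 1 else 0) (by
      intro g hg
      simp only [List.mem_cons, List.mem_map] at hg
      rcases hg with rfl | rfl | ⟨j, -, rfl⟩
      · exact ha
      · exact hb
      · exact LoopComputable.ifeq ht (.const _) (.const 1) (.const 0))
  obtain ⟨p, hp⟩ := he (fun i => i) 2 (fun i => i.2)
  obtain ⟨k₀, hk₀⟩ := p.exists_fits 0
  -- Registers `0` and `1` hold the input, `2` and `3` the arguments of the gate, and `4` to `9` the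
  -- flags of the six types.
  set k := max k₀ 10 with hk
  have hk10 : 10 ≤ k := le_max_right _ _
  have : NeZero k := ⟨by omega⟩
  have hfits : p.Fits k 0 := hk₀.mono (le_max_left _ _)
  -- The output stack grows at the front of the word, so the parts are written from the last one to
  -- the first. The stacks are cleared because a final configuration has nothing but the output.
  let code : Pr (Bool ⊕ Bool) GateSym (Bst k) :=
    .seq (readPair (.reg (idx k 0)) (.reg (idx k 1)) (.reg (idx k 2)) (.reg (idx k 3)))
    (.seq (compile k 0 p) (.seq (emit .aux (.reg (idx k 3)) fun x => .inr (.inr x))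
    (.seq (emit .aux (.reg (idx k 2)) fun x => .inr (.inl x))
    (.seq (emitTypes (List.finRange 6)) (clearAll Finset.univ.toList)))))
  have main : ∀ N i : ℕ, ∃ T ℓ, ℓ ≤ (6 * e + 30) * (N.bits.length + i.bits.length + 1) ∧
      Runs (Bounded ℓ) code
        (stkOf (N.bits.map Sum.inl ++ i.bits.map Sum.inr) [] fun _ => [])
        (stkOf [] (Gate.optionWord (f (N, i))) fun _ => []) T ∧
      Bounded ℓ (stkOf ([] : List (Bool ⊕ Bool)) (Gate.optionWord (f (N, i))) fun _ : Bst k => []) := by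
    intro N i
    set V := (N + i + 2) ^ (e + 1) with hV
    -- The output stack has to hold two numbers of at most `V.size` digits each and a type; the
    -- other terms make room for the input.
    set ℓ := 2 * (V.size + 1) + N.bits.length + i.bits.length + 10 with hℓ
    obtain ⟨T₁, h₁⟩ := runs_readPair (Γo := GateSym) (k := k) (ℓ := ℓ) (by omega) (o := [])
      (by simp) N i (by simp; omega)
    set s : Store := ⟨fun r => if r = 0 then N else if r = 1 then i else 0, [], []⟩ with hs
    obtain ⟨p₁, p₂, p₃, p₄, p₅⟩ := hp s
    have hNi : N + i ≤ V := by
      rw [hV, pow_succ]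
      have : 0 < (N + i + 2) ^ e := by positivity
      nlinarith
    have hw : Prog.Within V 0 s := by
      refine ⟨fun r => ?_, by simp [hs]⟩
      simp only [hs]
      split_ifs <;> omega
    have hsafe : p.Safe V 0 s := (p₅ (N + i) (fun j => by
      simp only [hs]
      split_ifs <;> omega)).mono (pow_le_pow_of_le _ (by omega)) le_rfl
    have hw' := hsafe.within hw
    have h₂ := runs_compile (Γi := Bool ⊕ Bool) (Γo := GateSym) (ℓ := ℓ) (V := V) (Λ := 0)
      (i := []) (o := []) (by simp) (by simp) (by omega) (by omega) p 0 s (fun _ => 0) hfits hsafe hw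
      (by simp) (by simp)
    have hB := bounded_rep (Γi := Bool ⊕ Bool) (Γo := GateSym) (k := k) (ℓ := ℓ) (V := V) (Λ := 0)
      (i := []) (o := []) (by simp) (by simp) (by omega) (by omega) hw' (h := fun _ => 0) (by simp)
    set s' := p.run s with hs'
    have hra : s'.reg 2 = a N i := by simpa [hs] using p₄ 0 (by simp)
    have hrb : s'.reg 3 = b N i := by simpa [hs] using p₄ 1 (by simp)
    have hrt : ∀ j : Fin 6, s'.reg (4 + j) = if t N i = j then 1 else 0 := by
      intro j
      have := p₄ (j + 2) (by have := j.2; simp; omega)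
      simp only [List.getElem_cons_succ, List.getElem_map, List.getElem_finRange] at this
      rw [show 2 + ((j : ℕ) + 2) = 4 + j by omega] at this
      simpa [hs] using this
    have hla : (a N i).bits.length ≤ V.size := by
      rw [Nat.size_eq_bits_len, ← hra]; exact Nat.size_le_size (hw'.1 2)
    have hlb : (b N i).bits.length ≤ V.size := by
      rw [Nat.size_eq_bits_len, ← hrb]; exact Nat.size_le_size (hw'.1 3)
    have hregne : ∀ {x y : ℕ}, x < k → y < k → x ≠ y →
        (Bst.reg (idx k x) : Bst k) ≠ .reg (idx k y) := by
      intro x y hx hy hxy h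
      rw [Bst.reg.injEq, eq_idx_iff hy, idx_val hx] at h
      exact hxy h
    have hB' := (bounded_stkOf.1 hB).2.2
    have e3 : rep k s' (fun _ => 0) (.reg (idx k 3)) = (b N i).bits := by
      rw [rep_reg _ _ (by omega), hrb]
    have h₃ := runs_emit (Γi := Bool ⊕ Bool) (i := []) (o := ([] : List GateSym)) (ℓ := ℓ)
      (aux := Bst.aux) (r := .reg (idx k 3)) (by simp) (fun x => .inr (.inr x)) (by simp) hB' rfl
      (by rw [e3]; simp; omega)
    rw [e3] at h₃
    set b₃ := Function.update (rep k s' (fun _ => 0)) (.reg (idx k 3)) [] with hb₃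
    have hB₃ : ∀ j, (b₃ j).length ≤ ℓ := by
      intro j
      by_cases hj : j = .reg (idx k 3)
      · simp [hb₃, hj]
      · simpa [hb₃, hj] using hB' j
    have e2 : b₃ (.reg (idx k 2)) = (a N i).bits := by
      rw [hb₃, Function.update_of_ne (hregne (by omega) (by omega) (by omega)),
        rep_reg _ _ (by omega), hra]
    have h₄ := runs_emit (Γi := Bool ⊕ Bool) (i := [])
      (o := (b N i).bits.map (fun x => (Sum.inr (Sum.inr x) : GateSym)) ++ []) (ℓ := ℓ)
      (aux := Bst.aux) (r := .reg (idx k 2)) (by simp) (fun x => .inr (.inl x)) (by simp) hB₃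
      (by simp [hb₃, rep]) (by rw [e2]; simp; omega)
    rw [e2] at h₄
    set b₄ := Function.update b₃ (.reg (idx k 2)) [] with hb₄
    have hB₄ : ∀ j, (b₄ j).length ≤ ℓ := by
      intro j
      by_cases hj : j = .reg (idx k 2)
      · simp [hb₄, hj]
      · simpa [hb₄, hj] using hB₃ j
    have hT : ∀ j : Fin 6, b₄ (.reg (idx k (4 + j))) = [] ↔ t N i ≠ j := by
      intro j
      have hj := j.2
      rw [hb₄, Function.update_of_ne (hregne (by omega) (by omega) (by omega)), hb₃,
        Function.update_of_ne (hregne (by omega) (by omega) (by omega)), rep_reg _ _ (by omega),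
        hrt, bits_eq_nil]
      split_ifs <;> simp_all
    have h₅ := runs_emitTypes (Γi := Bool ⊕ Bool) (i := []) (ℓ := ℓ) (by simp) hB₄ hT
      (List.finRange 6) ((a N i).bits.map (fun x => (Sum.inr (Sum.inl x) : GateSym)) ++
        ((b N i).bits.map (fun x => (Sum.inr (Sum.inr x) : GateSym)) ++ [])) (by simp; omega)
    rw [typeWord_eq, List.append_nil, ← hf] at h₅
    have hout : (Gate.optionWord (f (N, i))).length ≤ ℓ := by
      rw [hf]
      have : (typeWord (t N i)).length ≤ 1 := by unfold typeWord; split_ifs <;> simp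
      simp
      omega
    have h₆ := runs_clearAll (Γi := Bool ⊕ Bool) (i := []) (ℓ := ℓ) (by simp) hout
      (Finset.univ : Finset (Bst k)).toList b₄ hB₄
    simp only [Finset.mem_toList, Finset.mem_univ, if_true] at h₆
    simp only [List.append_nil] at h₃ h₄
    refine ⟨_, ℓ, ?_, .seq h₁ (.seq h₂ (.seq h₃ (.seq h₄ (.seq h₅ h₆ le_rfl) le_rfl) le_rfl) le_rfl)
      le_rfl, bounded_stkOf.2 ⟨by simp, hout, by simp⟩⟩
    have hsz := size_pow_le (N + i) (e + 1)
    have hsz' := size_add_le N i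
    rw [← hV] at hsz
    rw [hℓ, Nat.size_eq_bits_len, Nat.size_eq_bits_len]
    have := Nat.mul_le_mul_left (e + 1) (Nat.add_le_add_right hsz' 2)
    nlinarith
  refine ⟨⟨machine code, Equiv.refl _, Equiv.refl _⟩,
    Fintype.card (Stk (Bst k)) * (6 * e + 30), fun ⟨N, i⟩ => ?_⟩
  obtain ⟨T, ℓ, hℓ, hr, hB⟩ := main N i
  obtain ⟨t, -, hpath⟩ := hr.path_machine hB
  have hin : List.map (Equiv.refl (Bool ⊕ Bool)).invFun ((Computability.encodingProd
      Computability.encodingNatBool Computability.encodingNatBool).encode (N, i)) =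
      N.bits.map Sum.inl ++ i.bits.map Sum.inr := by
    simp [Computability.encodingProd, Computability.encodingNatBool, encodeNat_eq_bits]
  have hout : List.map (Equiv.refl GateSym).invFun (Gate.optionWord (f (N, i))) =
      Gate.optionWord (f (N, i)) := by simp
  have hlen : ((Computability.encodingProd
      Computability.encodingNatBool Computability.encodingNatBool).encode (N, i)).length =
      N.bits.length + i.bits.length := by
    simp [Computability.encodingProd, Computability.encodingNatBool, encodeNat_eq_bits]
  refine ⟨⟨⟨t, ?_⟩⟩, fun cfg hc => ?_⟩
  · have := hpath.iterate
    erw [hin, hout]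
    exact this
  · erw [hin] at hc
    have hok := hpath.ok_of_reaches (by rw [haltList_machine]; exact hB) rfl hc
    rw [hlen]
    calc stackSpace (machine code) cfg ≤ Fintype.card (Stk (Bst k)) • ℓ :=
          Finset.sum_le_card_nsmul _ _ _ fun j _ => hok j
      _ ≤ _ := by
          rw [smul_eq_mul, mul_assoc]
          exact Nat.mul_le_mul_left _ hℓ

end StackCode

/-! ### Evaluation of circuits in polynomial time -/

namespace StackCode

open Turing Turing.TM2

namespace Prog

theorem iterate_moveAT (n : ℕ) (s : Store) :
    moveAT.run^[n] s = { s with A := s.A.drop n, T := (s.A.take n).reverse ++ s.T } := by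
  induction n generalizing s with
  | zero => simp
  | succ n ih =>
    rw [Function.iterate_succ_apply, ih]
    rcases hA : s.A with _ | ⟨x, l⟩ <;> simp [run, hA]

theorem iterate_moveTA (n : ℕ) (s : Store) :
    moveTA.run^[n] s = { s with T := s.T.drop n, A := (s.T.take n).reverse ++ s.A } := by
  induction n generalizing s with
  | zero => simp
  | succ n ih =>
    rw [Function.iterate_succ_apply, ih]
    rcases hA : s.T with _ | ⟨x, l⟩ <;> simp [run, hA]

/-- Read the element of the list whose place is in register `a`, into register `r`. -/
def fetch (a r : ℕ) : Prog := seq (loop a moveAT) (seq (peek r) (loop a moveTA))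

/-- Since `T` is empty at the beginning, the second loop brings back exactly the elements moved by
the first, even if the place lies beyond the end of the list. In that case the value read is the
default `false`. -/
theorem run_fetch {a r : ℕ} (h : a ≠ r) {s : Store} (hT : s.T = []) :
    (fetch a r).run s =
      { s with reg := Function.update s.reg r ((s.A.drop (s.reg a)).headD false).toNat } := by
  change moveTA.run^[((peek r).run (moveAT.run^[s.reg a] s)).reg a]
    ((peek r).run (moveAT.run^[s.reg a] s)) = _
  rw [iterate_moveAT]
  simp only [run, ne_eq, h, not_false_eq_true, Function.update_of_ne, hT, List.append_nil]
  change moveTA.run^[s.reg a] _ = _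
  rw [iterate_moveTA]
  have h₁ : (s.A.take (s.reg a)).reverse.length ≤ s.reg a := by simp
  simp only [List.drop_eq_nil_of_le h₁, List.take_of_length_le h₁, List.reverse_reverse,
    List.take_append_drop]

theorem safe_fetch (a r : ℕ) {V Λ : ℕ} (hV : 1 ≤ V) (s : Store) : (fetch a r).Safe V Λ s :=
  ⟨fun _ _ => trivial, hV, fun _ _ => trivial⟩

end Prog

/-- The value of a gate that reads no input, from its type and the values of its arguments. -/
def gateResult (t : ℕ) (x y : Bool) : Bool :=
  if t = 0 then false else if t = 1 then true else if t = 3 then !x else if t = 4 then x && y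
  else x || y

/-- The same, with numbers for the truth values. -/
def gateNumber (t x y : ℕ) : ℕ :=
  if t = 0 then 0 else if t = 1 then 1 else if t = 3 then 1 - x else if t = 4 then x * y
  else x + y

theorem gateNumber_toNat (t : ℕ) (x y : Bool) :
    decide (gateNumber t x.toNat y.toNat ≠ 0) = gateResult t x y := by
  unfold gateNumber gateResult
  cases x <;> cases y <;> split_ifs <;> simp

theorem loopComputable_gateNumber :
    LoopComputable fun x : Fin 3 → ℕ => gateNumber (x 0) (x 1) (x 2) :=
  .ifeq (.proj 0) (.const 0) (.const 0) <| .ifeq (.proj 0) (.const 1) (.const 1) <|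
    .ifeq (.proj 0) (.const 3) (.sub (.const 1) (.proj 1)) <|
    .ifeq (.proj 0) (.const 4) (.mul (.proj 1) (.proj 2)) (.add (.proj 1) (.proj 2))

/-- One round of the evaluation of a circuit: the list `A` of the values of the first `i` gates is
extended by the value of the `i`-th gate. -/
theorem exists_evalStep {t a₁ a₂ : ℕ → ℕ → ℕ} (ht : LoopComputable₂ t) (ha₁ : LoopComputable₂ a₁)
    (ha₂ : LoopComputable₂ a₂) (ht5 : ∀ N i, t N i ≤ 5) :
    ∃ (e : ℕ) (p : Prog), ∀ (s : Store) (val : ℕ → Bool) (N i : ℕ), s.reg 0 = N → s.reg 1 = i →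
      s.A = ((List.range i).map val).reverse → s.T = [] →
      (∀ x y, (a₁ N i < i → x = val (a₁ N i)) → (a₂ N i < i → y = val (a₂ N i)) →
        val i = gateResult (t N i) x y) →
      (p.run s).reg 0 = N ∧ (p.run s).reg 1 = i + 1 ∧
      (p.run s).A = ((List.range (i + 1)).map val).reverse ∧ (p.run s).T = [] ∧
      ∀ m, N ≤ m → i < m → p.Safe ((m + 7) ^ e) ((m + 7) ^ e) s := by
  -- The most recent value is at the head of `A`, so the value of gate `c` is at place `i - 1 - c`.
  obtain ⟨e, he⟩ := exists_prog_list (v := 2) [fun x => t (x 0) (x 1),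
    fun x => x 1 - 1 - a₁ (x 0) (x 1), fun x => x 1 - 1 - a₂ (x 0) (x 1)] (by
      intro g hg
      simp only [List.mem_cons, List.not_mem_nil, or_false] at hg
      rcases hg with rfl | rfl | rfl
      · exact ht
      · exact .sub (.sub (.proj 1) (.const 1)) ha₁
      · exact .sub (.sub (.proj 1) (.const 1)) ha₂)
  -- Register `2` is left to the surrounding loop. The type goes to register `3`, the places of the
  -- arguments to `4` and `5`, their values to `6` and `7`, and the result to `8`.
  obtain ⟨q, hq⟩ := he (fun i => i) 3 (fun i => i.2.trans (by norm_num))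
  obtain ⟨e', he'⟩ := loopComputable_gateNumber
  obtain ⟨r, hr⟩ := he' ![3, 6, 7] 8 (fun i => by fin_cases i <;> simp)
  refine ⟨e + e' + 1, .seq q (.seq (.fetch 4 6) (.seq (.fetch 5 7) (.seq r
    (.seq (.push 8) (.inc 1))))), ?_⟩
  intro s val N i h0 h1 hA hT hval
  obtain ⟨q₁, q₂, q₃, q₄, q₅⟩ := hq s
  have q40 := q₄ 0 (by simp)
  have q41 := q₄ 1 (by simp)
  have q42 := q₄ 2 (by simp)
  simp only [List.getElem_cons_zero, List.getElem_cons_succ, Fin.val_zero, Fin.val_one, h0, h1]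
    at q40 q41 q42
  norm_num at q40 q41 q42
  set s₁ := q.run s with hs₁
  have hT₁ : s₁.T = [] := q₃.trans hT
  have hA₁ : s₁.A = ((List.range i).map val).reverse := q₂.trans hA
  have look : ∀ c : ℕ, c < i →
      ((((List.range i).map val).reverse.drop (i - 1 - c)).headD false) = val c := by
    intro c hc
    rw [List.headD_eq_head?_getD, List.head?_drop, List.getElem?_reverse (by simp; omega)]
    simp only [List.length_map, List.length_range, List.getElem?_map]
    rw [show i - 1 - (i - 1 - c) = c by omega, List.getElem?_range hc]
    rfl
  set x := ((s₁.A.drop (i - 1 - a₁ N i)).headD false) with hx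
  set y := ((s₁.A.drop (i - 1 - a₂ N i)).headD false) with hy
  set s₂ : Store := { s₁ with reg := Function.update s₁.reg 6 x.toNat } with hs₂
  have e₂ : (Prog.fetch 4 6).run s₁ = s₂ := by
    rw [Prog.run_fetch (by norm_num) hT₁, q41]
  set s₃ : Store := { s₂ with reg := Function.update s₂.reg 7 y.toNat } with hs₃
  have e₃ : (Prog.fetch 5 7).run s₂ = s₃ := by
    have : s₂.reg 5 = i - 1 - a₂ N i := by simp [hs₂, q42]
    rw [Prog.run_fetch (by norm_num) (show s₂.T = [] from hT₁), this]
  obtain ⟨r₁, r₂, r₃, r₄, r₅⟩ := hr s₃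
  have hv : (fun j => s₃.reg ((![3, 6, 7] : Fin 3 → ℕ) j)) = ![t N i, x.toNat, y.toNat] := by
    funext j
    fin_cases j <;> simp [hs₃, hs₂, q40]
  have hvj : ∀ j, s₃.reg ((![3, 6, 7] : Fin 3 → ℕ) j) ≤ 5 := by
    intro j
    have := congrFun hv j
    rw [this]
    have hx1 := Bool.toNat_le x
    have hy1 := Bool.toNat_le y
    fin_cases j
    · exact ht5 N i
    · simp; omega
    · simp; omega
  rw [hv] at r₄ r₅
  simp only [Matrix.cons_val_zero, Matrix.cons_val_one, Matrix.cons_val] at r₄ r₅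
  set s₄ := r.run s₃ with hs₄
  have hres : decide (s₄.reg 8 ≠ 0) = val i := by
    rw [r₄, gateNumber_toNat]
    refine (hval x y (fun h => ?_) fun h => ?_).symm
    · rw [hx, hA₁, look _ h]
    · rw [hy, hA₁, look _ h]
  have h40 : s₄.reg 0 = N := by
    rw [r₁ 0 (by norm_num)]
    simp [hs₃, hs₂, q₁ 0 (by norm_num), h0]
  have h41 : s₄.reg 1 = i := by
    rw [r₁ 1 (by norm_num)]
    simp [hs₃, hs₂, q₁ 1 (by norm_num), h1]
  have h4A : s₄.A = ((List.range i).map val).reverse := r₂.trans hA₁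
  have h4T : s₄.T = [] := r₃.trans hT₁
  simp only [Prog.run, Prog.Safe, ← hs₁, e₂, e₃, ← hs₄, hres, h4A, h4T, h41]
  refine ⟨by simp [h40], by simp, by simp [List.range_succ], trivial, ?_⟩
  intro m hN hi
  have hpos : ∀ e, 0 < (m + 7) ^ e := fun e => by positivity
  have hpow : ∀ e₀, e₀ ≤ e + e' + 1 → (m + 7) ^ e₀ ≤ (m + 7) ^ (e + e' + 1) := fun e₀ h =>
    Nat.pow_le_pow_right (by omega) h
  have hm : m + 7 ≤ (m + 7) ^ (e + e' + 1) := by simpa using hpow 1 (by omega)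
  -- The arguments of `gateNumber` are at most `5`, which bounds its registers by `7 ^ e'`; this is
  -- the reason for the base `m + 7`.
  refine ⟨(q₅ m ?_).mono ((Nat.pow_le_pow_left (by omega) e).trans (hpow e (by omega)))
    (Nat.zero_le _), Prog.safe_fetch _ _ (hpos _) _, Prog.safe_fetch _ _ (hpos _) _,
    (r₅ 5 hvj).1.mono ((Nat.pow_le_pow_left (by omega) e').trans (hpow e' (by omega)))
    (Nat.zero_le _), by simp; omega, by omega⟩
  intro j
  fin_cases j
  · simpa [h0] using hN
  · simpa [h1] using hi.le

/-- A loop program that evaluates a circuit. -/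
theorem exists_evalProg {size : ℕ → ℕ} {t a₁ a₂ : ℕ → ℕ → ℕ}
    (hs : LoopComputable₂ fun N _ => size N) (ht : LoopComputable₂ t) (ha₁ : LoopComputable₂ a₁)
    (ha₂ : LoopComputable₂ a₂) (ht5 : ∀ N i, t N i ≤ 5) (hsize : ∀ N, N < size N) :
    ∃ (P : Polynomial ℕ) (p : Prog), ∀ (w : List Bool) (val : ℕ → Bool),
      (∀ i (h : i < w.length), val i = w[i]) →
      (∀ i, w.length ≤ i → i < size w.length → ∀ x y,
        (a₁ w.length i < i → x = val (a₁ w.length i)) →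
        (a₂ w.length i < i → y = val (a₂ w.length i)) →
        val i = gateResult (t w.length i) x y) →
      let s : Store := ⟨Function.update (fun _ => 0) 0 w.length, w.reverse, []⟩
      (p.run s).A.head? = some (val (size w.length - 1)) ∧
      Prog.Within (P.eval w.length) (P.eval w.length) s ∧
      p.Safe (P.eval w.length) (P.eval w.length) s := by
  obtain ⟨e, he⟩ := hs.sub (.proj 0)
  obtain ⟨pc, hpc⟩ := he (fun i => i) 2 (fun i => i.2)
  obtain ⟨e', q, hq⟩ := exists_evalStep ht ha₁ ha₂ ht5
  obtain ⟨es, hes⟩ := hs.polyBounded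
  refine ⟨((.X + 2) ^ es + .X + 7) ^ (e + e' + 1), .seq (.copy 0 1) (.seq pc (.loop 2 q)), ?_⟩
  intro w val hw hval s
  set N := w.length with hN
  have hS : size N ≤ (N + 2) ^ es := by simpa using hes (fun _ => N) N (by simp)
  have hV : (((.X + 2) ^ es + .X + 7) ^ (e + e' + 1) : Polynomial ℕ).eval N =
      ((N + 2) ^ es + N + 7) ^ (e + e' + 1) := by simp
  rw [hV]
  set M := (N + 2) ^ es + N with hM
  set V := (M + 7) ^ (e + e' + 1) with hVd
  have hpow : ∀ e₀, e₀ ≤ e + e' + 1 → (M + 7) ^ e₀ ≤ V := fun e₀ h =>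
    Nat.pow_le_pow_right (by omega) h
  have hMV : M + 7 ≤ V := by simpa using hpow 1 (by omega)
  have hNS := hsize N
  -- the initial part
  have e₁ : (Prog.copy 0 1).run s = { s with reg := Function.update s.reg 1 N } := by
    rw [Prog.run_copy (by norm_num)]
    simp [s, hN]
  set s₁ : Store := { s with reg := Function.update s.reg 1 N } with hs₁
  obtain ⟨c₁, c₂, c₃, c₄, c₅⟩ := hpc s₁
  have h10 : s₁.reg 0 = N := by simp [hs₁, s, hN]
  have h11 : s₁.reg 1 = N := by simp [hs₁]
  simp only [Fin.val_zero, h10] at c₄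
  set s₂ := pc.run s₁ with hs₂
  have hA : s.A = ((List.range N).map val).reverse := by
    simp only [s]
    congr 1
    refine List.ext_getElem (by simp [hN]) fun i h₁ h₂ => ?_
    simp [hw i h₁]
  -- the loop
  have loop : ∀ j, N + j ≤ size N → (q.run^[j] s₂).reg 0 = N ∧ (q.run^[j] s₂).reg 1 = N + j ∧
      (q.run^[j] s₂).A = ((List.range (N + j)).map val).reverse ∧ (q.run^[j] s₂).T = [] := by
    intro j
    induction j with
    | zero =>
      intro _
      exact ⟨(c₁ 0 (by norm_num)).trans h10, (c₁ 1 (by norm_num)).trans h11, c₂.trans hA, c₃⟩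
    | succ j ih =>
      intro hj
      obtain ⟨i₁, i₂, i₃, i₄⟩ := ih (by omega)
      rw [Function.iterate_succ_apply']
      obtain ⟨k₁, k₂, k₃, k₄, -⟩ := hq _ val N (N + j) i₁ i₂ i₃ i₄
        (hval (N + j) (by omega) (by omega))
      exact ⟨k₁, k₂, k₃, k₄⟩
  refine ⟨?_, ⟨fun r => ?_, ?_⟩, ?_, ?_, ?_⟩
  · simp only [Prog.run, e₁, ← hs₂, c₄]
    rw [(loop (size N - N) (by omega)).2.2.1, show N + (size N - N) = size N - 1 + 1 by omega,
      List.range_succ]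
    simp
  · by_cases hr : r = 0
    · subst hr; simp [s]; omega
    · simp [s, hr]
  · simp [s]; omega
  · exact Prog.safe_copy (by norm_num) (by simp [s]; omega)
  · rw [e₁]
    refine (c₅ N (fun i => ?_)).1.mono ((Nat.pow_le_pow_left (by omega) e).trans
      (hpow e (by omega))) (Nat.zero_le _)
    fin_cases i
    · exact h10.le
    · exact h11.le
  · rw [e₁, ← hs₂]
    intro j hj
    rw [c₄] at hj
    obtain ⟨i₁, i₂, i₃, i₄⟩ := loop j (by omega)
    obtain ⟨-, -, -, -, k₅⟩ := hq _ val N (N + j) i₁ i₂ i₃ i₄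
        (hval (N + j) (by omega) (by omega))
    exact (k₅ M (by omega) (by omega)).mono (hpow e' (by omega)) (hpow e' (by omega))

/-- Read the input onto the list, and count its length. -/
def readWord (k : ℕ) [NeZero k] : Pr Bool Bool (Bst k) :=
  .whil (popInp Sum.inl (ifBit Option.isSome (pushBit .A bit again) done))
    (incCode .aux (.reg (idx k 0)))

theorem runs_readWord {k ℓ m : ℕ} [NeZero k] (w : List Bool) :
    ∀ (n : ℕ) (l : List Bool), n + w.length ≤ m → 2 * m + l.length + 2 * w.length + 2 ≤ ℓ →
      Runs (Bounded ℓ) (readWord k)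
        (stkOf w [] (rep k ⟨Function.update (fun _ => 0) 0 n, l, []⟩ fun _ => 0))
        (stkOf [] [] (rep k ⟨Function.update (fun _ => 0) 0 (n + w.length), w.reverse ++ l, []⟩
          fun _ => 0)) (w.length * (2 * m + 3) + 1) := by
  have bd : ∀ (w : List Bool) (n : ℕ) (l : List Bool), n ≤ m →
      2 * m + l.length + 2 * w.length + 2 ≤ ℓ → Bounded ℓ
        (stkOf w ([] : List Bool) (rep k ⟨Function.update (fun _ => 0) 0 n, l, []⟩ fun _ => 0)) := by
    intro w n l hn hl
    have := size_le_self m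
    refine bounded_rep (V := m) (Λ := l.length) (by omega) (by simp) (by omega) (by omega)
      ⟨fun r => ?_, by simp⟩ (by simp)
    by_cases hr : r = 0
    · subst hr; simpa using hn
    · simp [hr]
  have h0k : 0 < k := Nat.pos_of_ne_zero (NeZero.ne k)
  induction w with
  | nil =>
    intro n l hn hl
    simp only [List.length_nil] at hn
    refine .halt (bd _ _ _ (by omega) (by simpa using hl)) (fun v => ⟨none, ?_⟩) (by simp)
    simp
  | cons x w ih =>
    intro n l hn hl
    simp only [List.length_cons] at hn hl
    have hB := bd w n (x :: l) (by omega) (by simp; omega)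
    have hsz := Nat.size_le_size (show n ≤ m by omega)
    have hsz' := size_le_self m
    have h₁ := runs_incCode (Γi := Bool) (Γo := Bool) (ℓ := ℓ) (i := w) (o := []) (by omega)
      (by simp) (aux := Bst.aux) (r := .reg (idx k 0)) (by simp) _ (bounded_stkOf.1 hB).2.2 rfl (by
        rw [rep_reg _ _ h0k, Nat.size_eq_bits_len]
        simp; omega)
    rw [rep_reg _ _ h0k, ← bits_succ, update_rep_reg _ _ _ h0k] at h₁
    simp only [Function.update_self, Function.update_idem, Nat.size_eq_bits_len] at h₁
    have h₂ := ih (n + 1) (x :: l) (by omega) (by simp; omega)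
    refine .loop (bd _ _ _ (by omega) (by simp; omega)) (fun v => ⟨some (.inl x), ?_⟩) h₁ ?_
      (S₁ := stkOf w [] (rep k ⟨Function.update (fun _ => 0) 0 n, x :: l, []⟩ fun _ => 0))
      (t' := w.length * (2 * m + 3) + 1) ?_
    · simp [rep, update_rep_A, bit]
    · have e₁ : n + (x :: w).length = n + 1 + w.length := by rw [List.length_cons]; omega
      have e₂ : (x :: w).reverse ++ l = w.reverse ++ x :: l := by simp
      rw [e₁, e₂]
      exact h₂
    · rw [List.length_cons, Nat.add_mul]
      omega

/-- The first gates are the inputs, so reading the word already produces the list of their values.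
The loop program extends it gate by gate, and the head of the final list is the output. The
registers are bounded by a polynomial in the length of the word, hence so is the number of rounds of
each loop. -/
theorem inPolyTime_of_loopComputable {L : Set (List Bool)} {size : ℕ → ℕ} {t a₁ a₂ : ℕ → ℕ → ℕ}
    (hs : LoopComputable₂ fun N _ => size N) (ht : LoopComputable₂ t) (ha₁ : LoopComputable₂ a₁)
    (ha₂ : LoopComputable₂ a₂) (ht5 : ∀ N i, t N i ≤ 5) (hsize : ∀ N, N < size N)
    (val : List Bool → ℕ → Bool)
    (hw : ∀ (w : List Bool) (i : ℕ) (h : i < w.length), val w i = w[i])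
    (hval : ∀ (w : List Bool) (i : ℕ), w.length ≤ i → i < size w.length → ∀ x y,
        (a₁ w.length i < i → x = val w (a₁ w.length i)) →
        (a₂ w.length i < i → y = val w (a₂ w.length i)) →
        val w i = gateResult (t w.length i) x y)
    (hL : ∀ w, val w (size w.length - 1) = true ↔ w ∈ L) : InPolyTime L := by
  obtain ⟨P, p, hp⟩ := exists_evalProg hs ht ha₁ ha₂ ht5 hsize
  obtain ⟨k₀, hk₀⟩ := p.exists_fits 0
  set k := max k₀ 1 with hk
  have : NeZero k := ⟨by omega⟩
  have hfits : p.Fits k 0 := hk₀.mono (le_max_left _ _)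
  let code : Pr Bool Bool (Bst k) := .seq (readWord k) (.seq (compile k 0 p)
    (.seq (once (popBit .A (.push Stk.out bit done))) (clearAll Finset.univ.toList)))
  refine ⟨fun w => val w (size w.length - 1), hL, ⟨⟨machine code, Equiv.refl _, Equiv.refl _⟩,
    .X * (2 * .X + 3) + 1 + (p.time.comp P + (1 + (Finset.univ : Finset (Bst k)).toList.length *
      (2 * P + 5 * .X + 8 + 1))) + 1, fun w => ?_⟩⟩
  set N := w.length with hN
  obtain ⟨p₁, p₂, p₃⟩ := hp w (val w) (hw w) (hval w)
  rw [← hN] at p₁ p₂ p₃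
  set V := P.eval N with hV
  set ℓ := 2 * V + 5 * N + 8 with hℓ
  have hVs := size_le_self V
  have h₁ := runs_readWord (k := k) (ℓ := ℓ) (m := N) w 0 [] (by omega) (by simp; omega)
  rw [Nat.zero_add, List.append_nil] at h₁
  set s : Store := ⟨Function.update (fun _ => 0) 0 w.length, w.reverse, []⟩ with hsd
  have h₂ := runs_compile (Γi := Bool) (Γo := Bool) (ℓ := ℓ) (V := V) (Λ := V)
    (i := []) (o := []) (by simp) (by simp) (by omega) (by omega) p 0 s (fun _ => 0) hfits p₃ p₂
    (by simp) (by simp)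
  set s' := p.run s with hs'
  have hB := bounded_rep (Γi := Bool) (Γo := Bool) (k := k) (ℓ := ℓ) (V := V) (Λ := V)
    (i := []) (o := []) (by simp) (by simp) (by omega) (by omega) (p₃.within p₂)
    (h := fun _ => 0) (by simp)
  have h₃ : Runs (Bounded ℓ) (once (popBit .A (.push Stk.out bit done)))
      (stkOf ([] : List Bool) ([] : List Bool) (rep k s' fun _ => 0))
      (stkOf [] [val w (size N - 1)] (Function.update (rep k s' fun _ => 0) .A s'.A.tail)) 1 := by
    refine .halt hB (fun v => ⟨s'.A.head?.map Sum.inl, ?_⟩) le_rfl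
    simp [rep, p₁, stepAux, bit]
  have hB' : ∀ j, (Function.update (rep k s' fun _ => 0) Bst.A s'.A.tail j).length ≤ ℓ := by
    intro j
    have := (bounded_stkOf.1 hB).2.2 j
    by_cases hj : j = .A
    · subst hj
      replace this : s'.A.length ≤ ℓ := this
      rw [Function.update_self, List.length_tail]
      omega
    · simpa [hj] using this
  have h₄ := runs_clearAll (Γi := Bool) (i := []) (o := [val w (size N - 1)]) (ℓ := ℓ) (by simp)
    (by simp; omega) (Finset.univ : Finset (Bst k)).toList _ hB'
  simp only [Finset.mem_toList, Finset.mem_univ, if_true] at h₄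
  have hinit : (rep k ⟨Function.update (fun _ => 0) 0 0, [], []⟩ fun _ => 0) =
      fun _ : Bst k => ([] : List Bool) := by
    funext j
    rcases j with _ | _ | _ | j | j <;> simp [rep]
  rw [hinit] at h₁
  have hall : Runs (Bounded ℓ) code _ _ _ := .seq h₁ (.seq h₂ (.seq h₃ h₄ le_rfl) le_rfl) le_rfl
  have hall' := hall.path_machine (bounded_stkOf.2 ⟨by simp, by simp; omega, by simp⟩)
  have htime : ((.X * (2 * .X + 3) + 1 + (p.time.comp P + (1 +
      (Finset.univ : Finset (Bst k)).toList.length * (2 * P + 5 * .X + 8 + 1))) + 1 :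
      Polynomial ℕ)).eval N = N * (2 * N + 3) + 1 + (p.time.eval V + (1 +
      (Finset.univ : Finset (Bst k)).toList.length * (ℓ + 1))) + 1 := by
    simp [Polynomial.eval_comp, ← hV, hℓ]
  have hst := hall'
  refine Classical.choice ?_
  obtain ⟨τ, hτ, hpath⟩ := hst
  refine ⟨⟨⟨τ, ?_⟩, ?_⟩⟩
  · have hin : List.map (Equiv.refl Bool).invFun w = w := by simp
    have hout : List.map (Equiv.refl Bool).invFun (Computability.encodeBool
      (val w (size N - 1))) = [val w (size N - 1)] := rfl
    erw [hin, hout]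
    exact hpath.iterate
  · rw [htime]
    exact hτ

end StackCode

/-! ### From unbounded to bounded fan-in -/

namespace StackCode

/-- A family of circuits with gates of unbounded fan-in: for `N` inputs there are `H N` levels of
`B N` gates, numbered consecutively, each with `K N` arguments. The gate `R` is a conjunction if
`op N R = 0`, and otherwise a disjunction. Its arguments are literals `ch N R c`: the code `0` is
the constant `false`, `1` is `true`, `2 + 2 y` is `y` and `3 + 2 y` its negation, where `y < N` is
an input and `N + R'` the gate `R'`, of a lower level. -/
structure TreeFamily where
  K : ℕ → ℕ
  B : ℕ → ℕ
  H : ℕ → ℕ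
  op : ℕ → ℕ → ℕ
  ch : ℕ → ℕ → ℕ → ℕ
  K_pos : ∀ N, 0 < K N
  B_pos : ∀ N, 0 < B N
  H_pos : ∀ N, 0 < H N

/-- The value of a literal, from the inputs `w` and the values `V` of the gates below `bound`. -/
def literalValue (w V : ℕ → Bool) (N bound c : ℕ) : Bool :=
  if c = 0 then false else if c = 1 then true else
    if (c - 2) / 2 < N then (w ((c - 2) / 2) ^^ decide (c % 2 = 1)) else
      if (c - 2) / 2 - N < bound then (V ((c - 2) / 2 - N) ^^ decide (c % 2 = 1)) else false

namespace TreeFamily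

variable (F : TreeFamily)

/-- The gates of bounded fan-in that replace one gate form a binary tree, in which the node `h` has
the children `2 h` and `2 h + 1`; this is the number of its nodes `1, …, 2 K - 1`, the last `K` of
which are the literals. -/
def block (N : ℕ) : ℕ := 2 * F.K N - 1

def size (N : ℕ) : ℕ := N + F.H N * F.B N * F.block N

def owner (N i : ℕ) : ℕ := (i - N) / F.block N

/-- The nodes of a tree are numbered backwards within its block, so that children precede their
parents and the root comes last. -/
def heap (N i : ℕ) : ℕ := F.block N - (i - N) % F.block N

def leaf (N i : ℕ) : ℕ := F.ch N (F.owner N i) (F.heap N i - F.K N)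

/-- A literal that names a gate refers to the root of the tree of that gate, the last place of its
block. -/
def target (N i : ℕ) : ℕ :=
  if (F.leaf N i - 2) / 2 < N then (F.leaf N i - 2) / 2 else
    N + ((F.leaf N i - 2) / 2 - N) * F.block N + (F.block N - 1)

/-- A positive literal becomes a disjunction of its target with itself. A reference to a gate of the
same or of a higher level counts as `false`; `F.owner N i / F.B N * F.B N` is the first gate of the
level. -/
def leafType (N i : ℕ) : ℕ :=
  if F.leaf N i = 0 then 0 else if F.leaf N i = 1 then 1 else
    if (F.leaf N i - 2) / 2 < N then (if F.leaf N i % 2 = 1 then 3 else 5) else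
      if (F.leaf N i - 2) / 2 - N < F.owner N i / F.B N * F.B N then
        (if F.leaf N i % 2 = 1 then 3 else 5) else 0

def type (N i : ℕ) : ℕ :=
  if i < N then 2 else if F.heap N i < F.K N then (if F.op N (F.owner N i) = 0 then 4 else 5) else
    F.leafType N i

/-- The places of the nodes `h` and `2 h` of a block differ by `h`, those of `h` and `2 h + 1` by `h
+ 1`. -/
def arg₁ (N i : ℕ) : ℕ :=
  if i < N then i else if F.heap N i < F.K N then i - F.heap N i else
    if F.leafType N i < 2 then 0 else F.target N i

def arg₂ (N i : ℕ) : ℕ :=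
  if i < N then 0 else if F.heap N i < F.K N then i - F.heap N i - 1 else
    if F.leafType N i = 5 then F.target N i else 0

end TreeFamily

/-- The gate of a given type with given arguments. -/
def mkGate (t a b : ℕ) : Gate :=
  if t = 0 then .const false else if t = 1 then .const true else if t = 2 then .input a else
    if t = 3 then .not a else if t = 4 then .and a b else .or a b

theorem optionWord_mkGate {t a b : ℕ} (ht : t ≤ 5) (h₁ : t < 2 → a = 0) (h₂ : t < 4 → b = 0) :
    Gate.optionWord (some (mkGate t a b)) =
      typeWord t ++ (a.bits.map (Sum.inr ∘ Sum.inl) ++ b.bits.map (Sum.inr ∘ Sum.inr)) := by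
  have key : ∀ (i : Fin 6) (a b : ℕ),
      Sum.inl i :: ((Computability.encodingProd Computability.encodingNatBool
        Computability.encodingNatBool).encode (a, b)).map Sum.inr =
      typeWord i ++ (a.bits.map (Sum.inr ∘ Sum.inl) ++ b.bits.map (Sum.inr ∘ Sum.inr)) := by
    intro i a b
    simp [typeWord, Computability.encodingProd, Computability.encodingNatBool, encodeNat_eq_bits]
  unfold Gate.optionWord mkGate
  interval_cases t
  · rw [h₁ (by norm_num), h₂ (by norm_num)]; exact key 0 _ _
  · rw [h₁ (by norm_num), h₂ (by norm_num)]; exact key 1 _ _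
  · rw [h₂ (by norm_num)]; exact key 2 _ _
  · rw [h₂ (by norm_num)]; exact key 3 _ _
  · exact key 4 _ _
  · exact key 5 _ _

namespace TreeFamily

variable (F : TreeFamily)

theorem block_pos (N : ℕ) : 0 < F.block N := by
  have := F.K_pos N
  unfold block; omega

theorem heap_pos (N i : ℕ) : 0 < F.heap N i := by
  have := Nat.mod_lt (i - N) (F.block_pos N)
  unfold heap; omega

theorem lt_size (N : ℕ) : N < F.size N := by
  have := Nat.mul_pos (Nat.mul_pos (F.H_pos N) (F.B_pos N)) (F.block_pos N)
  unfold size; omega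

theorem eq_index {N i : ℕ} (h : N ≤ i) :
    i + F.heap N i = N + F.owner N i * F.block N + F.block N := by
  have h₁ := Nat.mod_lt (i - N) (F.block_pos N)
  have h₂ := Nat.div_add_mod' (i - N) (F.block N)
  unfold heap owner; omega

theorem owner_index {N R h : ℕ} (h₁ : 1 ≤ h) (h₂ : h ≤ F.block N) :
    F.owner N (N + R * F.block N + (F.block N - h)) = R := by
  unfold owner
  rw [show N + R * F.block N + (F.block N - h) - N = (F.block N - h) + R * F.block N by omega,
    Nat.add_mul_div_right _ _ (F.block_pos N), Nat.div_eq_of_lt (by omega), Nat.zero_add]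

theorem heap_index {N R h : ℕ} (h₁ : 1 ≤ h) (h₂ : h ≤ F.block N) :
    F.heap N (N + R * F.block N + (F.block N - h)) = h := by
  unfold heap
  rw [show N + R * F.block N + (F.block N - h) - N = (F.block N - h) + R * F.block N by omega,
    Nat.add_mul_mod_self_right, Nat.mod_eq_of_lt (by omega)]
  omega

theorem leafType_mem (N i : ℕ) :
    F.leafType N i = 0 ∨ F.leafType N i = 1 ∨ F.leafType N i = 3 ∨ F.leafType N i = 5 := by
  unfold leafType; split_ifs <;> simp

theorem type_le (N i : ℕ) : F.type N i ≤ 5 := by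
  have := F.leafType_mem N i
  unfold type; split_ifs <;> omega

theorem target_lt {N i : ℕ} (h : N ≤ i) (ht : 2 ≤ F.leafType N i) : F.target N i < i := by
  have e := F.eq_index h
  have hh : F.heap N i ≤ F.block N := by unfold heap; omega
  have hb := F.block_pos N
  unfold leafType at ht
  unfold target
  have key : ∀ R' : ℕ, R' < F.owner N i / F.B N * F.B N →
      R' * F.block N + F.block N ≤ F.owner N i * F.block N := by
    intro R' h'
    have := Nat.mul_le_mul_right (F.block N)
      (show R' + 1 ≤ F.owner N i from h'.trans_le (Nat.div_mul_le_self _ _))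
    rwa [Nat.add_mul, Nat.one_mul] at this
  split_ifs at ht ⊢ <;> first | omega | skip
  all_goals have := key _ (by assumption); omega

theorem child_lt {N i : ℕ} (h : N ≤ i) (hh : F.heap N i < F.K N) : F.heap N i < i := by
  have e := F.eq_index h
  unfold block at e; omega

theorem type_eq_two {N i : ℕ} (h : F.type N i = 2) : i < N := by
  have := F.leafType_mem N i
  unfold type at h
  split_ifs at h <;> omega

theorem arg₁_lt {N i : ℕ} (h : N ≤ i) (ht : 2 ≤ F.type N i) : F.arg₁ N i < i := by
  have h₁ := @F.target_lt N i h
  have h₂ := @F.child_lt N i h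
  have h₃ := F.heap_pos N i
  unfold type at ht
  unfold arg₁
  split_ifs at ht ⊢ <;> omega

theorem arg₂_lt {N i : ℕ} (h : N ≤ i) (ht : 4 ≤ F.type N i) : F.arg₂ N i < i := by
  have h₁ := @F.target_lt N i h
  have h₂ := @F.child_lt N i h
  have h₃ := F.heap_pos N i
  have h₄ := F.leafType_mem N i
  unfold type at ht
  unfold arg₂
  split_ifs at ht ⊢ <;> omega

theorem arg₁_eq_zero {N i : ℕ} (ht : F.type N i < 2) : F.arg₁ N i = 0 := by
  unfold type at ht
  unfold arg₁
  split_ifs at ht ⊢ <;> omega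

theorem arg₂_eq_zero {N i : ℕ} (ht : F.type N i < 4) : F.arg₂ N i = 0 := by
  unfold type at ht
  unfold arg₂
  split_ifs at ht ⊢ <;> omega

/-- The equivalent circuit of fan-in two. -/
def circuit (N : ℕ) : BoolCircuit N where
  gates := (List.range (F.size N)).map fun i => mkGate (F.type N i) (F.arg₁ N i) (F.arg₂ N i)
  nonempty := by
    have := F.lt_size N
    simp; omega
  wellFormed := by
    intro i g hg
    simp only [List.getElem?_map, Option.map_eq_some_iff] at hg
    obtain ⟨j, hj, rfl⟩ := hg
    obtain ⟨-, rfl⟩ := List.getElem?_eq_some_iff.1 hj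
    rw [List.getElem_range]
    unfold mkGate
    split_ifs with h₀ h₁ h₂ h₃ h₄
    · trivial
    · trivial
    · have := F.type_eq_two h₂
      simp [Gate.WellFormed, arg₁, this]
    all_goals
      have hN : N ≤ i := by
        by_contra h
        simp [type, not_le.1 h] at h₂
    · exact F.arg₁_lt hN (by omega)
    · exact ⟨F.arg₁_lt hN (by omega), F.arg₂_lt hN (by omega)⟩
    · have := F.type_le N i
      exact ⟨F.arg₁_lt hN (by omega), F.arg₂_lt hN (by omega)⟩

theorem size_circuit (N : ℕ) : (F.circuit N).size = F.size N := by
  simp [circuit, BoolCircuit.size]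

theorem getElem?_circuit {N i : ℕ} (h : i < F.size N) :
    (F.circuit N).gates[i]? = some (mkGate (F.type N i) (F.arg₁ N i) (F.arg₂ N i)) := by
  simp [circuit, List.getElem?_range h]

theorem getElem?_circuit_of_le {N i : ℕ} (h : F.size N ≤ i) :
    (F.circuit N).gates[i]? = none := by
  simpa [circuit] using h

theorem gateValue_eq {N i : ℕ} (h : i < F.size N) (w : ℕ → Bool) :
    (F.circuit N).gateValue w i = (mkGate (F.type N i) (F.arg₁ N i) (F.arg₂ N i)).eval w
      (fun j => if j < i then (F.circuit N).gateValue w j else false) := by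
  rw [BoolCircuit.gateValue, F.getElem?_circuit h]
  simp

theorem gateDepth_eq {N i : ℕ} (h : i < F.size N) :
    (F.circuit N).gateDepth i = (mkGate (F.type N i) (F.arg₁ N i) (F.arg₂ N i)).depth
      (fun j => if j < i then (F.circuit N).gateDepth j else 0) := by
  rw [BoolCircuit.gateDepth, F.getElem?_circuit h]
  simp

theorem gateValue_input {N i : ℕ} (h : i < N) (w : ℕ → Bool) :
    (F.circuit N).gateValue w i = w i := by
  rw [F.gateValue_eq (h.trans (F.lt_size N))]
  simp [type, arg₁, h, mkGate, Gate.eval]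

/-- The values `x` and `y` are prescribed only where the argument is an earlier gate. The evaluation
looks up two values for every gate, and one that the gate does not use may be arbitrary. -/
theorem gateValue_gateResult {N i : ℕ} (h : N ≤ i) (hi : i < F.size N) (w : ℕ → Bool)
    (x y : Bool) (hx : F.arg₁ N i < i → x = (F.circuit N).gateValue w (F.arg₁ N i))
    (hy : F.arg₂ N i < i → y = (F.circuit N).gateValue w (F.arg₂ N i)) :
    (F.circuit N).gateValue w i = gateResult (F.type N i) x y := by
  rw [F.gateValue_eq hi]
  have h5 := F.type_le N i
  have h2 : F.type N i ≠ 2 := fun h' => (F.type_eq_two h').not_ge h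
  have h₁ := @F.arg₁_lt N i h
  have h₂ := @F.arg₂_lt N i h
  obtain e | e | e | e | e : F.type N i = 0 ∨ F.type N i = 1 ∨ F.type N i = 3 ∨ F.type N i = 4 ∨
    F.type N i = 5 := by omega
  · simp [e, mkGate, gateResult, Gate.eval]
  · simp [e, mkGate, gateResult, Gate.eval]
  · have a := h₁ (by omega)
    simp [e, mkGate, gateResult, Gate.eval, a, hx a]
  · have a := h₁ (by omega)
    have b := h₂ (by omega)
    simp [e, mkGate, gateResult, Gate.eval, a, hx a, b, hy b]
  · have a := h₁ (by omega)
    have b := h₂ (by omega)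
    simp [e, mkGate, gateResult, Gate.eval, a, hx a, b, hy b]

end TreeFamily

end StackCode

/-! ### The values and the uniformity of the circuits of bounded fan-in -/

namespace StackCode

/-- The nodes `K`, ..., `2 K - 1` are the leaves. From a node that satisfies `P` one descends
through children that satisfy it until a leaf is reached; conversely, `P` climbs from `h` to `h / 2`
and finally to the root. The number `K` need not be a power of two. -/
theorem heap_exists {K : ℕ} (hK : 0 < K) {P : ℕ → Prop}
    (hP : ∀ h, 1 ≤ h → h < K → (P h ↔ P (2 * h) ∨ P (2 * h + 1))) :
    P 1 ↔ ∃ c < K, P (K + c) := by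
  have down : ∀ d h, 1 ≤ h → h < 2 * K → 2 * K - h ≤ d → P h → ∃ c < K, P (K + c) := by
    intro d
    induction d with
    | zero => intro h _ _ _; omega
    | succ d ih =>
      intro h h₁ h₂ h₃ hh
      by_cases hK : h < K
      · rcases (hP h h₁ hK).1 hh with h' | h'
        · exact ih (2 * h) (by omega) (by omega) (by omega) h'
        · exact ih (2 * h + 1) (by omega) (by omega) (by omega) h'
      · exact ⟨h - K, by omega, by rwa [show K + (h - K) = h by omega]⟩
  have up : ∀ h, 1 ≤ h → h < 2 * K → P h → P 1 := by
    intro h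
    induction h using Nat.strong_induction_on with
    | _ h ih =>
      intro h₁ h₂ hh
      rcases Nat.lt_or_ge 1 h with h3 | h3
      · refine ih (h / 2) (by omega) (by omega) (by omega) ((hP (h / 2) (by omega) (by omega)).2 ?_)
        rcases Nat.mod_two_eq_zero_or_one h with e | e
        · left; rwa [show 2 * (h / 2) = h by omega]
        · right; rwa [show 2 * (h / 2) + 1 = h by omega]
      · rwa [show h = 1 by omega] at hh
  exact ⟨down _ 1 le_rfl (by omega) le_rfl, fun ⟨c, hc, h⟩ => up _ (by omega) (by omega) h⟩

namespace TreeFamily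

variable (F : TreeFamily)

/-- The number of the node `h` of the tree of the gate `R`. -/
def index (N R h : ℕ) : ℕ := N + R * F.block N + (F.block N - h)

/-- The value of the gate `R`. -/
def value (w : ℕ → Bool) (N R : ℕ) : Bool := (F.circuit N).gateValue w (F.index N R 1)

variable {F} {N R h : ℕ}

theorem index_lt (hR : R < F.H N * F.B N) (h₁ : 1 ≤ h) : F.index N R h < F.size N := by
  have := Nat.mul_le_mul_right (F.block N) (show R + 1 ≤ F.H N * F.B N from hR)
  have hb := F.block_pos N
  rw [Nat.add_mul, Nat.one_mul] at this
  unfold index size; omega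

theorem le_index : N ≤ F.index N R h := by unfold index; omega

theorem type_index (h₁ : 1 ≤ h) (h₂ : h ≤ F.block N) : F.type N (F.index N R h) =
    if h < F.K N then (if F.op N R = 0 then 4 else 5) else F.leafType N (F.index N R h) := by
  have := @le_index F N R h
  simp only [type, index, F.owner_index h₁ h₂, F.heap_index h₁ h₂] at *
  rw [if_neg (by omega)]

theorem arg₁_index (h₁ : 1 ≤ h) (h₂ : h < F.K N) :
    F.arg₁ N (F.index N R h) = F.index N R (2 * h) := by
  have := @le_index F N R h
  have hb : h ≤ F.block N := by unfold block; omega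
  simp only [arg₁, index, F.heap_index h₁ hb] at *
  rw [if_neg (by omega), if_pos h₂]
  unfold block; omega

theorem arg₂_index (h₁ : 1 ≤ h) (h₂ : h < F.K N) :
    F.arg₂ N (F.index N R h) = F.index N R (2 * h + 1) := by
  have := @le_index F N R h
  have hb : h ≤ F.block N := by unfold block; omega
  simp only [arg₂, index, F.heap_index h₁ hb] at *
  rw [if_neg (by omega), if_pos h₂]
  unfold block; omega

theorem gateValue_node (w : ℕ → Bool) (hR : R < F.H N * F.B N) (h₁ : 1 ≤ h) (h₂ : h < F.K N) :
    (F.circuit N).gateValue w (F.index N R h) =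
      if F.op N R = 0 then
        ((F.circuit N).gateValue w (F.index N R (2 * h)) &&
          (F.circuit N).gateValue w (F.index N R (2 * h + 1)))
      else
        ((F.circuit N).gateValue w (F.index N R (2 * h)) ||
          (F.circuit N).gateValue w (F.index N R (2 * h + 1))) := by
  have hb : h ≤ F.block N := by unfold block; omega
  rw [F.gateValue_gateResult le_index (index_lt hR h₁) w _ _ (fun _ => rfl) (fun _ => rfl),
    type_index h₁ hb, if_pos h₂, arg₁_index h₁ h₂, arg₂_index h₁ h₂]
  unfold gateResult
  split_ifs <;> simp_all

theorem gateValue_leaf (w : ℕ → Bool) {c : ℕ} (hR : R < F.H N * F.B N) (hc : c < F.K N) :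
    (F.circuit N).gateValue w (F.index N R (F.K N + c)) =
      literalValue w (F.value w N) N (R / F.B N * F.B N) (F.ch N R c) := by
  have h₁ : 1 ≤ F.K N + c := by omega
  have hb : F.K N + c ≤ F.block N := by unfold block; omega
  have hl : F.leaf N (F.index N R (F.K N + c)) = F.ch N R c := by
    simp only [leaf, index, F.owner_index h₁ hb, F.heap_index h₁ hb]
    congr 1; omega
  have hh : F.heap N (F.index N R (F.K N + c)) = F.K N + c := F.heap_index h₁ hb
  have ho : F.owner N (F.index N R (F.K N + c)) = R := F.owner_index h₁ hb
  have hN := @le_index F N R (F.K N + c)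
  have hi := index_lt hR h₁
  rw [F.gateValue_gateResult hN hi w _ _ (fun _ => rfl) (fun _ => rfl), type_index h₁ hb,
    if_neg (by omega)]
  set i := F.index N R (F.K N + c) with hid
  have hlt : F.leafType N i = if F.ch N R c = 0 then 0 else if F.ch N R c = 1 then 1 else
    if (F.ch N R c - 2) / 2 < N then (if F.ch N R c % 2 = 1 then 3 else 5) else
      if (F.ch N R c - 2) / 2 - N < R / F.B N * F.B N then
        (if F.ch N R c % 2 = 1 then 3 else 5) else 0 := by rw [leafType, hl, ho]
  have ht : F.target N i = if (F.ch N R c - 2) / 2 < N then (F.ch N R c - 2) / 2 else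
    F.index N ((F.ch N R c - 2) / 2 - N) 1 := by rw [target, hl]; rfl
  have h₃ : F.arg₁ N i = if F.leafType N i < 2 then 0 else F.target N i := by
    rw [arg₁, if_neg (by omega), if_neg (by omega)]
  have h₄ : F.arg₂ N i = if F.leafType N i = 5 then F.target N i else 0 := by
    rw [arg₂, if_neg (by omega), if_neg (by omega)]
  rw [h₃, h₄, ht, hlt]
  unfold literalValue value
  split_ifs <;> first | omega | simp_all [gateResult, gateValue_input]

/-- The value of a gate of unbounded fan-in. -/
theorem value_eq_true_iff (w : ℕ → Bool) (hR : R < F.H N * F.B N) :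
    F.value w N R = true ↔
      if F.op N R = 0 then
        ∀ c < F.K N, literalValue w (F.value w N) N (R / F.B N * F.B N) (F.ch N R c) = true
      else
        ∃ c < F.K N, literalValue w (F.value w N) N (R / F.B N * F.B N) (F.ch N R c) = true := by
  split_ifs with hop
  -- A conjunction fails exactly if one of its leaves does, so the statement on trees is applied to
  -- the value `false`.
  · have := heap_exists (F.K_pos N)
      (P := fun h => (F.circuit N).gateValue w (F.index N R h) = false) (fun h h₁ h₂ => by
        rw [gateValue_node w hR h₁ h₂, if_pos hop, Bool.and_eq_false_iff])
    rw [← not_iff_not, Bool.not_eq_true]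
    refine this.trans ?_
    push Not
    refine exists_congr fun c => and_congr_right fun hc => ?_
    rw [gateValue_leaf w hR hc]
    exact Bool.eq_false_iff
  · refine (heap_exists (F.K_pos N)
      (P := fun h => (F.circuit N).gateValue w (F.index N R h) = true) (fun h h₁ h₂ => by
        rw [gateValue_node w hR h₁ h₂, if_neg hop, Bool.or_eq_true])).trans ?_
    refine exists_congr fun c => and_congr_right fun hc => ?_
    rw [gateValue_leaf w hR hc]

theorem output_circuit (w : List Bool) (N : ℕ) :
    (F.circuit N).output w = F.value (fun k => w.getD k false) N (F.H N * F.B N - 1) := by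
  have hb := F.block_pos N
  obtain ⟨m, hm⟩ := Nat.exists_eq_add_of_lt (Nat.mul_pos (F.H_pos N) (F.B_pos N))
  rw [BoolCircuit.output, value, F.size_circuit, size, index]
  rw [hm]
  congr 1
  simp only [Nat.zero_add, Nat.add_sub_cancel, Nat.add_mul, Nat.one_mul]
  generalize m * F.block N = X
  omega

theorem depth_mkGate_le {t a b : ℕ} {d : ℕ → ℕ} {m : ℕ} (h₁ : 2 ≤ t → t ≠ 2 → d a ≤ m)
    (h₂ : 4 ≤ t → d b ≤ m) : (mkGate t a b).depth d ≤ m + 1 := by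
  unfold mkGate
  split_ifs <;> simp only [Gate.depth] <;> omega

theorem gateDepth_input {i : ℕ} (h : i < N) : (F.circuit N).gateDepth i = 0 := by
  rw [F.gateDepth_eq (h.trans (F.lt_size N))]
  simp [type, h, mkGate, Gate.depth]

/-- The condition `F.K N ≤ 2 ^ e * h` says that the node `h` is at most `e` steps above the leaves.
The induction is on the gate and then on `e`; each level contributes the height of a tree and one
more for the leaves, which is `s`. -/
theorem gateDepth_index {s : ℕ} (hs : s = Nat.clog 2 (F.K N) + 1) :
    ∀ R, R < F.H N * F.B N → ∀ e h, e + 1 ≤ s → 1 ≤ h → h ≤ F.block N → F.K N ≤ 2 ^ e * h →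
      (F.circuit N).gateDepth (F.index N R h) ≤ R / F.B N * s + 1 + e := by
  intro R
  induction R using Nat.strong_induction_on with
  | _ R ihR =>
    intro hR e
    induction e with
    | zero =>
      intro h he h₁ hb hK
      have hN := @le_index F N R h
      have hi := index_lt hR h₁
      have hh : F.heap N (F.index N R h) = h := F.heap_index h₁ hb
      have ho : F.owner N (F.index N R h) = R := F.owner_index h₁ hb
      rw [F.gateDepth_eq hi]
      have key : 2 ≤ F.leafType N (F.index N R h) →
          (F.circuit N).gateDepth (F.target N (F.index N R h)) ≤ R / F.B N * s := by
        intro ht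
        unfold leafType at ht
        unfold target
        rw [ho] at ht
        have hlow : (F.leaf N (F.index N R h) - 2) / 2 - N < R / F.B N * F.B N →
            (F.circuit N).gateDepth (F.index N ((F.leaf N (F.index N R h) - 2) / 2 - N) 1) ≤
              R / F.B N * s := by
          intro hlt
          set R' := (F.leaf N (F.index N R h) - 2) / 2 - N
          have hRR : R' < R := hlt.trans_le (Nat.div_mul_le_self _ _)
          have hq : R' / F.B N + 1 ≤ R / F.B N := (Nat.div_lt_iff_lt_mul (F.B_pos N)).2 hlt
          have := ihR R' hRR (hRR.trans hR) (Nat.clog 2 (F.K N)) 1 hs.ge le_rfl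
            (F.block_pos N) (by simpa using Nat.le_pow_clog one_lt_two (F.K N))
          have h3 := Nat.mul_le_mul_right s hq
          rw [Nat.add_mul] at h3
          omega
        split_ifs at ht ⊢ <;> first | omega | skip
        all_goals first | exact hlow (by assumption) | skip
        all_goals rw [gateDepth_input (by assumption)]; omega
      have h2 : F.type N (F.index N R h) = F.leafType N (F.index N R h) := by
        rw [type_index h₁ hb, if_neg (by omega)]
      have h3 : F.arg₁ N (F.index N R h) = if F.leafType N (F.index N R h) < 2 then 0 else
          F.target N (F.index N R h) := by
        rw [arg₁, if_neg (by omega), if_neg (by omega)]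
      have h4 : F.arg₂ N (F.index N R h) = if F.leafType N (F.index N R h) = 5 then
          F.target N (F.index N R h) else 0 := by
        rw [arg₂, if_neg (by omega), if_neg (by omega)]
      have hm := F.leafType_mem N (F.index N R h)
      refine depth_mkGate_le (fun ht _ => ?_) (fun ht => ?_)
      · split_ifs
        · rw [h3, if_neg (by omega)]; exact key (by omega)
        · omega
      · split_ifs
        · rw [h4, if_pos (by omega)]; exact key (by omega)
        · omega
    | succ e ih =>
      intro h he h₁ hb hK
      by_cases hlt : F.K N ≤ h
      · have := ih h (by omega) h₁ hb (hlt.trans (Nat.le_mul_of_pos_left _ (by positivity)))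
        omega
      · have hlt := not_le.1 hlt
        rw [F.gateDepth_eq (index_lt hR h₁), arg₁_index h₁ hlt, arg₂_index h₁ hlt]
        have hK' : F.K N ≤ 2 ^ e * (2 * h) := by rwa [← Nat.mul_assoc, ← pow_succ]
        refine depth_mkGate_le (fun _ _ => ?_) (fun _ => ?_)
        · split_ifs
          · exact ih (2 * h) (by omega) (by omega) (by unfold block; omega) hK'
          · omega
        · split_ifs
          · exact ih (2 * h + 1) (by omega) (by omega) (by unfold block; omega)
              (hK'.trans (Nat.mul_le_mul_left _ (by omega)))
          · omega

theorem depthAtMost (N : ℕ) :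
    (F.circuit N).DepthAtMost (F.H N * (Nat.clog 2 (F.K N) + 1)) := by
  intro i hi
  rw [F.size_circuit] at hi
  rcases Nat.lt_or_ge i N with h | h
  · rw [gateDepth_input h]; omega
  have e := F.eq_index h
  have hh : F.heap N i ≤ F.block N := by unfold heap; omega
  have ho : F.owner N i < F.H N * F.B N := by
    unfold owner
    rw [Nat.div_lt_iff_lt_mul (F.block_pos N)]
    unfold size at hi; omega
  have hidx : i = F.index N (F.owner N i) (F.heap N i) := by unfold index; omega
  have := gateDepth_index (N := N) rfl (F.owner N i) ho (Nat.clog 2 (F.K N)) (F.heap N i) le_rfl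
    (F.heap_pos N i) hh ((Nat.le_pow_clog one_lt_two _).trans
      (Nat.le_mul_of_pos_right _ (F.heap_pos N i)))
  rw [← hidx] at this
  have hq : F.owner N i / F.B N + 1 ≤ F.H N := (Nat.div_lt_iff_lt_mul (F.B_pos N)).2 ho
  have := Nat.mul_le_mul_right (Nat.clog 2 (F.K N) + 1) hq
  rw [Nat.add_mul] at this
  omega

end TreeFamily

end StackCode

/-! ### Uniform families of circuits of unbounded fan-in -/

namespace StackCode

/-- Loop computability is preserved by the substitution into `f`. -/
def Loop₁ (f : ℕ → ℕ) : Prop :=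
  ∀ ⦃v : ℕ⦄ ⦃a : (Fin v → ℕ) → ℕ⦄, LoopComputable a → LoopComputable fun x => f (a x)

/-- Loop computability is preserved by the substitution into `f`. -/
def Loop₂ (f : ℕ → ℕ → ℕ) : Prop :=
  ∀ ⦃v : ℕ⦄ ⦃a b : (Fin v → ℕ) → ℕ⦄, LoopComputable a → LoopComputable b →
    LoopComputable fun x => f (a x) (b x)

/-- Loop computability is preserved by the substitution into `f`. -/
def Loop₃ (f : ℕ → ℕ → ℕ → ℕ) : Prop :=
  ∀ ⦃v : ℕ⦄ ⦃a b c : (Fin v → ℕ) → ℕ⦄, LoopComputable a → LoopComputable b → LoopComputable c →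
    LoopComputable fun x => f (a x) (b x) (c x)

theorem Loop₂.loopComputable₂ {f : ℕ → ℕ → ℕ} (hf : Loop₂ f) : LoopComputable₂ f :=
  hf (.proj 0) (.proj 1)

namespace TreeFamily

variable {F : TreeFamily}

variable (F) in
/-- The data of the family are computable by loop programs. -/
structure Uniform : Prop where
  K : Loop₁ F.K
  B : Loop₁ F.B
  H : Loop₁ F.H
  op : Loop₂ F.op
  ch : Loop₃ F.ch

theorem Uniform.block (hF : F.Uniform) : Loop₁ F.block := fun _ _ ha =>
  .sub (.mul (.const 2) (hF.K ha)) (.const 1)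

theorem Uniform.size (hF : F.Uniform) : Loop₁ F.size := fun _ _ ha =>
  .add ha (.mul (.mul (hF.H ha) (hF.B ha)) (hF.block ha))

theorem Uniform.owner (hF : F.Uniform) : Loop₂ F.owner := fun _ _ _ ha hb =>
  .div (.sub hb ha) (hF.block ha)

theorem Uniform.heap (hF : F.Uniform) : Loop₂ F.heap := fun _ _ _ ha hb =>
  .sub (hF.block ha) (.mod (.sub hb ha) (hF.block ha))

theorem Uniform.leaf (hF : F.Uniform) : Loop₂ F.leaf := fun _ _ _ ha hb =>
  hF.ch ha (hF.owner ha hb) (.sub (hF.heap ha hb) (hF.K ha))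

theorem Uniform.source (hF : F.Uniform) : Loop₂ fun N i => (F.leaf N i - 2) / 2 :=
  fun _ _ _ ha hb => .div (.sub (hF.leaf ha hb) (.const 2)) (.const 2)

theorem Uniform.target (hF : F.Uniform) : Loop₂ F.target := fun _ _ _ ha hb =>
  .iflt (hF.source ha hb) ha (hF.source ha hb) <|
    .add (.add ha (.mul (.sub (hF.source ha hb) ha) (hF.block ha)))
      (.sub (hF.block ha) (.const 1))

theorem Uniform.leafType (hF : F.Uniform) : Loop₂ F.leafType := fun _ _ _ ha hb =>
  have h := LoopComputable.ifeq (.mod (hF.leaf ha hb) (.const 2)) (.const 1) (.const 3) (.const 5)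
  .ifeq (hF.leaf ha hb) (.const 0) (.const 0) <| .ifeq (hF.leaf ha hb) (.const 1) (.const 1) <|
    .iflt (hF.source ha hb) ha h <| .iflt (.sub (hF.source ha hb) ha)
      (.mul (.div (hF.owner ha hb) (hF.B ha)) (hF.B ha)) h (.const 0)

theorem Uniform.type (hF : F.Uniform) : Loop₂ F.type := fun _ _ _ ha hb =>
  .iflt hb ha (.const 2) <| .iflt (hF.heap ha hb) (hF.K ha)
    (.ifeq (hF.op ha (hF.owner ha hb)) (.const 0) (.const 4) (.const 5)) (hF.leafType ha hb)

theorem Uniform.arg₁ (hF : F.Uniform) : Loop₂ F.arg₁ := fun _ _ _ ha hb =>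
  .iflt hb ha hb <| .iflt (hF.heap ha hb) (hF.K ha) (.sub hb (hF.heap ha hb)) <|
    .iflt (hF.leafType ha hb) (.const 2) (.const 0) (hF.target ha hb)

theorem Uniform.arg₂ (hF : F.Uniform) : Loop₂ F.arg₂ := fun _ _ _ ha hb =>
  .iflt hb ha (.const 0) <|
    .iflt (hF.heap ha hb) (hF.K ha) (.sub (.sub hb (hF.heap ha hb)) (.const 1)) <|
    .ifeq (hF.leafType ha hb) (.const 5) (hF.target ha hb) (.const 0)

theorem Uniform.logspaceUniform (hF : F.Uniform) : LogspaceUniform F.circuit := by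
  have cut : ∀ {f : ℕ → ℕ → ℕ} (c : ℕ), Loop₂ f →
      LoopComputable₂ fun N i => if i < F.size N then f N i else c := fun c hf =>
    .iflt (.proj 1) (hF.size (.proj 0)) (hf.loopComputable₂) (.const c)
  -- The type `6`, to which `typeWord` assigns the empty word, stands for the absence of a gate.
  refine linearSpace_of_loopComputable (cut 6 hF.type) (cut 0 hF.arg₁) (cut 0 hF.arg₂) ?_
  intro N i
  by_cases h : i < F.size N
  · simp only [F.getElem?_circuit h, if_pos h]
    exact optionWord_mkGate (F.type_le N i) (F.arg₁_eq_zero) (F.arg₂_eq_zero)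
  · simp only [F.getElem?_circuit_of_le (not_lt.1 h), if_neg h]
    simp [Gate.optionWord, typeWord]

theorem Uniform.exists_size_le (hF : F.Uniform) :
    ∃ c : ℕ, ∀ N, (F.circuit N).size ≤ N ^ c + c := by
  obtain ⟨e, he⟩ := (hF.size (v := 1) (.proj 0)).polyBounded
  -- For `N ≥ 2` one has `N + 2 ≤ N ^ 2`, which leads to the exponent `2 * e`; for smaller `N` the
  -- bound is `3 ^ e`.
  refine ⟨2 * e + 3 ^ e, fun N => ?_⟩
  rw [F.size_circuit]
  refine (by simpa using he (fun _ => N) N (by simp) : F.size N ≤ (N + 2) ^ e).trans ?_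
  rcases Nat.lt_or_ge N 2 with h | h
  · have := Nat.pow_le_pow_left (show N + 2 ≤ 3 by omega) e
    omega
  · have h₁ := Nat.pow_le_pow_left (show N + 2 ≤ N ^ 2 by nlinarith) e
    have h₂ := Nat.pow_le_pow_right (show 0 < N by omega) (Nat.le_add_right (2 * e) (3 ^ e))
    rw [← pow_mul] at h₁
    exact (h₁.trans h₂).trans (Nat.le_add_right _ _)

/-- The fan-in is polynomially bounded, so each of the O(log N) levels becomes a layer of trees of
height O(log N). -/
theorem Uniform.exists_depth_le (hF : F.Uniform) {a : ℕ} (ha : ∀ N, F.H N ≤ a * Nat.log 2 N + a) :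
    ∃ c : ℕ, ∀ N, (F.circuit N).DepthAtMost (c * (Nat.log 2 N) ^ 2 + c) := by
  obtain ⟨e, he⟩ := (hF.K (v := 1) (.proj 0)).polyBounded
  refine ⟨2 * (a * (2 * e + 1)), fun N i hi => (F.depthAtMost N i hi).trans ?_⟩
  set l := Nat.log 2 N with hl
  have h₁ : N + 2 ≤ 2 ^ (l + 2) := by
    have h := Nat.lt_pow_succ_log_self one_lt_two N
    have h' := Nat.one_le_two_pow (n := l + 1)
    have h'' : 2 ^ (l + 2) = 2 * 2 ^ (l + 1) := by ring
    have h3 : 2 ^ (l + 1) = 2 * 2 ^ l := by ring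
    have := Nat.one_le_two_pow (n := l)
    simp only [Nat.succ_eq_add_one, ← hl] at h
    omega
  have h₂ : F.K N ≤ 2 ^ ((l + 2) * e) := by
    refine (by simpa using he (fun _ => N) N (by simp) : F.K N ≤ (N + 2) ^ e).trans ?_
    rw [pow_mul]
    exact Nat.pow_le_pow_left h₁ e
  have h₃ := Nat.clog_le_of_le_pow h₂
  calc F.H N * (Nat.clog 2 (F.K N) + 1) ≤ (a * l + a) * ((l + 2) * e + 1) :=
        Nat.mul_le_mul (ha N) (by omega)
    _ ≤ (a * (l + 1)) * ((2 * e + 1) * (l + 1)) := by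
        refine Nat.mul_le_mul (by rw [Nat.mul_add, Nat.mul_one]) ?_
        nlinarith [Nat.zero_le (l * e), Nat.zero_le l]
    _ = a * (2 * e + 1) * ((l + 1) ^ 2) := by ring
    _ ≤ a * (2 * e + 1) * (2 * l ^ 2 + 2) := by
        refine Nat.mul_le_mul_left _ ?_
        zify
        nlinarith [sq_nonneg ((l : ℤ) - 1)]
    _ = _ := by ring

theorem Uniform.inNC (hF : F.Uniform) {a : ℕ} (ha : ∀ N, F.H N ≤ a * Nat.log 2 N + a)
    {L : Set (List Bool)}
    (hL : ∀ w : List Bool, F.value (fun k => w.getD k false) w.length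
      (F.H w.length * F.B w.length - 1) = true ↔ w ∈ L) : InNC 2 L :=
  ⟨F.circuit, fun w => by rw [output_circuit, hL], hF.exists_size_le, hF.exists_depth_le ha,
    hF.logspaceUniform⟩

/-- No bound on the depth is needed here: the size is polynomial for every uniform family, and the
gates are evaluated one after another. -/
theorem Uniform.inPolyTime (hF : F.Uniform) {L : Set (List Bool)}
    (hL : ∀ w : List Bool, F.value (fun k => w.getD k false) w.length
      (F.H w.length * F.B w.length - 1) = true ↔ w ∈ L) : InPolyTime L := by
  refine inPolyTime_of_loopComputable (hF.size (.proj 0)) hF.type.loopComputable₂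
    hF.arg₁.loopComputable₂ hF.arg₂.loopComputable₂ F.type_le F.lt_size
    (fun w => (F.circuit w.length).gateValue fun k => w.getD k false) (fun w i h => ?_)
    (fun w i h hi x y hx hy => F.gateValue_gateResult h hi _ x y hx hy) fun w => ?_
  · rw [F.gateValue_input h]
    simp [h]
  · rw [← hL, ← output_circuit, BoolCircuit.output, F.size_circuit]

end TreeFamily

end StackCode

/-! ### Layers of disjunctions of conjunctions -/

namespace StackCode

theorem literalValue_add_two (w V : ℕ → Bool) (N b c : ℕ) :
    literalValue w V N b (2 + c) =
      if c / 2 < N then (w (c / 2) ^^ decide (c % 2 = 1)) else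
        if c / 2 - N < b then (V (c / 2 - N) ^^ decide (c % 2 = 1)) else false := by
  have h₁ : 2 + c ≠ 0 := by omega
  have h₂ : 2 + c ≠ 1 := by omega
  have h₃ : 2 + c - 2 = c := by omega
  have h₄ : (2 + c) % 2 = c % 2 := by omega
  rw [literalValue, if_neg h₁, if_neg h₂, h₃, h₄]

theorem literalValue_gate (w V : ℕ → Bool) {N b R : ℕ} (h : R < b) :
    literalValue w V N b (2 + 2 * (N + R)) = V R := by
  simp [literalValue_add_two, h]

theorem literalValue_not_gate (w V : ℕ → Bool) {N b R : ℕ} (h : R < b) :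
    literalValue w V N b (2 + 2 * (N + R) + 1) = !V R := by
  have h₁ : (2 * (N + R) + 1) / 2 = N + R := by omega
  have h₂ : (2 * (N + R) + 1) % 2 = 1 := by omega
  simp [Nat.add_assoc 2, literalValue_add_two, h₁, h₂, h]

/-- A family of circuits in layers: each of the `H N` layers consists of `Z N` gates, each of which
is a disjunction of `K N` conjunctions of `K N` literals. The literal `c` of the conjunction `q` of
the gate `z` of the layer `l` has the code `ref N l z q c`. -/
structure LayerFamily where
  K : ℕ → ℕ
  Z : ℕ → ℕ
  H : ℕ → ℕ
  ref : ℕ → ℕ → ℕ → ℕ → ℕ → ℕ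
  K_pos : ∀ N, 0 < K N
  Z_pos : ∀ N, 0 < Z N
  H_pos : ∀ N, 0 < H N

namespace LayerFamily

variable (F : LayerFamily)

/-- All levels of a `TreeFamily` have the same number of gates. A level of disjunctions therefore
repeats its `Z N` gates, the place `a` being a copy of `a % Z N`. -/
def width (N : ℕ) : ℕ := F.Z N * F.K N

theorem width_pos (N : ℕ) : 0 < F.width N := Nat.mul_pos (F.Z_pos N) (F.K_pos N)

/-- The gates of the even levels are the conjunctions, those of the odd levels the disjunctions. -/
def toTree : TreeFamily where
  K := F.K
  B := F.width
  H N := 2 * F.H N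
  op N R := R / F.width N % 2
  ch N R c :=
    if R / F.width N % 2 = 0 then
      F.ref N (R / F.width N / 2) (R % F.width N / F.K N) (R % F.width N % F.K N) c
    else 2 + 2 * (N + (R / F.width N - 1) * F.width N + R % F.width N % F.Z N * F.K N + c)
  K_pos := F.K_pos
  B_pos := F.width_pos
  H_pos N := Nat.mul_pos two_pos (F.H_pos N)

/-- The code of the gate `z` of the layer `l`, as a literal. -/
def gateCode (N l z : ℕ) : ℕ := 2 + 2 * (N + ((2 * l + 1) * F.width N + z))

/-- The value of the gate `z` of the layer `l`. -/
def val (w : ℕ → Bool) (N l z : ℕ) : Bool := F.toTree.value w N ((2 * l + 1) * F.width N + z)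

/-- The value of a literal in the layer `l`. -/
def lit (w : ℕ → Bool) (N l c : ℕ) : Bool :=
  literalValue w (F.toTree.value w N) N (2 * l * F.width N) c

variable {F} {w : ℕ → Bool} {N l : ℕ}

@[simp] theorem lit_zero : F.lit w N l 0 = false := rfl

@[simp] theorem lit_one : F.lit w N l 1 = true := rfl

theorem lit_input {i : ℕ} (h : i < N) : F.lit w N l (2 + 2 * i) = w i := by
  simp [lit, literalValue_add_two, h]

theorem lit_not_input {i : ℕ} (h : i < N) : F.lit w N l (2 + 2 * i + 1) = !w i := by
  have h₁ : (2 * i + 1) / 2 = i := by omega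
  have h₂ : (2 * i + 1) % 2 = 1 := by omega
  simp [lit, Nat.add_assoc 2, literalValue_add_two, h₁, h₂, h]

theorem gate_lt {l' z : ℕ} (h : l' < l) (hz : z < F.Z N) :
    (2 * l' + 1) * F.width N + z < 2 * l * F.width N := by
  have h₁ := Nat.mul_le_mul_right (F.width N) (show 2 * l' + 1 + 1 ≤ 2 * l by omega)
  have h₂ : F.Z N ≤ F.width N := Nat.le_mul_of_pos_right _ (F.K_pos N)
  rw [Nat.add_mul (2 * l' + 1), Nat.one_mul] at h₁
  omega

theorem lit_gate {l' z : ℕ} (h : l' < l) (hz : z < F.Z N) :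
    F.lit w N l (F.gateCode N l' z) = F.val w N l' z :=
  literalValue_gate _ _ (gate_lt h hz)

theorem lit_not_gate {l' z : ℕ} (h : l' < l) (hz : z < F.Z N) :
    F.lit w N l (F.gateCode N l' z + 1) = !F.val w N l' z :=
  literalValue_not_gate _ _ (gate_lt h hz)

theorem value_conjunction {a : ℕ} (hl : l < F.H N) (ha : a < F.width N) :
    F.toTree.value w N (2 * l * F.width N + a) = true ↔
      ∀ c < F.K N, F.lit w N l (F.ref N l (a / F.K N) (a % F.K N) c) = true := by
  have hw := F.width_pos N
  have h₁ : (2 * l * F.width N + a) / F.width N = 2 * l := by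
    rw [Nat.add_comm, Nat.add_mul_div_right _ _ hw, Nat.div_eq_of_lt ha, Nat.zero_add]
  have h₂ : (2 * l * F.width N + a) % F.width N = a := by
    rw [Nat.add_comm, Nat.add_mul_mod_self_right, Nat.mod_eq_of_lt ha]
  have hR : 2 * l * F.width N + a < 2 * F.H N * F.width N := by
    have := Nat.mul_le_mul_right (F.width N) (show 2 * l + 1 ≤ 2 * F.H N by omega)
    rw [Nat.add_mul, Nat.one_mul] at this
    omega
  rw [TreeFamily.value_eq_true_iff w hR]
  simp only [toTree, h₁, h₂, Nat.mul_mod_right, if_true,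
    Nat.mul_div_cancel_left l two_pos]
  rfl

theorem value_disjunction {a : ℕ} (hl : l < F.H N) (ha : a < F.width N) :
    F.toTree.value w N ((2 * l + 1) * F.width N + a) = true ↔
      ∃ q < F.K N, ∀ c < F.K N, F.lit w N l (F.ref N l (a % F.Z N) q c) = true := by
  have hw := F.width_pos N
  have h₁ : ((2 * l + 1) * F.width N + a) / F.width N = 2 * l + 1 := by
    rw [Nat.add_comm, Nat.add_mul_div_right _ _ hw, Nat.div_eq_of_lt ha, Nat.zero_add]
  have h₂ : ((2 * l + 1) * F.width N + a) % F.width N = a := by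
    rw [Nat.add_comm, Nat.add_mul_mod_self_right, Nat.mod_eq_of_lt ha]
  have hR : (2 * l + 1) * F.width N + a < 2 * F.H N * F.width N := by
    have := Nat.mul_le_mul_right (F.width N) (show 2 * l + 1 + 1 ≤ 2 * F.H N by omega)
    rw [Nat.add_mul (2 * l + 1), Nat.one_mul] at this
    omega
  have h₃ : (2 * l + 1) % 2 = 1 := by omega
  rw [TreeFamily.value_eq_true_iff w hR]
  simp only [toTree, h₁, h₂, h₃, one_ne_zero, if_false, Nat.add_sub_cancel]
  refine exists_congr fun q => and_congr_right fun hq => ?_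
  have hz : a % F.Z N < F.Z N := Nat.mod_lt _ (F.Z_pos N)
  have hq' : a % F.Z N * F.K N + q < F.width N := by
    have := Nat.mul_le_mul_right (F.K N) (show a % F.Z N + 1 ≤ F.Z N from hz)
    rw [Nat.add_mul, Nat.one_mul] at this
    unfold width; omega
  have := value_conjunction (w := w) hl hq'
  rw [Nat.add_comm (a % F.Z N * F.K N), Nat.add_mul_div_right _ _ (F.K_pos N),
    Nat.div_eq_of_lt hq, Nat.zero_add, Nat.add_mul_mod_self_right, Nat.mod_eq_of_lt hq] at this
  rw [← this]
  have e : 2 + 2 * (N + 2 * l * F.width N + a % F.Z N * F.K N + q) =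
      2 + 2 * (N + (2 * l * F.width N + (q + a % F.Z N * F.K N))) := by ring
  have hlt : 2 * l * F.width N + (q + a % F.Z N * F.K N) < (2 * l + 1) * F.width N := by
    rw [Nat.add_mul, Nat.one_mul]; omega
  rw [e, literalValue_gate _ _ hlt]
  rfl

theorem val_eq_true_iff {z : ℕ} (hl : l < F.H N) (hz : z < F.Z N) :
    F.val w N l z = true ↔
      ∃ q < F.K N, ∀ c < F.K N, F.lit w N l (F.ref N l z q c) = true := by
  have := value_disjunction (w := w) hl
    (hz.trans_le (Nat.le_mul_of_pos_right _ (F.K_pos N)) : z < F.width N)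
  rwa [Nat.mod_eq_of_lt hz] at this

/-- The last gate is the output. -/
theorem output_eq_true_iff (hl : F.H N = l + 1) :
    F.toTree.value w N (F.toTree.H N * F.toTree.B N - 1) = true ↔
      ∃ q < F.K N, ∀ c < F.K N, F.lit w N l (F.ref N l (F.Z N - 1) q c) = true := by
  have hw := F.width_pos N
  have e : F.toTree.H N * F.toTree.B N - 1 = (2 * l + 1) * F.width N + (F.width N - 1) := by
    simp only [toTree, hl]
    rw [show 2 * (l + 1) = 2 * l + 1 + 1 by ring, Nat.add_mul (2 * l + 1), Nat.one_mul]
    omega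
  have hm : (F.width N - 1) % F.Z N = F.Z N - 1 := by
    have hz := F.Z_pos N
    obtain ⟨k, hk⟩ := Nat.exists_eq_add_of_lt (F.K_pos N)
    have : F.width N - 1 = F.Z N - 1 + F.Z N * k := by
      rw [width, hk, Nat.zero_add, Nat.mul_add, Nat.mul_one]; omega
    rw [this, Nat.add_mul_mod_self_left, Nat.mod_eq_of_lt (by omega)]
  rw [e, value_disjunction (by omega) (by omega), hm]

variable (F) in
/-- The data of the family are computable by loop programs. -/
structure Uniform : Prop where
  K : Loop₁ F.K
  Z : Loop₁ F.Z
  H : Loop₁ F.H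
  ref : ∀ ⦃v : ℕ⦄ ⦃a b c d e : (Fin v → ℕ) → ℕ⦄, LoopComputable a → LoopComputable b →
    LoopComputable c → LoopComputable d → LoopComputable e →
    LoopComputable fun x => F.ref (a x) (b x) (c x) (d x) (e x)

theorem Uniform.width (hF : F.Uniform) : Loop₁ F.width := fun _ _ ha => .mul (hF.Z ha) (hF.K ha)

theorem Uniform.toTree (hF : F.Uniform) : F.toTree.Uniform where
  K := hF.K
  B := hF.width
  H _ _ ha := .mul (.const 2) (hF.H ha)
  op _ _ _ ha hb := .mod (.div hb (hF.width ha)) (.const 2)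
  ch _ _ _ _ ha hb hc :=
    have q := LoopComputable.div hb (hF.width ha)
    have r := LoopComputable.mod hb (hF.width ha)
    .ifeq (.mod q (.const 2)) (.const 0)
      (hF.ref ha (.div q (.const 2)) (.div r (hF.K ha)) (.mod r (hF.K ha)) hc)
      (.add (.const 2) (.mul (.const 2) (.add (.add (.add ha (.mul (.sub q (.const 1))
        (hF.width ha))) (.mul (.mod r (hF.Z ha)) (hF.K ha))) hc)))

end LayerFamily

end StackCode

/-! ### The propagation of zeros -/

theorem symConj_globalMap_eq_false {n : ℕ} (G : UGraph n) (x : Fin n → Bool) (v : Fin n) :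
    (symConj G).globalMap x v = false ↔ ∃ u, G.adj v u = true ∧ x u = false := by
  classical
  simp [CSAN.globalMap, symConj]

theorem symConjPeriodic_iterate_snd {p n : ℕ} (G : UGraph n) (x : Fin n → PerState Bool p) (t : ℕ)
    (v : Fin n) : (((symConjPeriodic p G)^[t] x) v).2 =
      (⟨((x v).2.1.val + t) % p, Nat.mod_lt _ (x v).2.1.pos⟩, (x v).2.2) := by
  induction t with
  | zero =>
    ext1
    · ext1
      simp [Nat.mod_eq_of_lt (x v).2.1.isLt]
    · rfl
  | succ t ih =>
    rw [Function.iterate_succ_apply']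
    change ((⟨(((symConjPeriodic p G)^[t] x) v).2.1.val.succ % p, _⟩ : Fin p),
      (((symConjPeriodic p G)^[t] x) v).2.2) = _
    simp only [ih]
    ext1
    · ext1
      simp [Nat.succ_eq_add_one, Nat.add_assoc]
    · rfl

/-- A zero at time `t + 1` comes from a zero at time `t`. -/
theorem symConjPeriodic_iterate_succ_fst {p n : ℕ} (G : UGraph n) (x : Fin n → PerState Bool p)
    (t : ℕ) (v : Fin n) : (((symConjPeriodic p G)^[t + 1] x) v).1 = false ↔
      ∃ u, (((symConjPeriodic p G)^[t] x) u).1 = false ∧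
        if (⟨((x v).2.1.val + t) % p, Nat.mod_lt _ (x v).2.1.pos⟩ : Fin p) ∈ (x v).2.2 then
          G.adj v u = true else u = v := by
  rw [Function.iterate_succ_apply']
  have h := symConjPeriodic_iterate_snd G x t v
  set y := (symConjPeriodic p G)^[t] x
  change (if (y v).2.1 ∈ (y v).2.2 then (symConj G).globalMap (fun u => (y u).1) v
    else (y v).1) = false ↔ _
  rw [h]
  dsimp only
  split_ifs
  · rw [symConj_globalMap_eq_false]
    simp [and_comm]
  · simp

namespace PredInstance

variable {p : ℕ} (I : PredInstance p)

theorem period_pos {p : ℕ} (I : PredInstance p) : 0 < p := (I.init I.node).2.1.pos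

/-- The number `u * p + φ` stands for the node `u` at a time that is congruent to `φ`; the node
`I.n` is an additional one, whose state is always zero. The node has state zero at the time `t`. -/
def IsZero (t a : ℕ) : Prop :=
  a % p = t % p ∧ (a / p = I.n ∨ ∃ h : a / p < I.n,
    (((symConjPeriodic p I.graph)^[t] I.init) ⟨a / p, h⟩).1 = false)

/-- A zero of `a` leads to a zero of `b` one step later. -/
def Step (a b : ℕ) : Prop :=
  a / p ≤ I.n ∧ b % p = (a % p + 1) % p ∧ ((b / p = I.n ∧ a / p = I.n) ∨ ∃ h : b / p < I.n,
    if (⟨((I.init ⟨b / p, h⟩).2.1.val + a % p) % p, Nat.mod_lt _ I.period_pos⟩ : Fin p) ∈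
      (I.init ⟨b / p, h⟩).2.2 then ∃ h' : a / p < I.n, I.graph.adj ⟨b / p, h⟩ ⟨a / p, h'⟩ = true
    else a / p = b / p)

/-- The phase is part of the number, so the predecessor of a zero at time `t + 1` is forced to be of
the form `u * p + t % p`, with the node `u` that `symConjPeriodic_iterate_succ_fst` provides. -/
theorem isZero_succ (t b : ℕ) : I.IsZero (t + 1) b ↔ ∃ d, I.IsZero t d ∧ I.Step d b := by
  have hp := I.period_pos
  constructor
  · rintro ⟨h₁, h₂⟩
    have hd : ∀ u, (u * p + t % p) / p = u := fun u => by
      rw [Nat.add_comm, Nat.add_mul_div_right _ _ hp, Nat.div_eq_of_lt (Nat.mod_lt _ hp),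
        Nat.zero_add]
    have hm : ∀ u, (u * p + t % p) % p = t % p := fun u => by
      rw [Nat.add_comm, Nat.add_mul_mod_self_right, Nat.mod_mod]
    have hb : b % p = (t % p + 1) % p := by rw [h₁, Nat.mod_add_mod]
    rcases h₂ with h₂ | ⟨hn, h₂⟩
    · refine ⟨I.n * p + t % p, ⟨hm _, .inl (hd _)⟩, ?_, ?_, .inl ⟨h₂, hd _⟩⟩
      · rw [hd]
      · rw [hm, hb]
    · rw [symConjPeriodic_iterate_succ_fst] at h₂
      obtain ⟨u, hu, hs⟩ := h₂
      refine ⟨u * p + t % p, ⟨hm _, .inr ⟨by rw [hd]; exact u.2, ?_⟩⟩, ?_, ?_, .inr ⟨hn, ?_⟩⟩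
      · simpa only [hd] using hu
      · rw [hd]; exact u.2.le
      · rw [hm, hb]
      · simp only [hm, hd, Nat.add_mod_mod]
        split_ifs at hs ⊢ with hc
        · exact ⟨u.2, hs⟩
        · rw [hs]
  · rintro ⟨d, ⟨h₁, h₂⟩, h₃, h₄, h₅⟩
    refine ⟨by rw [h₄, h₁, Nat.mod_add_mod], ?_⟩
    rcases h₅ with ⟨h₅, -⟩ | ⟨hn, h₅⟩
    · exact .inl h₅
    · refine .inr ⟨hn, ?_⟩
      rw [symConjPeriodic_iterate_succ_fst]
      simp only [h₁, Nat.add_mod_mod] at h₅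
      split_ifs at h₅ with hc
      · obtain ⟨h', hadj⟩ := h₅
        rcases h₂ with h₂ | ⟨_, h₂⟩
        · omega
        · exact ⟨_, h₂, by rwa [if_pos hc]⟩
      · rcases h₂ with h₂ | ⟨_, h₂⟩
        · omega
        · refine ⟨_, h₂, ?_⟩
          rw [if_neg hc]
          exact Fin.ext h₅

/-- The additional node reveals the phase: the divisibility of the time by `p` is read off from the
powers of the same relation, without dividing a number given in binary. -/
theorem isZero_dummy (t : ℕ) : I.IsZero t (I.n * p) ↔ t % p = 0 := by
  have hp := I.period_pos
  rw [IsZero, Nat.mul_div_cancel _ hp, Nat.mul_mod_left]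
  exact ⟨fun h => h.1.symm, fun h => ⟨h.symm, .inl rfl⟩⟩

theorem isZero_node (t : ℕ) (h : t % p = 0) : I.IsZero t (I.node * p) ↔
    (((symConjPeriodic p I.graph)^[t] I.init) I.node).1 = false := by
  have hp := I.period_pos
  simp [IsZero, Nat.mul_div_cancel _ hp, h, I.node.2.ne]

/-- The clock of a node has its initial value exactly at the multiples of `p`, and the update set
never changes. At the other times the state has changed in any case; at the multiples of `p` only
the Boolean component has to be compared. -/
theorem changes_iff : I.Changes ↔ ¬ I.IsZero I.time (I.n * p) ∨
    (I.IsZero I.time (I.node * p) ∧ (I.init I.node).1 = true) ∨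
    (¬ I.IsZero I.time (I.node * p) ∧ (I.init I.node).1 = false) := by
  have hp := I.period_pos
  have h := symConjPeriodic_iterate_snd I.graph I.init I.time I.node
  unfold Changes
  by_cases ht : I.time % p = 0
  · rw [I.isZero_node _ ht, I.isZero_dummy]
    set y := ((symConjPeriodic p I.graph)^[I.time] I.init) I.node
    have hy : y.2 = (I.init I.node).2 := by
      rw [h]
      ext1
      · ext1
        simp only
        rw [← Nat.add_mod_mod, ht, Nat.add_zero, Nat.mod_eq_of_lt (I.init I.node).2.1.isLt]
      · rfl
    have : y ≠ I.init I.node ↔ y.1 ≠ (I.init I.node).1 := by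
      rw [Ne, Prod.ext_iff, not_and]
      simp [hy]
    rw [this]
    simp only [ht, not_true_eq_false, false_or]
    cases y.1 <;> cases (I.init I.node).1 <;> simp
  · rw [I.isZero_dummy]
    refine iff_of_true (fun heq => ht ?_) (.inl ht)
    have h' := congrArg (fun q : PerState Bool p => q.2.1.val) heq
    simp only [h] at h'
    have hc := (I.init I.node).2.1.isLt
    have : ((I.init I.node).2.1.val + I.time) % p = ((I.init I.node).2.1.val + 0) % p := by
      rw [h', Nat.add_zero, Nat.mod_eq_of_lt hc]
    have := (Nat.ModEq.add_left_cancel' _ this : I.time ≡ 0 [MOD p])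
    simpa [Nat.ModEq] using this

/-- A zero of `a` leads to a zero of `b` after `t` steps; the number `(I.n + 1) * p` stands for all
zeros of the initial configuration. -/
def Reach : ℕ → ℕ → ℕ → Prop
  | 0, a, b => (a = b ∧ a < (I.n + 1) * p) ∨ (a = (I.n + 1) * p ∧ I.IsZero 0 b)
  | t + 1, a, b => ∃ d, Reach t a d ∧ I.Step d b

/-- With the additional starting vertex, the question about all initial zeros together becomes one
entry of the matrix. -/
theorem reach_start (t b : ℕ) : I.Reach t ((I.n + 1) * p) b ↔ I.IsZero t b := by
  induction t generalizing b with
  | zero => simp [Reach]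
  | succ t ih => simp [Reach, ih, I.isZero_succ]

theorem lt_of_div_le {a : ℕ} (h : a / p ≤ I.n) : a < (I.n + 1) * p :=
  (Nat.div_lt_iff_lt_mul I.period_pos).1 (Nat.lt_succ_of_le h)

theorem IsZero.lt {t a : ℕ} (h : I.IsZero t a) : a < (I.n + 1) * p :=
  I.lt_of_div_le (by rcases h.2 with h | ⟨h, -⟩ <;> omega)

theorem Step.lt_right {a b : ℕ} (h : I.Step a b) : b < (I.n + 1) * p :=
  I.lt_of_div_le (by rcases h.2.2 with h | ⟨h, -⟩ <;> omega)

theorem Reach.lt_right {t a b : ℕ} (h : I.Reach t a b) : b < (I.n + 1) * p := by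
  rcases t with _ | t
  · rcases h with ⟨rfl, h⟩ | ⟨-, h⟩
    · exact h
    · exact h.lt
  · obtain ⟨d, -, h⟩ := h
    exact h.lt_right

theorem reach_zero_iff {c b : ℕ} (hc : c < (I.n + 1) * p) : I.Reach 0 c b ↔ c = b := by
  simp [Reach, hc, hc.ne]

/-- The intermediate point `c` is reached and hence is below `(I.n + 1) * p`, so the convention for
the starting vertex does not affect the second factor. -/
theorem reach_add (s t a b : ℕ) : I.Reach (s + t) a b ↔ ∃ c, I.Reach s a c ∧ I.Reach t c b := by
  induction t generalizing b with
  | zero =>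
    refine ⟨fun h => ⟨b, h, (I.reach_zero_iff h.lt_right).2 rfl⟩, fun ⟨c, h, h'⟩ => ?_⟩
    rw [I.reach_zero_iff h.lt_right] at h'
    exact h' ▸ h
  | succ t ih =>
    constructor
    · rintro ⟨d, h, h'⟩
      obtain ⟨c, h₁, h₂⟩ := (ih d).1 h
      exact ⟨c, h₁, d, h₂, h'⟩
    · rintro ⟨c, h₁, d, h₂, h₃⟩
      exact ⟨d, (ih d).2 ⟨c, h₁, h₂⟩, h₃⟩

/-- One digit of the binary expansion of the time. -/
theorem reach_bit (s : ℕ) (f : Bool) (a b : ℕ) : I.Reach (2 * s + f.toNat) a b ↔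
    ∃ c d, I.Reach s a c ∧ I.Reach s c d ∧ if f then I.Step d b else d = b := by
  cases f
  · simp [two_mul, reach_add]
  · simp only [Bool.toNat_true, if_true]
    constructor
    · rintro ⟨d, h, h'⟩
      rw [two_mul, reach_add] at h
      obtain ⟨c, h₁, h₂⟩ := h
      exact ⟨c, d, h₁, h₂, h'⟩
    · rintro ⟨c, d, h₁, h₂, h'⟩
      refine ⟨d, ?_, h'⟩
      rw [two_mul, reach_add]
      exact ⟨c, h₁, h₂⟩

end PredInstance

/-! ### The circuits for the prediction problems -/

namespace Prediction

open StackCode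

/-- The base of the numbering of the gates. -/
def base (p N : ℕ) : ℕ := (N + 4) * (p + 1)

/-- The members of a disjunction are indexed by three digits, in the reachability layers by a time
digit and two intermediate vertices. A gate has five digits: its kind, the candidates for the number
of nodes and for the node, and two vertices. The candidates are needed because the length of the
word does not determine them. -/
def fanIn (p N : ℕ) : ℕ := base p N * base p N * base p N

def gates (p N : ℕ) : ℕ := fanIn p N * base p N * base p N

def pack (p N κ n v a b : ℕ) : ℕ :=
  (((κ * base p N + n) * base p N + v) * base p N + a) * base p N + b

def digit₀ (p N z : ℕ) : ℕ := z % base p N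

def digit₁ (p N z : ℕ) : ℕ := z / base p N % base p N

def digit₂ (p N z : ℕ) : ℕ := z / base p N / base p N % base p N

def digit₃ (p N z : ℕ) : ℕ := z / base p N / base p N / base p N % base p N

def digit₄ (p N z : ℕ) : ℕ := z / base p N / base p N / base p N / base p N

/-- The place of an entry of the adjacency matrix in the input word. -/
def adjPos (n u v : ℕ) : ℕ := n + 1 + (u * n + v)

/-- The place of the state of a node in the input word. -/
def statePos (p n u : ℕ) : ℕ := n + 1 + n * n + u * (1 + 2 * p)

/-- The place of an entry of the one-hot vector of the node in the input word. -/
def nodePos (p n u : ℕ) : ℕ := n + 1 + n * n + n * (1 + 2 * p) + u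

/-- The place where the time starts in the input word. -/
def timePos (p n : ℕ) : ℕ := nodePos p n n

def inputLit (i : ℕ) : ℕ := 2 + 2 * i

def gateLit (p N l z : ℕ) : ℕ := 2 + 2 * (N + ((2 * l + 1) * (gates p N * fanIn p N) + z))

/-- Negation of a literal: the codes `2 + 2 y` and `3 + 2 y` are exchanged, and so are the constants
`0` and `1`. -/
def flipLit (c : ℕ) : ℕ := if c % 2 = 0 then c + 1 else c - 1

/-- The number of binary digits of the time. -/
def digits (unary : Bool) (N : ℕ) : ℕ := if unary then Nat.log 2 N + 1 else N

/-- The digit `j` of the time, as a literal. -/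
def timeLit (p : ℕ) (unary : Bool) (N n j : ℕ) : ℕ :=
  -- In unary the time is determined by `N` and `n`, so that its digits are constants of the
  -- circuit. The cut at `N + 1` keeps the computation polynomially bounded and has no effect on the
  -- digits that are used.
  if unary then (N - timePos p n) / min (2 ^ j) (N + 1) % 2
  else if timePos p n + j < N then inputLit (timePos p n + j) else 0

/-- The literals for `PredInstance.Step`. -/
def stepLit (p n a b q e : ℕ) : ℕ :=
  if n < a / p then 0 else if b % p = (a % p + 1) % p then
    if b / p = n then if a / p = n then 1 else 0
    else if n < b / p then 0
    -- A conjunction guesses the clock of the target node and whether the node is updated: `q < p`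
    -- is the clock `q` with an update, and `p ≤ q < 2 * p` is the clock `q - p` without one.
    else if q < p then
      if e = 0 then inputLit (statePos p n (b / p) + 1 + q)
      else if e = 1 then inputLit (statePos p n (b / p) + 1 + p + (q + a % p) % p)
      else if e = 2 then if a / p < n then inputLit (adjPos n (b / p) (a / p)) else 0
      else 1
    else if q < 2 * p then
      if e = 0 then inputLit (statePos p n (b / p) + 1 + (q - p))
      else if e = 1 then inputLit (statePos p n (b / p) + 1 + p + (q - p + a % p) % p) + 1
      else if e = 2 then if a / p = b / p then 1 else 0
      else 1
    else 0
  else 0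

/-- The literals for the check of the unary parts of the word and of the last digit of the time. -/
def formatLit (p : ℕ) (unary : Bool) (N n v e : ℕ) : ℕ :=
  if v < n then if N < timePos p n then 0
    else if e < n then inputLit e
    else if e = n then inputLit e + 1
    else if e < nodePos p n 0 then 1
    else if e < timePos p n then if e = nodePos p n v then inputLit e else inputLit e + 1
    else if e < N then if unary then inputLit e else if e + 1 = N then inputLit e else 1
    else 1
  else 0

/-- The literals for the check of the clock of the node `u`. -/
def clockLit (p n u q e : ℕ) : ℕ :=
  if u < n then if q < p then if e < p then
    if e = q then inputLit (statePos p n u + 1 + e) else inputLit (statePos p n u + 1 + e) + 1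
  else 1 else 0 else 1

/-- The literals for the check of the symmetry of the adjacency matrix. -/
def symmLit (n u v q e : ℕ) : ℕ :=
  if u < n then if v < n then
    if q = 0 then if e = 0 then inputLit (adjPos n u v) else if e = 1 then inputLit (adjPos n v u)
      else 1
    else if q = 1 then if e = 0 then inputLit (adjPos n u v) + 1
      else if e = 1 then inputLit (adjPos n v u) + 1 else 1
    else 0
  else 1 else 1

def layer₀ (p : ℕ) (unary : Bool) (N z q e : ℕ) : ℕ :=
  if digit₄ p N z = 0 then stepLit p (digit₃ p N z) (digit₁ p N z) (digit₀ p N z) q e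
  else if digit₄ p N z = 1 then formatLit p unary N (digit₃ p N z) (digit₂ p N z) e
  else if digit₄ p N z = 2 then clockLit p (digit₃ p N z) (digit₁ p N z) q e
  else symmLit (digit₃ p N z) (digit₁ p N z) (digit₀ p N z) q e

/-- The word is not well-formed. -/
def layer₁ (p N z q : ℕ) : ℕ :=
  if q / base p N / base p N < 3 then
    gateLit p N 0 (pack p N (q / base p N / base p N + 1) (digit₃ p N z) (digit₂ p N z)
      (digit₁ p N q) (digit₀ p N q)) + 1
  else 0

/-- The relation `PredInstance.Reach 0`. -/
def layer₂ (p N z : ℕ) : ℕ :=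
  if digit₁ p N z = digit₀ p N z then
    if digit₁ p N z < (digit₃ p N z + 1) * p then 1 else 0
  else if digit₁ p N z = (digit₃ p N z + 1) * p then
    if digit₀ p N z % p = 0 then
      if digit₀ p N z / p = digit₃ p N z then 1
      else if digit₀ p N z / p < digit₃ p N z then
        inputLit (statePos p (digit₃ p N z) (digit₀ p N z / p)) + 1
      else 0
    else 0
  else 0

/-- The relations `PredInstance.Reach t`, where `t` is given by the leading digits of the time. -/
def layerReach (p : ℕ) (unary : Bool) (N l z q e : ℕ) : ℕ :=
  if e = 0 then gateLit p N (l - 1) (pack p N 0 (digit₃ p N z) 0 (digit₁ p N z) (digit₁ p N q))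
  else if e = 1 then
    gateLit p N (l - 1) (pack p N 0 (digit₃ p N z) 0 (digit₁ p N q) (digit₀ p N q))
  else if e = 2 then
    if q / base p N / base p N = 0 then
      -- The layers from `3` on take the digits from the leading one downwards, so layer `l` is in
      -- charge of the digit `digits unary N + 2 - l`.
      flipLit (timeLit p unary N (digit₃ p N z) (digits unary N + 2 - l))
    else if q / base p N / base p N = 1 then
      timeLit p unary N (digit₃ p N z) (digits unary N + 2 - l)
    else 0
  else if e = 3 then
    if q / base p N / base p N = 1 then
      gateLit p N 0 (pack p N 0 (digit₃ p N z) 0 (digit₀ p N q) (digit₀ p N z))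
    else if digit₀ p N q = digit₀ p N z then 1 else 0
  else 1

/-- The disjunction runs over all candidates for the number of nodes and the node, and over the
three alternatives of `PredInstance.changes_iff`. The format check enters negated because the gates
of layer `1` recognise the words that are not well-formed. -/
def layerOut (p : ℕ) (unary : Bool) (N q e : ℕ) : ℕ :=
  if e = 0 then gateLit p N 1 (pack p N 0 (digit₂ p N q) (digit₁ p N q) 0 0) + 1
  else if e = 1 then
    if digit₀ p N q = 0 then gateLit p N (digits unary N + 2)
      (pack p N 0 (digit₂ p N q) 0 ((digit₂ p N q + 1) * p) (digit₂ p N q * p)) + 1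
    else if digit₀ p N q = 1 then gateLit p N (digits unary N + 2)
      (pack p N 0 (digit₂ p N q) 0 ((digit₂ p N q + 1) * p) (digit₁ p N q * p))
    else if digit₀ p N q = 2 then gateLit p N (digits unary N + 2)
      (pack p N 0 (digit₂ p N q) 0 ((digit₂ p N q + 1) * p) (digit₁ p N q * p)) + 1
    else 0
  else if e = 2 then
    if digit₀ p N q = 1 then inputLit (statePos p (digit₂ p N q) (digit₁ p N q))
    else if digit₀ p N q = 2 then inputLit (statePos p (digit₂ p N q) (digit₁ p N q)) + 1
    else 1
  else 1

theorem base_pos (p N : ℕ) : 0 < base p N := Nat.mul_pos (by omega) (by omega)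

/-- The circuits for the prediction problem. -/
def family (p : ℕ) (unary : Bool) : LayerFamily where
  K := fanIn p
  Z := gates p
  -- The layers are: local checks and steps, the collection of the checks, the power zero, one
  -- squaring for each digit, and the output.
  H N := digits unary N + 4
  ref N l z q e :=
    if l = 0 then layer₀ p unary N z q e
    else if l = 1 then layer₁ p N z q
    else if l = 2 then layer₂ p N z
    else if l < digits unary N + 3 then layerReach p unary N l z q e
    else layerOut p unary N q e
  K_pos N := Nat.mul_pos (Nat.mul_pos (base_pos p N) (base_pos p N)) (base_pos p N)
  Z_pos N := Nat.mul_pos (Nat.mul_pos (Nat.mul_pos (Nat.mul_pos (base_pos p N) (base_pos p N))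
    (base_pos p N)) (base_pos p N)) (base_pos p N)
  H_pos N := by omega

/-! ### Loop computability of the description of the circuits. -/

section Uniform

variable {v : ℕ} {N n u w a b c q e : (Fin v → ℕ) → ℕ} {p : ℕ} {unary : Bool}

theorem loop_base (hN : LoopComputable N) : LoopComputable fun x => base p (N x) :=
  .mul (.add hN (.const 4)) (.const (p + 1))

theorem loop_fanIn (hN : LoopComputable N) : LoopComputable fun x => fanIn p (N x) :=
  .mul (.mul (loop_base hN) (loop_base hN)) (loop_base hN)

theorem loop_gates (hN : LoopComputable N) : LoopComputable fun x => gates p (N x) :=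
  .mul (.mul (loop_fanIn hN) (loop_base hN)) (loop_base hN)

theorem loop_pack (hN : LoopComputable N) (hc : LoopComputable c) (hn : LoopComputable n)
    (hu : LoopComputable u) (ha : LoopComputable a) (hb : LoopComputable b) :
    LoopComputable fun x => pack p (N x) (c x) (n x) (u x) (a x) (b x) :=
  have h := loop_base (p := p) hN
  .add (.mul (.add (.mul (.add (.mul (.add (.mul hc h) hn) h) hu) h) ha) h) hb

theorem loop_digit₀ (hN : LoopComputable N) (ha : LoopComputable a) :
    LoopComputable fun x => digit₀ p (N x) (a x) :=
  .mod ha (loop_base hN)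

theorem loop_digit₁ (hN : LoopComputable N) (ha : LoopComputable a) :
    LoopComputable fun x => digit₁ p (N x) (a x) :=
  have h := loop_base (p := p) hN
  .mod (.div ha h) h

theorem loop_digit₂ (hN : LoopComputable N) (ha : LoopComputable a) :
    LoopComputable fun x => digit₂ p (N x) (a x) :=
  have h := loop_base (p := p) hN
  .mod (.div (.div ha h) h) h

theorem loop_digit₃ (hN : LoopComputable N) (ha : LoopComputable a) :
    LoopComputable fun x => digit₃ p (N x) (a x) :=
  have h := loop_base (p := p) hN
  .mod (.div (.div (.div ha h) h) h) h

theorem loop_digit₄ (hN : LoopComputable N) (ha : LoopComputable a) :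
    LoopComputable fun x => digit₄ p (N x) (a x) :=
  have h := loop_base (p := p) hN
  .div (.div (.div (.div ha h) h) h) h

theorem loop_adjPos (hn : LoopComputable n) (ha : LoopComputable a) (hb : LoopComputable b) :
    LoopComputable fun x => adjPos (n x) (a x) (b x) :=
  .add (.add hn (.const 1)) (.add (.mul ha hn) hb)

theorem loop_statePos (hn : LoopComputable n) (ha : LoopComputable a) :
    LoopComputable fun x => statePos p (n x) (a x) :=
  .add (.add (.add hn (.const 1)) (.mul hn hn)) (.mul ha (.const (1 + 2 * p)))

theorem loop_nodePos (hn : LoopComputable n) (ha : LoopComputable a) :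
    LoopComputable fun x => nodePos p (n x) (a x) :=
  .add (.add (.add (.add hn (.const 1)) (.mul hn hn)) (.mul hn (.const (1 + 2 * p)))) ha

theorem loop_timePos (hn : LoopComputable n) : LoopComputable fun x => timePos p (n x) :=
  loop_nodePos hn hn

theorem loop_inputLit (ha : LoopComputable a) : LoopComputable fun x => inputLit (a x) :=
  .add (.const 2) (.mul (.const 2) ha)

theorem loop_gateLit (hN : LoopComputable N) (ha : LoopComputable a) (hb : LoopComputable b) :
    LoopComputable fun x => gateLit p (N x) (a x) (b x) :=
  .add (.const 2) (.mul (.const 2) (.add hN (.add (.mul (.add (.mul (.const 2) ha) (.const 1))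
    (.mul (loop_gates hN) (loop_fanIn hN))) hb)))

theorem loop_flipLit (ha : LoopComputable a) : LoopComputable fun x => flipLit (a x) :=
  .ifeq (.mod ha (.const 2)) (.const 0) (.add ha (.const 1)) (.sub ha (.const 1))

theorem loop_digits (hN : LoopComputable N) : LoopComputable fun x => digits unary (N x) := by
  cases unary
  · exact hN
  · exact .add (.log hN) (.const 1)

theorem loop_timeLit (hN : LoopComputable N) (hn : LoopComputable n) (ha : LoopComputable a) :
    LoopComputable fun x => timeLit p unary (N x) (n x) (a x) := by
  cases unary
  · exact .iflt (.add (loop_timePos hn) ha) hN (loop_inputLit (.add (loop_timePos hn) ha))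
      (.const 0)
  · exact .mod (.div (.sub hN (loop_timePos hn)) (.powMin ha (.add hN (.const 1)))) (.const 2)

theorem loop_stepLit (hn : LoopComputable n) (ha : LoopComputable a) (hb : LoopComputable b)
    (hq : LoopComputable q) (he : LoopComputable e) :
    LoopComputable fun x => stepLit p (n x) (a x) (b x) (q x) (e x) := by
  unfold stepLit
  repeat' first | assumption | exact .const _ | apply LoopComputable.iflt |
    apply LoopComputable.ifeq | apply loop_inputLit | apply loop_statePos | apply loop_adjPos |
    apply LoopComputable.add | apply LoopComputable.mul | apply LoopComputable.sub |
    apply LoopComputable.mod | apply LoopComputable.div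

theorem loop_formatLit (hN : LoopComputable N) (hn : LoopComputable n) (hu : LoopComputable u)
    (he : LoopComputable e) :
    LoopComputable fun x => formatLit p unary (N x) (n x) (u x) (e x) := by
  unfold formatLit
  cases unary <;> simp only [if_true, Bool.false_eq_true, if_false]
  all_goals
    repeat' first | assumption | exact .const _ | apply LoopComputable.iflt |
      apply LoopComputable.ifeq | apply loop_inputLit | apply loop_timePos | apply loop_nodePos |
      apply LoopComputable.add

theorem loop_clockLit (hn : LoopComputable n) (hu : LoopComputable u)
    (hq : LoopComputable q) (he : LoopComputable e) :
    LoopComputable fun x => clockLit p (n x) (u x) (q x) (e x) := by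
  unfold clockLit
  repeat' first | assumption | exact .const _ | apply LoopComputable.iflt |
    apply LoopComputable.ifeq | apply loop_inputLit | apply loop_statePos |
    apply LoopComputable.add

theorem loop_symmLit (hn : LoopComputable n) (hu : LoopComputable u) (hw : LoopComputable w)
    (hq : LoopComputable q) (he : LoopComputable e) :
    LoopComputable fun x => symmLit (n x) (u x) (w x) (q x) (e x) := by
  unfold symmLit
  repeat' first | assumption | exact .const _ | apply LoopComputable.iflt |
    apply LoopComputable.ifeq | apply loop_inputLit | apply loop_adjPos |
    apply LoopComputable.add

theorem loop_layer₀ (hN : LoopComputable N) (ha : LoopComputable a) (hq : LoopComputable q)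
    (he : LoopComputable e) :
    LoopComputable fun x => layer₀ p unary (N x) (a x) (q x) (e x) :=
  have z₀ := loop_digit₀ (p := p) hN ha
  have z₁ := loop_digit₁ (p := p) hN ha
  have z₂ := loop_digit₂ (p := p) hN ha
  have z₃ := loop_digit₃ (p := p) hN ha
  have z₄ := loop_digit₄ (p := p) hN ha
  .ifeq z₄ (.const 0) (loop_stepLit z₃ z₁ z₀ hq he) <|
    .ifeq z₄ (.const 1) (loop_formatLit hN z₃ z₂ he) <|
    .ifeq z₄ (.const 2) (loop_clockLit z₃ z₁ hq he) <| loop_symmLit z₃ z₁ z₀ hq he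

theorem loop_layer₁ (hN : LoopComputable N) (ha : LoopComputable a) (hq : LoopComputable q) :
    LoopComputable fun x => layer₁ p (N x) (a x) (q x) :=
  have h := loop_base (p := p) hN
  have h' := LoopComputable.div (.div hq h) h
  .iflt h' (.const 3) (.add (loop_gateLit hN (.const 0) (loop_pack hN (.add h' (.const 1))
    (loop_digit₃ hN ha) (loop_digit₂ hN ha) (loop_digit₁ hN hq) (loop_digit₀ hN hq))) (.const 1))
    (.const 0)

theorem loop_layer₂ (hN : LoopComputable N) (ha : LoopComputable a) :
    LoopComputable fun x => layer₂ p (N x) (a x) :=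
  have z₀ := loop_digit₀ (p := p) hN ha
  have z₁ := loop_digit₁ (p := p) hN ha
  have z₃ := loop_digit₃ (p := p) hN ha
  have hs := LoopComputable.mul (.add z₃ (.const 1)) (.const p)
  have hd := LoopComputable.div z₀ (.const p)
  .ifeq z₁ z₀ (.iflt z₁ hs (.const 1) (.const 0)) <| .ifeq z₁ hs
    (.ifeq (.mod z₀ (.const p)) (.const 0) (.ifeq hd z₃ (.const 1)
      (.iflt hd z₃ (.add (loop_inputLit (loop_statePos z₃ hd)) (.const 1)) (.const 0)))
      (.const 0)) (.const 0)

theorem loop_layerReach (hN : LoopComputable N) (hc : LoopComputable c) (ha : LoopComputable a)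
    (hq : LoopComputable q) (he : LoopComputable e) :
    LoopComputable fun x => layerReach p unary (N x) (c x) (a x) (q x) (e x) :=
  have z₀ := loop_digit₀ (p := p) hN ha
  have z₁ := loop_digit₁ (p := p) hN ha
  have z₃ := loop_digit₃ (p := p) hN ha
  have q₀ := loop_digit₀ (p := p) hN hq
  have q₁ := loop_digit₁ (p := p) hN hq
  have h := loop_base (p := p) hN
  have q₂ := LoopComputable.div (.div hq h) h
  have hl := LoopComputable.sub hc (.const 1)
  have ht := loop_timeLit (p := p) (unary := unary) hN z₃
    (.sub (.add (loop_digits (unary := unary) hN) (.const 2)) hc)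
  .ifeq he (.const 0) (loop_gateLit hN hl (loop_pack hN (.const 0) z₃ (.const 0) z₁ q₁)) <|
    .ifeq he (.const 1) (loop_gateLit hN hl (loop_pack hN (.const 0) z₃ (.const 0) q₁ q₀)) <|
    .ifeq he (.const 2)
      (.ifeq q₂ (.const 0) (loop_flipLit ht) (.ifeq q₂ (.const 1) ht (.const 0))) <|
    .ifeq he (.const 3) (.ifeq q₂ (.const 1)
      (loop_gateLit hN (.const 0) (loop_pack hN (.const 0) z₃ (.const 0) q₀ z₀))
      (.ifeq q₀ z₀ (.const 1) (.const 0))) (.const 1)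

theorem loop_layerOut (hN : LoopComputable N) (hq : LoopComputable q) (he : LoopComputable e) :
    LoopComputable fun x => layerOut p unary (N x) (q x) (e x) :=
  have q₀ := loop_digit₀ (p := p) hN hq
  have q₁ := loop_digit₁ (p := p) hN hq
  have q₂ := loop_digit₂ (p := p) hN hq
  have hs := LoopComputable.mul (.add q₂ (.const 1)) (.const p)
  have hd := LoopComputable.add (loop_digits (unary := unary) hN) (.const 2)
  have hv := loop_gateLit (p := p) hN hd
    (loop_pack hN (.const 0) q₂ (.const 0) hs (.mul q₁ (.const p)))
  have hl := loop_inputLit (loop_statePos (p := p) q₂ q₁)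
  .ifeq he (.const 0)
    (.add (loop_gateLit hN (.const 1) (loop_pack hN (.const 0) q₂ q₁ (.const 0) (.const 0)))
      (.const 1)) <|
    .ifeq he (.const 1)
      (.ifeq q₀ (.const 0) (.add (loop_gateLit hN hd (loop_pack hN (.const 0) q₂ (.const 0) hs
        (.mul q₂ (.const p)))) (.const 1)) <| .ifeq q₀ (.const 1) hv <|
        .ifeq q₀ (.const 2) (.add hv (.const 1)) (.const 0)) <|
    .ifeq he (.const 2) (.ifeq q₀ (.const 1) hl <| .ifeq q₀ (.const 2) (.add hl (.const 1))
      (.const 1)) (.const 1)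

theorem uniform_family : (family p unary).Uniform where
  K _ _ := loop_fanIn
  Z _ _ := loop_gates
  H _ _ ha := .add (loop_digits ha) (.const 4)
  ref _ _ _ _ _ _ hN hl hz hq he :=
    .ifeq hl (.const 0) (loop_layer₀ hN hz hq he) <| .ifeq hl (.const 1) (loop_layer₁ hN hz hq) <|
    .ifeq hl (.const 2) (loop_layer₂ hN hz) <|
    .iflt hl (.add (loop_digits hN) (.const 3)) (loop_layerReach hN hl hz hq he)
      (loop_layerOut hN hq he)

end Uniform

end Prediction

/-! ### The words of the prediction problems -/

theorem List.getD_flatten {α : Type*} {m : ℕ} (d : α) :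
    ∀ (L : List (List α)), (∀ l ∈ L, l.length = m) → ∀ (u r : ℕ), r < m →
      L.flatten.getD (u * m + r) d = (L.getD u []).getD r d
  | [], _, u, r, _ => by simp
  | l :: L, h, u, r, hr => by
    have hl := h l (by simp)
    rcases u with _ | u
    · rw [List.flatten_cons, Nat.zero_mul, Nat.zero_add, List.getD_append _ _ _ _ (by omega)]
      rfl
    · rw [List.flatten_cons, List.getD_append_right _ _ _ _ (by rw [hl, Nat.add_mul]; omega),
        show (u + 1) * m + r - l.length = u * m + r by rw [hl, Nat.add_mul]; omega,
        List.getD_flatten d L (fun l' h' => h l' (by simp [h'])) u r hr]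
      rfl

theorem List.getD_ofFn {α : Type*} {n : ℕ} (f : Fin n → α) (d : α) {k : ℕ} (h : k < n) :
    (List.ofFn f).getD k d = f ⟨k, h⟩ := by
  simp [List.getD_eq_getElem?_getD, h]

theorem List.ext_getD {α : Type*} (d : α) {l l' : List α} (h : l.length = l'.length)
    (h' : ∀ k < l.length, l.getD k d = l'.getD k d) : l = l' := by
  refine List.ext_getElem h fun k h₁ h₂ => ?_
  simpa [List.getD_eq_getElem?_getD, h₁, h₂] using h' k h₁

namespace PredInstance

open Prediction

variable {p : ℕ}

theorem length_stateWord (q : PerState Bool p) : (stateWord q).length = 1 + 2 * p := by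
  simp [stateWord]; omega

variable (I : PredInstance p) (tw : List Bool)

theorem length_adjacency :
    (List.ofFn fun u => List.ofFn fun v => I.graph.adj u v).flatten.length = I.n * I.n := by
  simp [List.length_flatten, List.map_ofFn, Function.comp_def]

theorem length_states :
    (List.ofFn fun u => stateWord (I.init u)).flatten.length = I.n * (1 + 2 * p) := by
  simp [List.length_flatten, List.map_ofFn, Function.comp_def, length_stateWord]

theorem length_word : (I.word tw).length = timePos p I.n + tw.length := by
  have h₁ := I.length_adjacency
  have h₂ := I.length_states
  simp only [word, List.length_append, List.length_replicate, h₁, h₂, timePos, nodePos,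
    List.length_ofFn, List.length_cons, List.length_nil]

theorem word_lt {k : ℕ} (h : k < I.n) : (I.word tw).getD k false = true := by
  simp only [word, List.append_assoc]
  rw [List.getD_append _ _ _ _ (by simpa using h)]
  simp [List.getD_eq_getElem?_getD, h]

theorem word_n : (I.word tw).getD I.n false = false := by
  simp only [word, List.append_assoc]
  rw [List.getD_append_right _ _ _ _ (by simp)]
  simp

theorem word_adj (u v : Fin I.n) :
    (I.word tw).getD (adjPos I.n u v) false = I.graph.adj u v := by
  have h₁ := I.length_adjacency
  have h : u.val * I.n + v < I.n * I.n := by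
    have := Nat.mul_le_mul_right I.n (show u.val + 1 ≤ I.n from u.2)
    rw [Nat.add_mul] at this
    have := v.2
    omega
  have e : I.word tw = (List.replicate I.n true ++ [false]) ++
    ((List.ofFn fun u => List.ofFn fun v => I.graph.adj u v).flatten ++
    ((List.ofFn fun u => stateWord (I.init u)).flatten ++
    (List.ofFn (fun u => decide (u = I.node)) ++ tw))) := by simp [word]
  rw [e, List.getD_append_right _ _ _ _ (by simp [adjPos]),
    show adjPos I.n u v - (List.replicate I.n true ++ [false]).length = u.val * I.n + v by
      simp [adjPos], List.getD_append _ _ _ _ (by rwa [h₁]),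
    List.getD_flatten _ _ (by simp [List.mem_ofFn]) _ _ v.2, List.getD_ofFn _ _ u.2,
    List.getD_ofFn _ _ v.2]

theorem word_state (u : Fin I.n) {r : ℕ} (hr : r < 1 + 2 * p) :
    (I.word tw).getD (statePos p I.n u + r) false = (stateWord (I.init u)).getD r false := by
  have h₁ := I.length_adjacency
  have h₂ := I.length_states
  have h : u.val * (1 + 2 * p) + r < I.n * (1 + 2 * p) := by
    have := Nat.mul_le_mul_right (1 + 2 * p) (show u.val + 1 ≤ I.n from u.2)
    rw [Nat.add_mul] at this
    omega
  have e : I.word tw = (List.replicate I.n true ++ [false] ++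
    (List.ofFn fun u => List.ofFn fun v => I.graph.adj u v).flatten) ++
    ((List.ofFn fun u => stateWord (I.init u)).flatten ++
    (List.ofFn (fun u => decide (u = I.node)) ++ tw)) := by simp [word]
  have hl : (List.replicate I.n true ++ [false] ++
    (List.ofFn fun u => List.ofFn fun v => I.graph.adj u v).flatten).length =
      I.n + 1 + I.n * I.n := by
    rw [List.length_append, h₁]; simp
  rw [e, List.getD_append_right _ _ _ _ (by rw [hl, statePos]; omega), hl,
    show statePos p I.n u + r - (I.n + 1 + I.n * I.n) = u.val * (1 + 2 * p) + r by
      rw [statePos]; omega, List.getD_append _ _ _ _ (by rwa [h₂]),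
    List.getD_flatten _ _ (by simp [List.mem_ofFn, length_stateWord]) _ _ hr,
    List.getD_ofFn _ _ u.2]

theorem word_fst (u : Fin I.n) :
    (I.word tw).getD (statePos p I.n u) false = (I.init u).1 := by
  have := I.word_state tw u (r := 0) (by omega)
  simpa [stateWord] using this

theorem word_clock (u : Fin I.n) {i : ℕ} (hi : i < p) :
    (I.word tw).getD (statePos p I.n u + 1 + i) false = decide (i = (I.init u).2.1.val) := by
  rw [Nat.add_assoc, I.word_state tw u (by omega), stateWord, List.append_assoc,
    List.getD_append_right _ _ _ _ (by simp), List.getD_append _ _ _ _ (by simpa using hi)]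
  simp only [List.length_singleton, Nat.add_sub_cancel_left]
  rw [List.getD_ofFn _ _ hi]
  simp [Fin.ext_iff]

theorem word_schedule (u : Fin I.n) {i : ℕ} (hi : i < p) :
    (I.word tw).getD (statePos p I.n u + 1 + p + i) false =
      decide ((⟨i, hi⟩ : Fin p) ∈ (I.init u).2.2) := by
  rw [Nat.add_assoc, Nat.add_assoc, I.word_state tw u (by omega), stateWord,
    List.getD_append_right _ _ _ _ (by simp; omega)]
  simp only [List.length_append, List.length_singleton, List.length_ofFn]
  rw [show 1 + (p + i) - (1 + p) = i by omega, List.getD_ofFn _ _ hi]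

theorem word_node {u : ℕ} (hu : u < I.n) :
    (I.word tw).getD (nodePos p I.n u) false = decide (u = I.node.val) := by
  have h₁ := I.length_adjacency
  have h₂ := I.length_states
  have e : I.word tw = (List.replicate I.n true ++ [false] ++
    (List.ofFn fun u => List.ofFn fun v => I.graph.adj u v).flatten ++
    (List.ofFn fun u => stateWord (I.init u)).flatten) ++
    (List.ofFn (fun u => decide (u = I.node)) ++ tw) := by simp [word]
  have hl : (List.replicate I.n true ++ [false] ++
    (List.ofFn fun u => List.ofFn fun v => I.graph.adj u v).flatten ++
    (List.ofFn fun u => stateWord (I.init u)).flatten).length =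
      I.n + 1 + I.n * I.n + I.n * (1 + 2 * p) := by
    rw [List.length_append, List.length_append, h₁, h₂]; simp
  rw [e, List.getD_append_right _ _ _ _ (by rw [hl, nodePos]; omega), hl,
    show nodePos p I.n u - (I.n + 1 + I.n * I.n + I.n * (1 + 2 * p)) = u by
      rw [nodePos]; omega, List.getD_append _ _ _ _ (by simpa using hu), List.getD_ofFn _ _ hu]
  simp [Fin.ext_iff]

theorem word_time (k : ℕ) :
    (I.word tw).getD (timePos p I.n + k) false = tw.getD k false := by
  have h₁ := I.length_adjacency
  have h₂ := I.length_states
  have hl := I.length_word []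
  have e : I.word tw = I.word [] ++ tw := by simp [word]
  rw [e, List.getD_append_right _ _ _ _ (by rw [hl]; simp), hl]
  simp

end PredInstance

namespace Prediction

/-- The word starts with the encoding of a graph with `n` nodes, of a configuration and of the
node `v`. -/
structure WellFormed (p : ℕ) (w : List Bool) (n v : ℕ) : Prop where
  lt : v < n
  le : timePos p n ≤ w.length
  ones : ∀ k < n, w.getD k false = true
  zero : w.getD n false = false
  node : ∀ u < n, w.getD (nodePos p n u) false = decide (u = v)
  clock : ∀ u < n, ∃ q < p, ∀ e < p, w.getD (statePos p n u + 1 + e) false = decide (e = q)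
  symm : ∀ u < n, ∀ u' < n, w.getD (adjPos n u u') false = w.getD (adjPos n u' u) false

theorem _root_.PredInstance.wellFormed {p : ℕ} (I : PredInstance p) (tw : List Bool) :
    WellFormed p (I.word tw) I.n I.node where
  lt := I.node.2
  le := by rw [I.length_word]; omega
  ones k hk := I.word_lt tw hk
  zero := I.word_n tw
  node u hu := I.word_node tw hu
  clock u hu := ⟨_, (I.init ⟨u, hu⟩).2.1.2, fun e he => I.word_clock tw ⟨u, hu⟩ he⟩
  symm u hu u' hu' := by
    have h₁ := I.word_adj tw ⟨u, hu⟩ ⟨u', hu'⟩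
    have h₂ := I.word_adj tw ⟨u', hu'⟩ ⟨u, hu⟩
    simp only at h₁ h₂
    rw [h₁, h₂, I.graph.symm]

/-- The conditions are what is needed to read off a graph, a clock for each node and a node; the
Boolean states and the update sets are arbitrary bits. The time is free here, since the rest of the
word is not interpreted. -/
theorem WellFormed.exists_instance {p n v : ℕ} {w : List Bool} (h : WellFormed p w n v) (t : ℕ) :
    ∃ I : PredInstance p, I.n = n ∧ I.node.val = v ∧ I.time = t ∧
      w = I.word (w.drop (timePos p n)) := by
  have hc := fun u : Fin n => h.clock u u.2
  choose q hq hq' using hc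
  let I : PredInstance p := ⟨n, ⟨fun u u' => w.getD (adjPos n u u') false,
    fun u u' => h.symm u u.2 u' u'.2⟩, ⟨v, h.lt⟩, fun u => (w.getD (statePos p n u) false,
      ⟨q u, hq u⟩, Finset.univ.filter fun i : Fin p =>
        w.getD (statePos p n u + 1 + p + i) false = true), t⟩
  refine ⟨I, rfl, rfl, rfl, ?_⟩
  set tw := w.drop (timePos p n) with htw
  have hle := h.le
  have hn : 0 < n := Nat.zero_lt_of_lt h.lt
  refine List.ext_getD false ?_ fun k hk => ?_
  · rw [I.length_word, htw, List.length_drop]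
    change _ = timePos p n + _
    omega
  -- The two words are compared field by field: the number of nodes, its end mark, the matrix, the
  -- states, the node, the time.
  by_cases h₁ : k < n
  · rw [h.ones k h₁, I.word_lt tw h₁]
  by_cases h₂ : k = n
  · rw [h₂, h.zero]; exact (I.word_n tw).symm
  by_cases h₃ : k < n + 1 + n * n
  · have hu : (k - n - 1) / n < n := Nat.div_lt_of_lt_mul (by omega)
    have hv : (k - n - 1) % n < n := Nat.mod_lt _ hn
    have e : adjPos n ((k - n - 1) / n) ((k - n - 1) % n) = k := by
      rw [adjPos, Nat.div_add_mod']; omega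
    have := I.word_adj tw ⟨_, hu⟩ ⟨_, hv⟩
    change (I.word tw).getD (adjPos n _ _) false = w.getD (adjPos n _ _) false at this
    simp only [e] at this
    exact this.symm
  by_cases h₄ : k < nodePos p n 0
  · have h4 : k - (n + 1 + n * n) < n * (1 + 2 * p) := by rw [nodePos] at h₄; omega
    set j := k - (n + 1 + n * n) with hj
    have hu : j / (1 + 2 * p) < n := Nat.div_lt_of_lt_mul (by rwa [Nat.mul_comm])
    have hr : j % (1 + 2 * p) < 1 + 2 * p := Nat.mod_lt _ (by omega)
    have hdm := Nat.div_add_mod' j (1 + 2 * p)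
    have e : statePos p n (j / (1 + 2 * p)) + j % (1 + 2 * p) = k := by
      rw [statePos]; omega
    set u := j / (1 + 2 * p) with hud
    set r := j % (1 + 2 * p) with hrd
    rcases Nat.eq_zero_or_pos r with h0 | h0
    · have := I.word_fst tw ⟨u, hu⟩
      change (I.word tw).getD (statePos p n u) false = w.getD (statePos p n u) false at this
      rw [h0, Nat.add_zero] at e
      rw [← e, this]
    by_cases hrp : r < 1 + p
    · have := I.word_clock tw ⟨u, hu⟩ (i := r - 1) (by omega)
      change (I.word tw).getD (statePos p n u + 1 + (r - 1)) false =
        decide (r - 1 = q ⟨u, hu⟩) at this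
      rw [← hq' ⟨u, hu⟩ (r - 1) (by omega),
        show statePos p n u + 1 + (r - 1) = k by omega] at this
      rw [this]
    · have := I.word_schedule tw ⟨u, hu⟩ (i := r - 1 - p) (by omega)
      change (I.word tw).getD (statePos p n u + 1 + p + (r - 1 - p)) false = _ at this
      rw [show statePos p n u + 1 + p + (r - 1 - p) = k by omega] at this
      rw [this]
      simp only [I, Finset.mem_filter, Finset.mem_univ, true_and]
      rw [show statePos p n u + 1 + p + (r - 1 - p) = k by omega]
      simp
  by_cases h₅ : k < timePos p n
  · have hu : k - nodePos p n 0 < n := by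
      rw [timePos, nodePos] at h₅; rw [nodePos] at h₄ ⊢; omega
    have e : nodePos p n (k - nodePos p n 0) = k := by
      rw [nodePos] at h₄ ⊢; rw [nodePos]; omega
    have h6 := h.node _ hu
    have h7 := I.word_node tw (u := k - nodePos p n 0) hu
    change (I.word tw).getD (nodePos p n _) false = decide (_ = v) at h7
    rw [e] at h6 h7
    rw [h6, h7]
  · have := I.word_time tw (k - timePos p n)
    change (I.word tw).getD (timePos p n + _) false = _ at this
    rw [show timePos p n + (k - timePos p n) = k by omega] at this
    rw [this, htw, List.getD_eq_getElem?_getD, List.getD_eq_getElem?_getD, List.getElem?_drop,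
      show timePos p n + (k - timePos p n) = k by omega]

end Prediction

/-! ### The values of the gates -/

/-- All conjunctions formally have `fanIn` literals, but in most of them all but the first few are
the constant `true`. -/
theorem forall_lt_iff_of_forall_ge {K m : ℕ} {P : ℕ → Prop} (hK : m ≤ K) (h : ∀ e, m ≤ e → P e) :
    (∀ e < K, P e) ↔ ∀ e < m, P e :=
  ⟨fun H e he => H e (he.trans_le hK), fun H e _ => (Nat.lt_or_ge e m).elim (H e) (h e)⟩

namespace Prediction

open StackCode

/-! ### Digits of gate numbers and positions in the word. -/

section Numbers

variable {p N : ℕ}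

theorem four_le_base : 4 ≤ base p N := by unfold base; nlinarith

theorem lt_base : N < base p N := by unfold base; nlinarith

theorem period_lt_base : p < base p N := by unfold base; nlinarith

theorem base_le_fanIn : base p N * base p N * 4 ≤ fanIn p N :=
  Nat.mul_le_mul_left _ four_le_base

theorem mul_four_le_fanIn : base p N * 16 ≤ fanIn p N := by
  have h := @base_le_fanIn p N
  have h' := Nat.mul_le_mul_left (base p N) (@four_le_base p N)
  omega

theorem pack_lt {κ n v a b : ℕ} (hκ : κ < base p N) (hn : n < base p N) (hv : v < base p N)
    (ha : a < base p N) (hb : b < base p N) : pack p N κ n v a b < gates p N := by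
  unfold pack gates fanIn
  have key : ∀ x y c : ℕ, x < y → c < base p N → x * base p N + c < y * base p N := by
    intro x y c h h'
    have := Nat.mul_le_mul_right (base p N) (show x + 1 ≤ y from h)
    rw [Nat.add_mul, Nat.one_mul] at this
    omega
  exact key _ _ _ (key _ _ _ (key _ _ _ (key _ _ _ hκ hn) hv) ha) hb

theorem base_div {x c : ℕ} (h : c < base p N) : (x * base p N + c) / base p N = x := by
  rw [Nat.add_comm, Nat.add_mul_div_right _ _ (base_pos p N), Nat.div_eq_of_lt h, Nat.zero_add]

theorem base_mod {x c : ℕ} (h : c < base p N) : (x * base p N + c) % base p N = c := by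
  rw [Nat.add_comm, Nat.add_mul_mod_self_right, Nat.mod_eq_of_lt h]

variable {κ n v a b : ℕ}

theorem digit₀_pack (hb : b < base p N) : digit₀ p N (pack p N κ n v a b) = b := by
  rw [digit₀, pack, base_mod hb]

theorem digit₁_pack (ha : a < base p N) (hb : b < base p N) :
    digit₁ p N (pack p N κ n v a b) = a := by
  rw [digit₁, pack, base_div hb, base_mod ha]

theorem digit₂_pack (hv : v < base p N) (ha : a < base p N) (hb : b < base p N) :
    digit₂ p N (pack p N κ n v a b) = v := by
  rw [digit₂, pack, base_div hb, base_div ha, base_mod hv]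

theorem digit₃_pack (hn : n < base p N) (hv : v < base p N) (ha : a < base p N)
    (hb : b < base p N) : digit₃ p N (pack p N κ n v a b) = n := by
  rw [digit₃, pack, base_div hb, base_div ha, base_div hv, base_mod hn]

theorem digit₄_pack (hn : n < base p N) (hv : v < base p N) (ha : a < base p N)
    (hb : b < base p N) : digit₄ p N (pack p N κ n v a b) = κ := by
  rw [digit₄, pack, base_div hb, base_div ha, base_div hv, base_div hn]

/-- The numbers of conjunctions are the numbers with three digits. -/
theorem exists_lt_fanIn {P : ℕ → Prop} : (∃ q < fanIn p N, P q) ↔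
    ∃ f < base p N, ∃ c < base p N, ∃ d < base p N, P (pack p N 0 0 f c d) := by
  constructor
  · rintro ⟨q, hq, h⟩
    refine ⟨q / base p N / base p N, ?_, digit₁ p N q, Nat.mod_lt _ (base_pos p N), digit₀ p N q,
      Nat.mod_lt _ (base_pos p N), ?_⟩
    · rw [Nat.div_div_eq_div_mul]
      exact Nat.div_lt_of_lt_mul hq
    · rw [pack, digit₁, digit₀, Nat.zero_mul, Nat.zero_add, Nat.zero_mul, Nat.zero_add,
        Nat.div_add_mod', Nat.div_add_mod']
      exact h
  · rintro ⟨f, hf, c, hc, d, hd, h⟩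
    refine ⟨_, ?_, h⟩
    have key : ∀ x y c : ℕ, x < y → c < base p N → x * base p N + c < y * base p N := by
      intro x y c h h'
      have := Nat.mul_le_mul_right (base p N) (show x + 1 ≤ y from h)
      rw [Nat.add_mul, Nat.one_mul] at this
      omega
    simp only [pack, Nat.zero_mul, Nat.zero_add]
    exact key _ _ _ (key _ _ _ hf hc) hd

theorem div_div_pack {f c d : ℕ} (hc : c < base p N) (hd : d < base p N) :
    pack p N 0 0 f c d / base p N / base p N = f := by
  rw [pack, base_div hd, base_div hc, Nat.zero_mul, Nat.zero_add, Nat.zero_mul, Nat.zero_add]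

theorem adjPos_lt {n u v : ℕ} (hu : u < n) (hv : v < n) : adjPos n u v < timePos p n := by
  have := Nat.mul_le_mul_right n (show u + 1 ≤ n from hu)
  rw [Nat.add_mul] at this
  unfold adjPos timePos nodePos
  omega

theorem statePos_lt {n u r : ℕ} (hu : u < n) (hr : r < 1 + 2 * p) :
    statePos p n u + r < timePos p n := by
  have := Nat.mul_le_mul_right (1 + 2 * p) (show u + 1 ≤ n from hu)
  rw [Nat.add_mul, Nat.one_mul] at this
  unfold statePos timePos nodePos
  omega

theorem le_timePos : n + 1 ≤ timePos p n := by unfold timePos nodePos; omega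

end Numbers

/-! ### Values of literals and of the gates of each layer. -/

section Values

variable {p : ℕ} {unary : Bool} {w : ℕ → Bool} {N l : ℕ}

theorem lit_inputLit {i : ℕ} (h : i < N) : (family p unary).lit w N l (inputLit i) = w i :=
  LayerFamily.lit_input h

theorem lit_inputLit_not {i : ℕ} (h : i < N) :
    (family p unary).lit w N l (inputLit i + 1) = !w i :=
  LayerFamily.lit_not_input h

theorem lit_gateLit {l' z : ℕ} (h : l' < l) (hz : z < gates p N) :
    (family p unary).lit w N l (gateLit p N l' z) = (family p unary).val w N l' z :=
  LayerFamily.lit_gate (F := family p unary) h hz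

theorem lit_gateLit_not {l' z : ℕ} (h : l' < l) (hz : z < gates p N) :
    (family p unary).lit w N l (gateLit p N l' z + 1) = !(family p unary).val w N l' z :=
  LayerFamily.lit_not_gate (F := family p unary) h hz

theorem val_layer₀ {z : ℕ} (hz : z < gates p N) : (family p unary).val w N 0 z = true ↔
    ∃ q < fanIn p N, ∀ e < fanIn p N,
      (family p unary).lit w N 0 (layer₀ p unary N z q e) = true :=
  LayerFamily.val_eq_true_iff (F := family p unary) (Nat.succ_pos _) hz

theorem val_layer₁ {z : ℕ} (hz : z < gates p N) : (family p unary).val w N 1 z = true ↔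
    ∃ q < fanIn p N, ∀ e < fanIn p N,
      (family p unary).lit w N 1 (layer₁ p N z q) = true :=
  LayerFamily.val_eq_true_iff (F := family p unary) (by change 1 < _ + 4; omega) hz

theorem val_layer₂ {z : ℕ} (hz : z < gates p N) : (family p unary).val w N 2 z = true ↔
    ∃ q < fanIn p N, ∀ e < fanIn p N,
      (family p unary).lit w N 2 (layer₂ p N z) = true :=
  LayerFamily.val_eq_true_iff (F := family p unary) (by change 2 < _ + 4; omega) hz

theorem val_layerReach {j z : ℕ} (hj : j < digits unary N) (hz : z < gates p N) :
    (family p unary).val w N (j + 3) z = true ↔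
    ∃ q < fanIn p N, ∀ e < fanIn p N,
      (family p unary).lit w N (j + 3) (layerReach p unary N (j + 3) z q e) = true := by
  have h := LayerFamily.val_eq_true_iff (F := family p unary) (w := w) (N := N) (l := j + 3)
    (by change _ < _ + 4; omega) hz
  have e : ∀ q c, (family p unary).ref N (j + 3) z q c = layerReach p unary N (j + 3) z q c := by
    intro q c
    simp only [family]
    rw [if_neg (by omega), if_neg (by omega), if_neg (by omega), if_pos (by omega)]
  simp only [e] at h
  exact h

theorem output_family : (family p unary).toTree.value w N
    ((family p unary).toTree.H N * (family p unary).toTree.B N - 1) = true ↔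
    ∃ q < fanIn p N, ∀ e < fanIn p N,
      (family p unary).lit w N (digits unary N + 3) (layerOut p unary N q e) = true := by
  have h := LayerFamily.output_eq_true_iff (F := family p unary) (w := w) (N := N)
    (l := digits unary N + 3) rfl
  have e : ∀ q c, (family p unary).ref N (digits unary N + 3) ((family p unary).Z N - 1) q c =
      layerOut p unary N q c := by
    intro q c
    simp only [family]
    rw [if_neg (by omega), if_neg (by omega), if_neg (by omega), if_neg (by omega)]
  simp only [e] at h
  exact h

theorem fanIn_pos : 0 < fanIn p N := (family p true).K_pos N

end Values

/-! ### The gates that check the format of the word. -/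

section Format

variable {p : ℕ} {unary : Bool} {w : List Bool} {n v : ℕ}

/-- The time is written correctly. -/
def TimeFormat (p : ℕ) (unary : Bool) (w : List Bool) (n : ℕ) : Prop :=
  if unary then ∀ k < w.length, timePos p n ≤ k → w.getD k false = true
  else timePos p n < w.length → w.getD (w.length - 1) false = true

theorem val_format {a b : ℕ} (hn : n < base p w.length) (hv : v < base p w.length)
    (ha : a < base p w.length) (hb : b < base p w.length) :
    (family p unary).val (fun k => w.getD k false) w.length 0 (pack p w.length 1 n v a b) = true ↔
      v < n ∧ timePos p n ≤ w.length ∧ (∀ k < n, w.getD k false = true) ∧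
      w.getD n false = false ∧ (∀ u < n, w.getD (nodePos p n u) false = decide (u = v)) ∧
      TimeFormat p unary w n := by
  rw [val_layer₀ (pack_lt (by have := @four_le_base p w.length; omega) hn hv ha hb)]
  simp only [layer₀, digit₄_pack hn hv ha hb, digit₃_pack hn hv ha hb, digit₂_pack hv ha hb,
    one_ne_zero, if_false, if_true]
  have hK := @mul_four_le_fanIn p w.length
  have hKN := @lt_base p w.length
  set N := w.length with hN
  -- The literals do not depend on `q`, so the disjunction is over equal conjunctions.
  have hpos : (∃ q < fanIn p N, ∀ e < fanIn p N, (family p unary).lit (fun k => w.getD k false) N 0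
      (formatLit p unary N n v e) = true) ↔ ∀ e < fanIn p N,
      (family p unary).lit (fun k => w.getD k false) N 0 (formatLit p unary N n v e) = true :=
    ⟨fun ⟨_, _, h⟩ => h, fun h => ⟨0, fanIn_pos, h⟩⟩
  rw [hpos]
  by_cases hvn : v < n
  swap
  · simp only [formatLit, hvn, if_false, LayerFamily.lit_zero, false_and, iff_false]
    exact fun h => by simpa using h 0 fanIn_pos
  by_cases hT : timePos p n ≤ N
  swap
  · simp only [formatLit, hvn, if_true, if_pos (not_le.1 hT), LayerFamily.lit_zero, hT, false_and,
      and_false, iff_false]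
    exact fun h => by simpa using h 0 fanIn_pos
  have hnT := @le_timePos p n
  have hnodeT : ∀ u < n, nodePos p n u < timePos p n := fun u hu => by
    unfold timePos nodePos; omega
  have hnode0 : ∀ u, nodePos p n 0 + u = nodePos p n u := fun u => by unfold nodePos; omega
  have hnodeTn : nodePos p n n = timePos p n := rfl
  have hn0 : n < nodePos p n 0 := by unfold nodePos; omega
  have F : ∀ e, formatLit p unary N n v e = if e < n then inputLit e
    else if e = n then inputLit e + 1
    else if e < nodePos p n 0 then 1
    else if e < timePos p n then if e = nodePos p n v then inputLit e else inputLit e + 1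
    else if e < N then if unary then inputLit e else if e + 1 = N then inputLit e else 1
    else 1 := fun e => by rw [formatLit, if_pos hvn, if_neg (not_lt.2 hT)]
  simp only [F, hvn, hT, true_and]
  constructor
  · intro h
    refine ⟨fun k hk => ?_, ?_, fun u hu => ?_, ?_⟩
    · have := h k (by omega)
      rwa [if_pos hk, lit_inputLit (by omega)] at this
    · have := h n (by omega)
      rw [if_neg (by omega), if_pos rfl, lit_inputLit_not (by omega)] at this
      simpa using this
    · have h₁ := hnodeT u hu
      have h₂ := hnode0 u
      have h₃ := hnode0 v
      have := h (nodePos p n u) (by omega)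
      rw [if_neg (by omega), if_neg (by omega), if_neg (by omega), if_pos (by omega)] at this
      by_cases huv : u = v
      · rw [if_pos (by rw [huv]), lit_inputLit (by omega)] at this
        simpa [huv] using this
      · rw [if_neg (by omega), lit_inputLit_not (by omega)] at this
        simpa [huv] using this
    · cases unary
      · simp only [TimeFormat, Bool.false_eq_true, if_false] at h ⊢
        intro hlt
        have h₅ := hnode0 n
        have := h (N - 1) (by omega)
        rwa [if_neg (by omega), if_neg (by omega), if_neg (by omega), if_neg (by omega),
          if_pos (by omega), if_pos (by omega), lit_inputLit (by omega)] at this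
      · simp only [TimeFormat, if_true] at h ⊢
        intro k hk hk'
        have h₅ := hnode0 n
        have := h k (by omega)
        rwa [if_neg (by omega), if_neg (by omega), if_neg (by omega), if_neg (by omega),
          if_pos (by omega), lit_inputLit (by omega)] at this
  · rintro ⟨h₁, h₂, h₃, h₄⟩ e -
    split_ifs with c₁ c₂ c₃ c₄ c₅ c₆ c₇ c₈
    · rw [lit_inputLit (by omega)]; exact h₁ e c₁
    · rw [lit_inputLit_not (by omega), c₂, h₂]; rfl
    · rfl
    · rw [lit_inputLit (by omega), c₅, h₃ v hvn]; simp
    · have h₅ := hnode0 (e - nodePos p n 0)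
      have h₆ := hnode0 n
      have h₇ := hnode0 v
      rw [lit_inputLit_not (by omega), show e = nodePos p n (e - nodePos p n 0) by omega,
        h₃ _ (by omega)]
      simp
      omega
    · rw [lit_inputLit (by omega)]
      simp only [TimeFormat, c₇, if_true] at h₄
      exact h₄ e (by omega) (by omega)
    · rw [lit_inputLit (by omega)]
      simp only [TimeFormat, c₇, Bool.false_eq_true, if_false] at h₄
      have := h₄ (by omega)
      rwa [← hN, show N - 1 = e by omega] at this
    · rfl
    · rfl

/-- The conjunction `q` asserts that the vector is the one-hot vector of `q`, and the disjunction is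
over all clock values. -/
theorem val_clock {u b : ℕ} (hn : n < base p w.length) (hv : v < base p w.length)
    (hu : u < base p w.length) (hb : b < base p w.length) (hT : timePos p n ≤ w.length) :
    (family p unary).val (fun k => w.getD k false) w.length 0 (pack p w.length 2 n v u b) = true ↔
      (u < n → ∃ q < p, ∀ e < p, w.getD (statePos p n u + 1 + e) false = decide (e = q)) := by
  rw [val_layer₀ (pack_lt (by have := @four_le_base p w.length; omega) hn hv hu hb)]
  simp only [layer₀, digit₄_pack hn hv hu hb, digit₃_pack hn hv hu hb, digit₁_pack hu hb]
  simp only [OfNat.ofNat_ne_zero, OfNat.ofNat_ne_one, if_false, if_true]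
  have hK := @mul_four_le_fanIn p w.length
  have hp := @period_lt_base p w.length
  by_cases hun : u < n
  swap
  · simp only [clockLit, hun, if_false, LayerFamily.lit_one, implies_true, and_true, false_imp_iff,
      iff_true]
    exact ⟨0, fanIn_pos⟩
  have hpos : ∀ e < p, statePos p n u + 1 + e < w.length := fun e he => by
    have := @statePos_lt p n u (1 + e) hun (by omega)
    omega
  simp only [clockLit, hun, if_true, true_imp_iff]
  constructor
  · rintro ⟨q, hq, h⟩
    by_cases hqp : q < p
    · refine ⟨q, hqp, fun e he => ?_⟩
      have := h e (by omega)
      rw [if_pos hqp, if_pos he] at this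
      split_ifs at this with heq
      · rw [lit_inputLit (hpos e he)] at this
        simpa [heq] using this
      · rw [lit_inputLit_not (hpos e he)] at this
        simpa [heq] using this
    · have := h 0 fanIn_pos
      simp [hqp] at this
  · rintro ⟨q, hq, h⟩
    refine ⟨q, by omega, fun e _ => ?_⟩
    rw [if_pos hq]
    split_ifs with he heq
    · rw [lit_inputLit (hpos e he), h e he]; simp [heq]
    · rw [lit_inputLit_not (hpos e he), h e he]; simp [heq]
    · rfl

/-- Equality of two bits is the disjunction of "both are one" (`q = 0`) and "both are zero" (`q =
1`). -/
theorem val_symm {a b : ℕ} (hn : n < base p w.length) (hv : v < base p w.length)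
    (ha : a < base p w.length) (hb : b < base p w.length) (hT : timePos p n ≤ w.length) :
    (family p unary).val (fun k => w.getD k false) w.length 0 (pack p w.length 3 n v a b) = true ↔
      (a < n → b < n → w.getD (adjPos n a b) false = w.getD (adjPos n b a) false) := by
  rw [val_layer₀ (pack_lt (by have := @four_le_base p w.length; omega) hn hv ha hb)]
  simp only [layer₀, digit₄_pack hn hv ha hb, digit₃_pack hn hv ha hb, digit₁_pack ha hb,
    digit₀_pack hb]
  simp only [OfNat.ofNat_ne_zero, OfNat.ofNat_ne_one, if_false, Nat.reduceEqDiff]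
  have hK := @mul_four_le_fanIn p w.length
  have h4 := @four_le_base p w.length
  by_cases han : a < n
  swap
  · simp only [symmLit, han, if_false, LayerFamily.lit_one, implies_true, and_true, false_imp_iff,
      iff_true]
    exact ⟨0, fanIn_pos⟩
  by_cases hbn : b < n
  swap
  · simp only [symmLit, hbn, if_false, LayerFamily.lit_one, implies_true, and_true, false_imp_iff,
      iff_true, ite_self]
    exact ⟨0, fanIn_pos⟩
  have h₁ := (@adjPos_lt p n a b han hbn).trans_le hT
  have h₂ := (@adjPos_lt p n b a hbn han).trans_le hT
  simp only [symmLit, han, hbn, if_true, true_imp_iff]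
  constructor
  · rintro ⟨q, hq, h⟩
    have e₀ := h 0 (by omega)
    have e₁ := h 1 (by omega)
    simp only [if_true, one_ne_zero, if_false] at e₀ e₁
    split_ifs at e₀ e₁
    · rw [lit_inputLit h₁] at e₀
      rw [lit_inputLit h₂] at e₁
      exact e₀.trans e₁.symm
    · rw [lit_inputLit_not h₁] at e₀
      rw [lit_inputLit_not h₂] at e₁
      exact Bool.not_inj (e₀.trans e₁.symm)
    · simp at e₀
  · intro h
    by_cases ht : w.getD (adjPos n a b) false = true
    · refine ⟨0, fanIn_pos, fun e _ => ?_⟩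
      rw [if_pos rfl]
      split_ifs
      · rw [lit_inputLit h₁]; exact ht
      · rw [lit_inputLit h₂, ← h]; exact ht
      · rfl
    · refine ⟨1, by omega, fun e _ => ?_⟩
      rw [if_neg one_ne_zero, if_pos rfl]
      rw [Bool.not_eq_true] at ht
      split_ifs
      · rw [lit_inputLit_not h₁, ht]; rfl
      · rw [lit_inputLit_not h₂, ← h, ht]; rfl
      · rfl

/-- The gate is the disjunction of the failures of all local checks. The format check guarantees
that the word is long enough; only then do the clock and symmetry gates have their meaning. -/
theorem val_wellFormed (hn : n < base p w.length) (hv : v < base p w.length) :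
    (family p unary).val (fun k => w.getD k false) w.length 1 (pack p w.length 0 n v 0 0) = false ↔
      WellFormed p w n v ∧ TimeFormat p unary w n := by
  have h0 : 0 < base p w.length := base_pos _ _
  have h4 := @four_le_base p w.length
  rw [← Bool.not_eq_true, val_layer₁ (pack_lt h0 hn hv h0 h0)]
  have key : (¬ ∃ q < fanIn p w.length, ∀ e < fanIn p w.length,
      (family p unary).lit (fun k => w.getD k false) w.length 1
        (layer₁ p w.length (pack p w.length 0 n v 0 0) q) = true) ↔
      ∀ κ < 3, ∀ a < base p w.length, ∀ b < base p w.length,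
        (family p unary).val (fun k => w.getD k false) w.length 0
          (pack p w.length (κ + 1) n v a b) = true := by
    rw [exists_lt_fanIn]
    push Not
    refine ⟨fun h κ hκ a ha b hb => ?_, fun h κ hκ a ha b hb => ?_⟩
    · obtain ⟨e, -, he⟩ := h κ (by omega) a ha b hb
      rw [layer₁, div_div_pack ha hb, if_pos hκ, digit₃_pack hn hv h0 h0, digit₂_pack hv h0 h0,
        digit₁_pack ha hb, digit₀_pack hb,
        lit_gateLit_not zero_lt_one (pack_lt (by omega) hn hv ha hb)] at he
      simpa using he
    · refine ⟨0, fanIn_pos, ?_⟩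
      rw [layer₁, div_div_pack ha hb]
      split_ifs with h3
      · rw [digit₃_pack hn hv h0 h0, digit₂_pack hv h0 h0,
          digit₁_pack ha hb, digit₀_pack hb,
          lit_gateLit_not zero_lt_one (pack_lt (by omega) hn hv ha hb), h κ h3 a ha b hb]
        simp
      · simp
  rw [key]
  constructor
  · intro h
    obtain ⟨h₁, h₂, h₃, h₄, h₅, h₆⟩ := (val_format hn hv h0 h0).1 (h 0 (by omega) 0 h0 0 h0)
    have hlt : ∀ u < n, u < base p w.length := fun u hu => hu.trans hn
    exact ⟨⟨h₁, h₂, h₃, h₄, h₅,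
      fun u hu => (val_clock hn hv (hlt u hu) h0 h₂).1 (h 1 (by omega) u (hlt u hu) 0 h0) hu,
      fun u hu u' hu' => (val_symm hn hv (hlt u hu) (hlt u' hu') h₂).1
        (h 2 (by omega) u (hlt u hu) u' (hlt u' hu')) hu hu'⟩, h₆⟩
  · rintro ⟨h, h'⟩ κ hκ a ha b hb
    interval_cases κ
    · exact (val_format hn hv ha hb).2 ⟨h.lt, h.le, h.ones, h.zero, h.node, h'⟩
    · exact (val_clock hn hv ha hb h.le).2 fun hu => h.clock a hu
    · exact (val_symm hn hv ha hb h.le).2 fun hu hu' => h.symm a hu b hu'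

end Format

end Prediction

/-! ### Correctness of the circuits -/

namespace Prediction

open StackCode

variable {p : ℕ} {unary : Bool} (I : PredInstance p) (tw : List Bool)

section Gates

variable {w : List Bool}

theorem timePos_le (hw : w = I.word tw) : timePos p I.n ≤ w.length := by
  rw [hw, I.length_word]; omega

theorem lit_clock (hw : w = I.word tw) {l : ℕ} (u : Fin I.n) {i : ℕ} (hi : i < p) :
    (family p unary).lit (fun k => w.getD k false) w.length l
      (inputLit (statePos p I.n u + 1 + i)) = decide (i = (I.init u).2.1.val) := by
  have h := timePos_le I tw hw
  have := @statePos_lt p I.n u (1 + i) u.2 (by omega)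
  rw [lit_inputLit (by omega), hw, I.word_clock tw u hi]

theorem lit_schedule (hw : w = I.word tw) {l : ℕ} (u : Fin I.n) {i : ℕ} (hi : i < p) :
    (family p unary).lit (fun k => w.getD k false) w.length l
      (inputLit (statePos p I.n u + 1 + p + i)) = decide ((⟨i, hi⟩ : Fin p) ∈ (I.init u).2.2) := by
  have h := timePos_le I tw hw
  have := @statePos_lt p I.n u (1 + p + i) u.2 (by omega)
  rw [lit_inputLit (by omega), hw, I.word_schedule tw u hi]

theorem lit_not_schedule (hw : w = I.word tw) {l : ℕ} (u : Fin I.n) {i : ℕ} (hi : i < p) :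
    (family p unary).lit (fun k => w.getD k false) w.length l
      (inputLit (statePos p I.n u + 1 + p + i) + 1) =
        !decide ((⟨i, hi⟩ : Fin p) ∈ (I.init u).2.2) := by
  have h := timePos_le I tw hw
  have := @statePos_lt p I.n u (1 + p + i) u.2 (by omega)
  rw [lit_inputLit_not (by omega), hw, I.word_schedule tw u hi]

theorem lit_state (hw : w = I.word tw) {l : ℕ} (u : Fin I.n) :
    (family p unary).lit (fun k => w.getD k false) w.length l
      (inputLit (statePos p I.n u)) = (I.init u).1 := by
  have h := timePos_le I tw hw
  have := @statePos_lt p I.n u 0 u.2 (by omega)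
  rw [lit_inputLit (by omega), hw, I.word_fst tw u]

theorem lit_not_state (hw : w = I.word tw) {l : ℕ} (u : Fin I.n) :
    (family p unary).lit (fun k => w.getD k false) w.length l
      (inputLit (statePos p I.n u) + 1) = !(I.init u).1 := by
  have h := timePos_le I tw hw
  have := @statePos_lt p I.n u 0 u.2 (by omega)
  rw [lit_inputLit_not (by omega), hw, I.word_fst tw u]

theorem lit_adj (hw : w = I.word tw) {l : ℕ} (u v : Fin I.n) :
    (family p unary).lit (fun k => w.getD k false) w.length l
      (inputLit (adjPos I.n u v)) = I.graph.adj u v := by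
  have h := timePos_le I tw hw
  have := @adjPos_lt p I.n u v u.2 v.2
  rw [lit_inputLit (by omega), hw, I.word_adj tw u v]

theorem n_lt_base (hw : w = I.word tw) : I.n < base p w.length := by
  have h := timePos_le I tw hw
  have h' := @le_timePos p I.n
  have := @lt_base p w.length
  omega

theorem start_lt_base (hw : w = I.word tw) : (I.n + 1) * p < base p w.length := by
  have h := timePos_le I tw hw
  have h' := @le_timePos p I.n
  unfold base
  calc (I.n + 1) * p ≤ (w.length + 4) * p := Nat.mul_le_mul_right _ (by omega)
    _ < (w.length + 4) * (p + 1) := Nat.mul_lt_mul_of_pos_left (by omega) (by omega)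

/-- For a target among the genuine nodes, a conjunction can hold only if its guess agrees with the
clock and the update set of that node. This matches the case distinction in `PredInstance.Step`. -/
theorem val_step (hw : w = I.word tw) {a b : ℕ} (ha : a < base p w.length)
    (hb : b < base p w.length) :
    (family p unary).val (fun k => w.getD k false) w.length 0
      (pack p w.length 0 I.n 0 a b) = true ↔ I.Step a b := by
  have h0 := base_pos p w.length
  have hn := n_lt_base I tw hw
  have hp := I.period_pos
  rw [val_layer₀ (pack_lt h0 hn h0 ha hb)]
  simp only [layer₀, digit₄_pack hn h0 ha hb, digit₃_pack hn h0 ha hb, digit₁_pack ha hb,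
    digit₀_pack hb, if_true]
  have hK := @mul_four_le_fanIn p w.length
  have hpb := @period_lt_base p w.length
  have h4 := @four_le_base p w.length
  have hfalse : ¬ ∃ q < fanIn p w.length, ∀ e < fanIn p w.length,
      (family p unary).lit (fun k => w.getD k false) w.length 0 0 = true := by
    rintro ⟨q, -, h⟩
    simpa using h 0 fanIn_pos
  unfold stepLit PredInstance.Step
  by_cases h₁ : I.n < a / p
  · simp only [h₁, if_true]
    exact iff_of_false hfalse fun h => absurd h.1 (not_le.2 h₁)
  by_cases h₂ : b % p = (a % p + 1) % p
  swap
  · simp only [h₁, h₂, if_false]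
    exact iff_of_false hfalse fun h => h.2.1.elim
  simp only [h₁, h₂, if_true, if_false, not_lt.1 h₁, true_and]
  by_cases h₃ : b / p = I.n
  · simp only [h₃, if_true, lt_irrefl, IsEmpty.exists_iff, or_false, true_and]
    by_cases h₄ : a / p = I.n
    · simp only [h₄, if_true, iff_true]
      exact ⟨0, fanIn_pos, fun _ _ => rfl⟩
    · simp only [h₄, if_false, iff_false]
      exact hfalse
  by_cases h₄ : I.n < b / p
  · simp only [h₃, h₄, if_true, if_false, false_and, false_or]
    exact iff_of_false hfalse fun ⟨h, _⟩ => absurd h (not_lt.2 h₄.le)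
  have hbn : b / p < I.n := by omega
  simp only [h₃, h₄, if_false, false_and, false_or, hbn, exists_true_left]
  set u : Fin I.n := ⟨b / p, hbn⟩ with hu
  have hub : b / p = u.val := rfl
  have hmod : ∀ x, x % p < p := fun x => Nat.mod_lt _ hp
  have hclock := (I.init u).2.1.2
  have three : ∀ f : ℕ → ℕ, (∀ e, 3 ≤ e → f e = 1) →
      ((∀ e < fanIn p w.length,
        (family p unary).lit (fun k => w.getD k false) w.length 0 (f e) = true) ↔
        (family p unary).lit (fun k => w.getD k false) w.length 0 (f 0) = true ∧
        (family p unary).lit (fun k => w.getD k false) w.length 0 (f 1) = true ∧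
        (family p unary).lit (fun k => w.getD k false) w.length 0 (f 2) = true) := by
    intro f hf
    rw [forall_lt_iff_of_forall_ge (m := 3) (by omega) fun e he => by rw [hf e he]; rfl]
    refine ⟨fun h => ⟨h 0 (by omega), h 1 (by omega), h 2 (by omega)⟩, fun ⟨h, h', h''⟩ e he => ?_⟩
    interval_cases e <;> assumption
  -- the conjunctions for the case that the node is updated
  have A : ∀ q < p, ((∀ e < fanIn p w.length,
      (family p unary).lit (fun k => w.getD k false) w.length 0
        (if e = 0 then inputLit (statePos p I.n (b / p) + 1 + q)
        else if e = 1 then inputLit (statePos p I.n (b / p) + 1 + p + (q + a % p) % p)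
        else if e = 2 then if a / p < I.n then inputLit (adjPos I.n (b / p) (a / p)) else 0
        else 1) = true) ↔ q = (I.init u).2.1.val ∧
        (⟨(q + a % p) % p, hmod _⟩ : Fin p) ∈ (I.init u).2.2 ∧
        ∃ h' : a / p < I.n, I.graph.adj u ⟨a / p, h'⟩ = true) := by
    intro q hq
    rw [three _ fun e he => by rw [if_neg (by omega), if_neg (by omega), if_neg (by omega)]]
    simp only [if_true, one_ne_zero, if_false, OfNat.ofNat_ne_zero, OfNat.ofNat_ne_one, hub]
    rw [lit_clock I tw hw u hq, lit_schedule I tw hw u (hmod _), decide_eq_true_eq,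
      decide_eq_true_eq]
    refine and_congr_right fun _ => and_congr_right fun _ => ?_
    by_cases han : a / p < I.n
    · simp only [han, if_true, exists_true_left]
      exact Eq.to_iff (congrArg (· = true) (lit_adj I tw hw u ⟨a / p, han⟩))
    · simp [han]
  -- the conjunctions for the case that it is not
  have B : ∀ q < p, ((∀ e < fanIn p w.length,
      (family p unary).lit (fun k => w.getD k false) w.length 0
        (if e = 0 then inputLit (statePos p I.n (b / p) + 1 + q)
        else if e = 1 then inputLit (statePos p I.n (b / p) + 1 + p + (q + a % p) % p) + 1
        else if e = 2 then if a / p = b / p then 1 else 0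
        else 1) = true) ↔ q = (I.init u).2.1.val ∧
        (⟨(q + a % p) % p, hmod _⟩ : Fin p) ∉ (I.init u).2.2 ∧ a / p = b / p) := by
    intro q hq
    rw [three _ fun e he => by rw [if_neg (by omega), if_neg (by omega), if_neg (by omega)]]
    simp only [if_true, one_ne_zero, if_false, OfNat.ofNat_ne_zero, OfNat.ofNat_ne_one, hub]
    rw [lit_clock I tw hw u hq, lit_not_schedule I tw hw u (hmod _), decide_eq_true_eq,
      Bool.not_eq_true', decide_eq_false_iff_not]
    refine and_congr_right fun _ => and_congr_right fun _ => ?_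
    split_ifs with h <;> simp [h]
  constructor
  · rintro ⟨q, -, h⟩
    by_cases hq : q < p
    · simp only [hq, if_true] at h
      obtain ⟨rfl, h₅, h₆⟩ := (A q hq).1 h
      rw [if_pos h₅]
      exact h₆
    · by_cases hq' : q < 2 * p
      · simp only [hq, hq', if_true, if_false] at h
        obtain ⟨e, h₅, h₆⟩ := (B (q - p) (by omega)).1 h
        rw [if_neg (by simpa only [e] using h₅)]
        exact h₆
      · simp only [hq, hq', if_false] at h
        simpa using h 0 fanIn_pos
  · intro h
    split_ifs at h with hc
    · refine ⟨(I.init u).2.1.val, by omega, ?_⟩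
      simp only [hclock, if_true]
      exact (A _ hclock).2 ⟨rfl, hc, h⟩
    · refine ⟨p + (I.init u).2.1.val, by omega, ?_⟩
      have e₁ : ¬ p + (I.init u).2.1.val < p := by omega
      have e₂ : p + (I.init u).2.1.val < 2 * p := by omega
      simp only [e₁, e₂, if_true, if_false, Nat.add_sub_cancel_left]
      exact (B _ hclock).2 ⟨rfl, hc, h⟩

theorem val_reach_zero (hw : w = I.word tw) {a b : ℕ} (ha : a < base p w.length)
    (hb : b < base p w.length) :
    (family p unary).val (fun k => w.getD k false) w.length 2
      (pack p w.length 0 I.n 0 a b) = true ↔ I.Reach 0 a b := by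
  have h0 := base_pos p w.length
  have hn := n_lt_base I tw hw
  have hp := I.period_pos
  rw [val_layer₂ (pack_lt h0 hn h0 ha hb)]
  have hc : ∀ {P : Prop}, (∃ q < fanIn p w.length, ∀ e < fanIn p w.length, P) ↔ P := fun {P} =>
    ⟨fun ⟨_, _, h⟩ => h 0 fanIn_pos, fun h => ⟨0, fanIn_pos, fun _ _ => h⟩⟩
  rw [hc]
  simp only [layer₂, digit₃_pack hn h0 ha hb, digit₁_pack ha hb, digit₀_pack hb]
  unfold PredInstance.Reach PredInstance.IsZero
  by_cases h₁ : a = b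
  · subst h₁
    by_cases h₂ : a < (I.n + 1) * p
    · simp [h₂]
    · simp only [if_true, h₂, if_false, LayerFamily.lit_zero, Bool.false_eq_true, and_false,
        false_or, false_iff]
      -- The starting vertex is not reached from itself: its quotient by `p` is `I.n + 1`, which
      -- belongs to no node.
      rintro ⟨rfl, -, h | ⟨h, -⟩⟩
      all_goals
        rw [Nat.mul_div_cancel _ hp] at h
        omega
  by_cases h₂ : a = (I.n + 1) * p
  swap
  · simp [h₁, h₂]
  by_cases h₃ : b % p = 0
  swap
  · simp [h₁, h₃]
  by_cases h₄ : b / p = I.n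
  · simp [h₁, ← h₂, h₃, h₄]
  by_cases h₅ : b / p < I.n
  · simp only [h₂, h₃, h₄, h₅, if_true, if_false, false_or, Nat.zero_mod, true_and,
      exists_true_left]
    have h₆ := lit_not_state (unary := unary) (l := 2) I tw hw ⟨b / p, h₅⟩
    simp only at h₆
    rw [if_neg (h₂ ▸ h₁), h₆, Bool.not_eq_true', or_iff_right fun h => lt_irrefl _ h.2]
    rfl
  · simp [h₁, ← h₂, h₄, h₅]


/-- After `j` squarings the gates describe the walks whose length is given by the `j` leading digits
of the time. Each layer doubles this length and adds the next digit. -/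
theorem val_reach (hw : w = I.word tw)
    (hbit : ∀ k < digits unary w.length, ∀ l,
        (family p unary).lit (fun k => w.getD k false) w.length l
          (timeLit p unary w.length I.n k) = I.time.testBit k ∧
        (family p unary).lit (fun k => w.getD k false) w.length l
          (flipLit (timeLit p unary w.length I.n k)) = !I.time.testBit k)
    (htime : I.time < 2 ^ digits unary w.length)
    {j : ℕ} (hj : j ≤ digits unary w.length) :
    ∀ {a b : ℕ}, a < base p w.length → b < base p w.length →
    ((family p unary).val (fun k => w.getD k false) w.length (j + 2)
      (pack p w.length 0 I.n 0 a b) = true ↔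
        I.Reach (I.time / 2 ^ (digits unary w.length - j)) a b) := by
  have h0 := base_pos p w.length
  have hn := n_lt_base I tw hw
  have h4 := @four_le_base p w.length
  have hK := @mul_four_le_fanIn p w.length
  have hstart := start_lt_base I tw hw
  induction j with
  | zero =>
    intro a b ha hb
    rw [Nat.sub_zero, Nat.div_eq_of_lt htime]
    exact val_reach_zero I tw hw ha hb
  | succ j ih =>
    intro a b ha hb
    have ih := @ih (by omega)
    set k := digits unary w.length - (j + 1) with hk
    -- Appending one digit to a prefix of the binary expansion.
    have hdiv : I.time / 2 ^ k =
        2 * (I.time / 2 ^ (digits unary w.length - j)) + (I.time.testBit k).toNat := by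
      rw [show digits unary w.length - j = k + 1 by omega, pow_succ, ← Nat.div_div_eq_div_mul,
        Nat.toNat_testBit]
      omega
    rw [hdiv, I.reach_bit, show j + 1 + 2 = j + 3 by ring,
      val_layerReach (by omega) (pack_lt h0 hn h0 ha hb), exists_lt_fanIn]
    have four : ∀ f c d : ℕ, f < base p w.length → c < base p w.length → d < base p w.length →
        ((∀ e < fanIn p w.length, (family p unary).lit (fun k => w.getD k false) w.length (j + 3)
          (layerReach p unary w.length (j + 3) (pack p w.length 0 I.n 0 a b)
            (pack p w.length 0 0 f c d) e) = true) ↔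
        I.Reach (I.time / 2 ^ (digits unary w.length - j)) a c ∧
        I.Reach (I.time / 2 ^ (digits unary w.length - j)) c d ∧
        ((f = 0 ∧ I.time.testBit k = false ∧ d = b) ∨
          (f = 1 ∧ I.time.testBit k = true ∧ I.Step d b))) := by
      intro f c d hf hc hd
      rw [forall_lt_iff_of_forall_ge (m := 4) (by omega) fun e he => by
        rw [layerReach, if_neg (by omega), if_neg (by omega), if_neg (by omega), if_neg (by omega)]
        rfl]
      have e₀ : layerReach p unary w.length (j + 3) (pack p w.length 0 I.n 0 a b)
          (pack p w.length 0 0 f c d) 0 = gateLit p w.length (j + 2)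
            (pack p w.length 0 I.n 0 a c) := by
        rw [layerReach, if_pos rfl, digit₃_pack hn h0 ha hb, digit₁_pack ha hb, digit₁_pack hc hd]
        rfl
      have e₁ : layerReach p unary w.length (j + 3) (pack p w.length 0 I.n 0 a b)
          (pack p w.length 0 0 f c d) 1 = gateLit p w.length (j + 2)
            (pack p w.length 0 I.n 0 c d) := by
        rw [layerReach, if_neg (by omega), if_pos rfl, digit₃_pack hn h0 ha hb,
          digit₁_pack hc hd, digit₀_pack hd]
        rfl
      have e₂ : layerReach p unary w.length (j + 3) (pack p w.length 0 I.n 0 a b)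
          (pack p w.length 0 0 f c d) 2 = if f = 0 then
            flipLit (timeLit p unary w.length I.n k)
            else if f = 1 then timeLit p unary w.length I.n k else 0 := by
        rw [layerReach, if_neg (by omega), if_neg (by omega), if_pos rfl,
          digit₃_pack hn h0 ha hb, div_div_pack hc hd,
          show digits unary w.length + 2 - (j + 3) = k by omega]
      have e₃ : layerReach p unary w.length (j + 3) (pack p w.length 0 I.n 0 a b)
          (pack p w.length 0 0 f c d) 3 = if f = 1 then
            gateLit p w.length 0 (pack p w.length 0 I.n 0 d b) else if d = b then 1 else 0 := by
        rw [layerReach, if_neg (by omega), if_neg (by omega), if_neg (by omega), if_pos rfl,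
          digit₃_pack hn h0 ha hb, div_div_pack hc hd, digit₀_pack hd, digit₀_pack hb]
      have all : ∀ P : ℕ → Prop, (∀ e < 4, P e) ↔ P 0 ∧ P 1 ∧ P 2 ∧ P 3 := fun P =>
        ⟨fun h => ⟨h 0 (by omega), h 1 (by omega), h 2 (by omega), h 3 (by omega)⟩,
          fun ⟨h₀, h₁, h₂, h₃⟩ e he => by interval_cases e <;> assumption⟩
      rw [all, e₀, e₁, e₂, e₃, lit_gateLit (by omega) (pack_lt h0 hn h0 ha hc),
        lit_gateLit (by omega) (pack_lt h0 hn h0 hc hd), ih ha hc, ih hc hd]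
      refine and_congr_right fun _ => and_congr_right fun _ => ?_
      obtain ⟨b₁, b₂⟩ := hbit k (by omega) (j + 3)
      by_cases hf0 : f = 0
      · subst hf0
        simp only [if_true, zero_ne_one, if_false, b₂, Bool.not_eq_true', true_and, false_and,
          or_false]
        refine and_congr_right fun _ => ?_
        split_ifs with h <;> simp [h]
      · by_cases hf1 : f = 1
        · subst hf1
          simp only [one_ne_zero, if_true, if_false, b₁, true_and, false_and, false_or]
          rw [lit_gateLit (by omega) (pack_lt h0 hn h0 hd hb), val_step I tw hw hd hb]
        · simp [hf0, hf1]
    constructor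
    · rintro ⟨f, hf, c, hc, d, hd, h⟩
      obtain ⟨h₁, h₂, ⟨-, h₃, h₄⟩ | ⟨-, h₃, h₄⟩⟩ := (four f c d hf hc hd).1 h
      · exact ⟨c, d, h₁, h₂, by rwa [h₃]⟩
      · exact ⟨c, d, h₁, h₂, by rwa [h₃]⟩
    · rintro ⟨c, d, h₁, h₂, h₃⟩
      -- The intermediate vertices are below the base, so they occur among the digits over which the
      -- disjunction runs.
      have hc := h₁.lt_right.trans hstart
      have hd := h₂.lt_right.trans hstart
      by_cases ht : I.time.testBit k = true
      · rw [if_pos ht] at h₃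
        exact ⟨1, by omega, c, hc, d, hd, (four 1 c d (by omega) hc hd).2
          ⟨h₁, h₂, .inr ⟨rfl, ht, h₃⟩⟩⟩
      · rw [if_neg ht] at h₃
        exact ⟨0, by omega, c, hc, d, hd, (four 0 c d (by omega) hc hd).2
          ⟨h₁, h₂, .inl ⟨rfl, Bool.eq_false_iff.2 ht, h₃⟩⟩⟩

theorem val_isZero (hw : w = I.word tw)
    (hbit : ∀ k < digits unary w.length, ∀ l,
        (family p unary).lit (fun k => w.getD k false) w.length l
          (timeLit p unary w.length I.n k) = I.time.testBit k ∧
        (family p unary).lit (fun k => w.getD k false) w.length l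
          (flipLit (timeLit p unary w.length I.n k)) = !I.time.testBit k)
    (htime : I.time < 2 ^ digits unary w.length)
    {b : ℕ} (hb : b < base p w.length) :
    (family p unary).val (fun k => w.getD k false) w.length (digits unary w.length + 2)
      (pack p w.length 0 I.n 0 ((I.n + 1) * p) b) = true ↔ I.IsZero I.time b := by
  rw [val_reach I tw hw hbit htime le_rfl (start_lt_base I tw hw) hb, Nat.sub_self, pow_zero,
    Nat.div_one, I.reach_start]

/-- The conjunctions of the output gate that belong to the instance. -/
theorem exists_layerOut (hw : w = I.word tw)
    (hbit : ∀ k < digits unary w.length, ∀ l,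
        (family p unary).lit (fun k => w.getD k false) w.length l
          (timeLit p unary w.length I.n k) = I.time.testBit k ∧
        (family p unary).lit (fun k => w.getD k false) w.length l
          (flipLit (timeLit p unary w.length I.n k)) = !I.time.testBit k)
    (htime : I.time < 2 ^ digits unary w.length)
    : (∃ f < base p w.length, ∀ e < fanIn p w.length,
      (family p unary).lit (fun k => w.getD k false) w.length (digits unary w.length + 3)
        (layerOut p unary w.length (pack p w.length 0 0 I.n I.node f) e) = true) ↔
      (WellFormed p w I.n I.node ∧ TimeFormat p unary w I.n) ∧ I.Changes := by
  have h0 := base_pos p w.length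
  have hn := n_lt_base I tw hw
  have hv := I.node.2.trans hn
  have h4 := @four_le_base p w.length
  have hK := @mul_four_le_fanIn p w.length
  have hstart := start_lt_base I tw hw
  have hnp : I.n * p < base p w.length := lt_of_le_of_lt (Nat.mul_le_mul_right _ (by omega)) hstart
  have hvp : I.node * p < base p w.length :=
    lt_of_le_of_lt (Nat.mul_le_mul_right _ I.node.2.le) hnp
  have three : ∀ f < base p w.length, ((∀ e < fanIn p w.length,
      (family p unary).lit (fun k => w.getD k false) w.length (digits unary w.length + 3)
        (layerOut p unary w.length (pack p w.length 0 0 I.n I.node f) e) = true) ↔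
      (WellFormed p w I.n I.node ∧ TimeFormat p unary w I.n) ∧
      ((f = 0 ∧ ¬ I.IsZero I.time (I.n * p)) ∨
        (f = 1 ∧ I.IsZero I.time (I.node * p) ∧ (I.init I.node).1 = true) ∨
        (f = 2 ∧ ¬ I.IsZero I.time (I.node * p) ∧ (I.init I.node).1 = false))) := by
    intro f hf
    rw [forall_lt_iff_of_forall_ge (m := 3) (by omega) fun e he => by
      rw [layerOut, if_neg (by omega), if_neg (by omega), if_neg (by omega)]
      rfl]
    have all : ∀ P : ℕ → Prop, (∀ e < 3, P e) ↔ P 0 ∧ P 1 ∧ P 2 := fun P =>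
      ⟨fun h => ⟨h 0 (by omega), h 1 (by omega), h 2 (by omega)⟩,
        fun ⟨h₀, h₁, h₂⟩ e he => by interval_cases e <;> assumption⟩
    rw [all]
    simp only [layerOut, digit₀_pack hf, digit₁_pack hv hf, digit₂_pack hn hv hf, if_true,
      one_ne_zero, if_false, OfNat.ofNat_ne_zero, OfNat.ofNat_ne_one]
    rw [lit_gateLit_not (by omega) (pack_lt h0 hn hv h0 h0), Bool.not_eq_true',
      val_wellFormed hn hv]
    refine and_congr_right fun _ => ?_
    have z₁ := val_isZero I tw hw hbit htime hnp
    have z₂ := val_isZero I tw hw hbit htime hvp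
    by_cases hf0 : f = 0
    · subst hf0
      simp only [if_true, zero_ne_one, if_false, OfNat.zero_ne_ofNat, LayerFamily.lit_one, and_true,
        true_and, false_and, or_false]
      rw [lit_gateLit_not (by omega) (pack_lt h0 hn h0 hstart hnp), Bool.not_eq_true', ← z₁,
        Bool.not_eq_true]
    by_cases hf1 : f = 1
    · subst hf1
      simp only [if_true, one_ne_zero, if_false, OfNat.one_ne_ofNat,
        true_and, false_and, or_false, false_or]
      rw [lit_gateLit (by omega) (pack_lt h0 hn h0 hstart hvp), z₂, lit_state I tw hw]
    by_cases hf2 : f = 2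
    · subst hf2
      simp only [if_true, OfNat.ofNat_ne_zero, OfNat.ofNat_ne_one, if_false,
        true_and, false_and, false_or]
      rw [lit_gateLit_not (by omega) (pack_lt h0 hn h0 hstart hvp), Bool.not_eq_true', ← z₂,
        Bool.not_eq_true, lit_not_state I tw hw, Bool.not_eq_true']
    · simp [hf0, hf1, hf2]
  rw [I.changes_iff]
  constructor
  · rintro ⟨f, hf, h⟩
    obtain ⟨h₁, h₂⟩ := (three f hf).1 h
    exact ⟨h₁, h₂.imp And.right (Or.imp And.right And.right)⟩
  · rintro ⟨h₁, h₂ | h₂ | h₂⟩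
    · exact ⟨0, by omega, (three 0 (by omega)).2 ⟨h₁, .inl ⟨rfl, h₂⟩⟩⟩
    · exact ⟨1, by omega, (three 1 (by omega)).2 ⟨h₁, .inr (.inl ⟨rfl, h₂⟩)⟩⟩
    · exact ⟨2, by omega, (three 2 (by omega)).2 ⟨h₁, .inr (.inr ⟨rfl, h₂⟩)⟩⟩

end Gates

end Prediction

/-! ### The complexity of the prediction problems -/

namespace Prediction

open StackCode

variable {p : ℕ} {unary : Bool}

/-- The notation of the time is isolated in two hypotheses: every remainder of the right format
denotes some time, and the time literals are the binary digits of that time. If the output is true,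
its literal for the format yields the instance, for whichever `n` and `v` made it true. -/
theorem output_iff {w : List Bool} {enc : ℕ → List Bool}
    (h₁ : ∀ n v, WellFormed p w n v → TimeFormat p unary w n →
      ∃ t, w.drop (timePos p n) = enc t)
    (h₂ : ∀ I : PredInstance p, w = I.word (enc I.time) → TimeFormat p unary w I.n ∧
      (∀ k < digits unary w.length, ∀ l,
        (family p unary).lit (fun k => w.getD k false) w.length l
          (timeLit p unary w.length I.n k) = I.time.testBit k ∧
        (family p unary).lit (fun k => w.getD k false) w.length l
          (flipLit (timeLit p unary w.length I.n k)) = !I.time.testBit k) ∧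
      I.time < 2 ^ digits unary w.length) :
    (family p unary).toTree.value (fun k => w.getD k false) w.length
      ((family p unary).toTree.H w.length * (family p unary).toTree.B w.length - 1) = true ↔
      ∃ I : PredInstance p, w = I.word (enc I.time) ∧ I.Changes := by
  have h0 := base_pos p w.length
  rw [output_family, exists_lt_fanIn]
  constructor
  · rintro ⟨n, hn, v, hv, f, hf, h⟩
    have hwf := h 0 fanIn_pos
    rw [layerOut, if_pos rfl, digit₁_pack hv hf, digit₂_pack hn hv hf,
      lit_gateLit_not (by omega) (pack_lt h0 hn hv h0 h0), Bool.not_eq_true',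
      val_wellFormed hn hv] at hwf
    obtain ⟨t, ht⟩ := h₁ n v hwf.1 hwf.2
    obtain ⟨I, rfl, rfl, rfl, hI⟩ := hwf.1.exists_instance t
    rw [ht] at hI
    obtain ⟨-, hbit, htime⟩ := h₂ I hI
    exact ⟨I, hI, ((exists_layerOut I _ hI hbit htime).1 ⟨f, hf, h⟩).2⟩
  · rintro ⟨I, hI, hc⟩
    obtain ⟨hT, hbit, htime⟩ := h₂ I hI
    have hwf := I.wellFormed (enc I.time)
    rw [← hI] at hwf
    obtain ⟨f, hf, h⟩ := (exists_layerOut I _ hI hbit htime).2 ⟨⟨hwf, hT⟩, hc⟩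
    have hn := n_lt_base I _ hI
    exact ⟨I.n, hn, I.node, I.node.2.trans hn, f, hf, h⟩

theorem unaryEncodeNat_eq (t : ℕ) : Computability.unaryEncodeNat t = List.replicate t true := by
  induction t with
  | zero => rfl
  | succ t ih => rw [List.replicate_succ, ← ih]; rfl

theorem output_unary (w : List Bool) :
    (family p true).toTree.value (fun k => w.getD k false) w.length
      ((family p true).toTree.H w.length * (family p true).toTree.B w.length - 1) = true ↔
      w ∈ unaryPrediction p := by
  refine output_iff (fun n v h hT => ⟨w.length - timePos p n, ?_⟩) fun I hI => ?_
  · rw [unaryEncodeNat_eq, List.eq_replicate_iff]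
    refine ⟨by simp, fun b hb => ?_⟩
    obtain ⟨k, hk, rfl⟩ := List.mem_iff_getElem.1 hb
    rw [List.length_drop] at hk
    have h' : timePos p n + k < w.length := by omega
    simp only [TimeFormat, if_true] at hT
    have := hT (timePos p n + k) h' (by omega)
    rw [List.getElem_drop]
    simpa [List.getD_eq_getElem?_getD, h'] using this
  · have hl := I.length_word (Computability.unaryEncodeNat I.time)
    rw [← hI, unaryEncodeNat_eq, List.length_replicate] at hl
    have h0 : w.length ≠ 0 := by
      have := @le_timePos p I.n
      omega
    refine ⟨?_, fun k hk l => ?_, ?_⟩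
    · simp only [TimeFormat, if_true]
      intro k hk hk'
      have := I.word_time (Computability.unaryEncodeNat I.time) (k - timePos p I.n)
      rw [← hI, show timePos p I.n + (k - timePos p I.n) = k by omega, unaryEncodeNat_eq] at this
      rw [this, List.getD_eq_getElem?_getD, List.getElem?_replicate, if_pos (by omega)]
      rfl
    · simp only [digits, if_true] at hk
      -- The digits used have `k` at most the logarithm of the length, so the cut in `timeLit` is
      -- not effective.
      have hpow : 2 ^ k ≤ w.length :=
        (Nat.pow_le_pow_right two_pos (by omega)).trans (Nat.pow_log_le_self 2 h0)
      have e : timeLit p true w.length I.n k = (I.time.testBit k).toNat := by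
        rw [timeLit, if_pos rfl, min_eq_left (by omega), Nat.toNat_testBit,
          show w.length - timePos p I.n = I.time by omega]
      rw [e]
      cases I.time.testBit k <;> exact ⟨rfl, rfl⟩
    · simp only [digits, if_true]
      have := Nat.lt_pow_succ_log_self one_lt_two w.length
      rw [Nat.succ_eq_add_one] at this
      omega

/-- A word denotes a number as soon as it has no leading zero; this is the only condition that the
format check imposes on a time in binary. -/
theorem exists_bits_eq : ∀ l : List Bool, (l ≠ [] → l.getD (l.length - 1) false = true) →
    ∃ t : ℕ, l = t.bits
  | [], _ => ⟨0, rfl⟩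
  | b :: l, h => by
    obtain ⟨t, ht⟩ := exists_bits_eq l fun hl => by
      obtain ⟨m, hm⟩ := Nat.exists_eq_add_of_lt (List.length_pos_iff.2 hl)
      have := h (by simp)
      rw [List.length_cons, hm] at this
      rw [hm]
      simpa using this
    refine ⟨Nat.bit b t, ?_⟩
    rw [Nat.bits_append_bit _ _ fun h0 => ?_, ht]
    subst h0
    rw [Nat.zero_bits] at ht
    subst ht
    simpa using h (by simp)

theorem getD_bits (t k : ℕ) : t.bits.getD k false = t.testBit k := by
  rw [Nat.testBit_eq_inth]
  rfl

theorem getD_bits_last {t : ℕ} (h : t ≠ 0) : t.bits.getD (t.bits.length - 1) false = true := by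
  induction t using Nat.binaryRec' with
  | zero => exact absurd rfl h
  | bit b t hb ih =>
    rw [Nat.bits_append_bit _ _ hb]
    by_cases ht : t = 0
    · subst ht
      simp [hb rfl]
    · have h' : t.bits ≠ [] := by rwa [Ne, bits_eq_nil]
      obtain ⟨m, hm⟩ := Nat.exists_eq_add_of_lt (List.length_pos_iff.2 h')
      have := ih ht
      rw [hm] at this
      rw [List.length_cons, hm]
      simpa using this

theorem output_binary (w : List Bool) :
    (family p false).toTree.value (fun k => w.getD k false) w.length
      ((family p false).toTree.H w.length * (family p false).toTree.B w.length - 1) = true ↔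
      w ∈ binaryPrediction p := by
  refine output_iff (fun n v h hT => ?_) fun I hI => ?_
  · simp only [encodeNat_eq_bits]
    refine exists_bits_eq _ fun hne => ?_
    simp only [TimeFormat, Bool.false_eq_true, if_false] at hT
    have hlt : timePos p n < w.length := by
      by_contra hc
      exact hne (List.drop_eq_nil_of_le (not_lt.1 hc))
    have := hT hlt
    rw [List.length_drop, List.getD_eq_getElem?_getD, List.getElem?_drop,
      show timePos p n + (w.length - timePos p n - 1) = w.length - 1 by omega]
    rwa [List.getD_eq_getElem?_getD] at this
  · have hl := I.length_word (Computability.encodeNat I.time)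
    have ht := I.word_time (Computability.encodeNat I.time)
    rw [← hI] at hl ht
    simp only [encodeNat_eq_bits, getD_bits] at hl ht
    refine ⟨?_, fun k hk l => ?_, ?_⟩
    · simp only [TimeFormat, Bool.false_eq_true, if_false]
      intro hlt
      have h0 : I.time ≠ 0 := fun h => by
        rw [h, Nat.zero_bits, List.length_nil] at hl; omega
      have := getD_bits_last h0
      rw [getD_bits, ← ht,
        show timePos p I.n + (I.time.bits.length - 1) = w.length - 1 by omega] at this
      exact this
    · simp only [timeLit, Bool.false_eq_true, if_false]
      split_ifs with h
      · have e : flipLit (inputLit (timePos p I.n + k)) = inputLit (timePos p I.n + k) + 1 := by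
          simp [flipLit, inputLit]
        rw [e, lit_inputLit h, lit_inputLit_not h]
        exact ⟨ht k, congrArg _ (ht k)⟩
      · have : I.time.testBit k = false := by
          rw [← ht, List.getD_eq_getElem?_getD, List.getElem?_eq_none (not_lt.1 h)]
          rfl
        rw [this]
        exact ⟨rfl, rfl⟩
    · simp only [digits, Bool.false_eq_true, if_false]
      refine Nat.lt_size_self I.time |>.trans_le (Nat.pow_le_pow_right two_pos ?_)
      rw [← Nat.size_eq_bits_len]
      omega

theorem inNC_unaryPrediction (p : ℕ) : InNC 2 (unaryPrediction p) :=
  -- Each of the `Nat.log 2 N + 5` layers consists of two levels.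
  uniform_family.toTree.inNC (F := (family p true).toTree) (a := 10)
    (fun N => by
      change 2 * (Nat.log 2 N + 1 + 4) ≤ _
      omega) output_unary

theorem inPolyTime_binaryPrediction (p : ℕ) : InPolyTime (binaryPrediction p) :=
  uniform_family.toTree.inPolyTime (F := (family p false).toTree) output_binary

end Prediction

/-! ### The transients of finite relations -/

section Relation

variable {V : Type*} {R : V → V → Prop}

/-- There is a walk of length `k` from `u` to `v`. -/
def Walk (R : V → V → Prop) : ℕ → V → V → Prop
  | 0, u, v => u = v
  | k + 1, u, v => ∃ w, Walk R k u w ∧ R w v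

theorem walk_add {i j : ℕ} {u v : V} :
    Walk R (i + j) u v ↔ ∃ w, Walk R i u w ∧ Walk R j w v := by
  induction j generalizing v with
  | zero => simp [Walk]
  | succ j ih =>
    constructor
    · rintro ⟨x, h, hx⟩
      obtain ⟨w, h₁, h₂⟩ := ih.1 h
      exact ⟨w, h₁, x, h₂, hx⟩
    · rintro ⟨w, h₁, x, h₂, hx⟩
      exact ⟨x, ih.2 ⟨w, h₁, h₂⟩, hx⟩

theorem walk_one {u v : V} : Walk R 1 u v ↔ R u v := by simp [Walk]

/-- With the reversed relation, statements on the part of a walk after a vertex apply to the part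
before it. -/
theorem walk_swap {k : ℕ} {u v : V} : Walk (Function.swap R) k u v ↔ Walk R k v u := by
  induction k generalizing v with
  | zero => exact eq_comm
  | succ k ih =>
    have h : Walk R (1 + k) v u ↔ ∃ w, Walk R 1 v w ∧ Walk R k w u := walk_add
    rw [Nat.add_comm 1 k] at h
    rw [h]
    exact exists_congr fun _ => (and_congr ih (walk_one (R := R)).symm).trans and_comm

theorem Walk.exists_path {k : ℕ} {u v : V} (h : Walk R k u v) :
    ∃ s : ℕ → V, s k = v ∧ ∀ i j, i + j ≤ k → Walk R j (s i) (s (i + j)) ∧ Walk R i u (s i) := by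
  induction k generalizing v with
  | zero =>
    refine ⟨fun _ => v, rfl, fun i j hij => ?_⟩
    obtain ⟨rfl, rfl⟩ : i = 0 ∧ j = 0 := by omega
    exact ⟨rfl, h⟩
  | succ k ih =>
    obtain ⟨w, hw, hR⟩ := h
    obtain ⟨s, rfl, hs⟩ := ih hw
    refine ⟨fun i => if i ≤ k then s i else v, by simp, fun i j hij => ?_⟩
    beta_reduce
    rcases Nat.lt_or_ge k (i + j) with h | h
    · rcases j with _ | j
      · simp only [Nat.add_zero] at h ⊢
        rw [if_neg (not_le.2 h)]
        refine ⟨rfl, ?_⟩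
        rw [show i = k + 1 by omega]
        exact ⟨_, hw, hR⟩
      · obtain ⟨h₁, h₂⟩ := hs i j (by omega)
        rw [if_pos (by omega), if_neg (by omega)]
        refine ⟨⟨_, h₁, ?_⟩, h₂⟩
        rwa [show i + j = k by omega]
    · rw [if_pos (by omega), if_pos h]
      exact hs i j h

variable [Fintype V]

/-- A long walk meets a cycle. -/
theorem Walk.exists_cycle {k : ℕ} {u v : V} (h : Walk R k u v) (hk : Fintype.card V ≤ k) :
    ∃ (w : V) (i j l : ℕ), i + j = k ∧ 0 < l ∧ l ≤ Fintype.card V ∧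
      Walk R i u w ∧ Walk R j w v ∧ Walk R l w w := by
  obtain ⟨s, rfl, hs⟩ := h.exists_path
  obtain ⟨a, b, hab, he⟩ := Fintype.exists_ne_map_eq_of_card_lt
    (fun i : Fin (Fintype.card V + 1) => s i) (by simp)
  have key : ∀ a b : ℕ, a < b → b ≤ Fintype.card V → s a = s b →
      ∃ (w : V) (i j l : ℕ), i + j = k ∧ 0 < l ∧ l ≤ Fintype.card V ∧
      Walk R i u w ∧ Walk R j w (s k) ∧ Walk R l w w := by
    intro a b hab hb he
    have h₁ := hs a (k - a) (by omega)
    have h₂ := hs a (b - a) (by omega)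
    rw [show a + (k - a) = k by omega] at h₁
    rw [show a + (b - a) = b by omega, ← he] at h₂
    exact ⟨s a, a, k - a, b - a, by omega, by omega, by omega, h₁.2, h₁.1, h₂.1⟩
  rcases lt_or_gt_of_ne (Fin.val_ne_of_ne hab) with h' | h'
  · exact key a b h' (by omega) he
  · exact key b a h' (by omega) he.symm

/-- The vertices that are reached from a vertex on a cycle. -/
theorem walk_sub_of_cycle {w v : V} {l i : ℕ} (hc : Walk R l w w)
    (hi : Fintype.card V * l ≤ i) (h : Walk R (i + l) w v) : Walk R i w v := by
  classical
  let A : ℕ → Finset V := fun i => Finset.univ.filter fun v => Walk R i w v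
  have hA : ∀ i v, v ∈ A i ↔ Walk R i w v := by simp [A]
  have mono : ∀ i, A i ⊆ A (i + l) := fun i v hv => by
    rw [hA] at hv ⊢
    rw [Nat.add_comm]
    exact walk_add.2 ⟨w, hc, hv⟩
  have next : ∀ i j, A i = A j → A (i + 1) = A (j + 1) := fun i j hij => by
    ext v
    rw [hA, hA]
    refine exists_congr fun x => and_congr_left fun _ => ?_
    rw [← hA, ← hA, hij]
  -- If none of these inclusions were an equality, the cardinality would grow at least by one each
  -- time and would exceed that of `V` after `Fintype.card V + 1` steps.
  obtain ⟨j, hj, he⟩ : ∃ j ≤ Fintype.card V, A (j * l) = A (j * l + l) := by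
    by_contra! hne
    have hcard : ∀ j ≤ Fintype.card V + 1, j ≤ (A (j * l)).card := by
      intro j
      induction j with
      | zero => intro _; exact Nat.zero_le _
      | succ j ih =>
        intro hj
        have := Finset.card_lt_card
          (Finset.ssubset_iff_subset_ne.2 ⟨mono (j * l), hne j (by omega)⟩)
        rw [← Nat.succ_mul] at this
        exact Nat.succ_le_of_lt ((ih (by omega)).trans_lt this)
    have := (hcard _ le_rfl).trans (Finset.card_le_univ _)
    omega
  have stable : ∀ d, A (j * l + d) = A (j * l + d + l) := by
    intro d
    induction d with
    | zero => exact he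
    | succ d ih =>
      have := next _ _ ih
      rwa [show j * l + d + l + 1 = j * l + (d + 1) + l by ring] at this
  have hle : j * l ≤ i := (Nat.mul_le_mul_right l hj).trans hi
  have := stable (i - j * l)
  rw [Nat.add_sub_of_le hle] at this
  rw [← hA, this, hA]
  exact h

/-- One of the two parts of the walk, before or after `w`, is long enough to lose `l` steps by
`walk_sub_of_cycle`; the part before `w` is treated in the reversed relation. -/
theorem walk_through_sub {u v w : V} {l L : ℕ} (hl : l ≤ Fintype.card V) (hc : Walk R l w w)
    (hL : 3 * Fintype.card V ^ 2 ≤ L)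
    (h : ∃ i j, i + j = L + l ∧ Walk R i u w ∧ Walk R j w v) :
    ∃ i j, i + j = L ∧ Walk R i u w ∧ Walk R j w v := by
  obtain ⟨i, j, hij, h₁, h₂⟩ := h
  set N := Fintype.card V
  have hNl : N * l ≤ N ^ 2 := by rw [sq]; exact Nat.mul_le_mul_left _ hl
  have hN : N ≤ N ^ 2 := Nat.le_self_pow two_ne_zero _
  -- If the part before `w` has fewer than `N * l + l ≤ 2 * N ^ 2` steps, then `L ≥ 3 * N ^ 2`
  -- leaves at least `N ^ 2 ≥ N * l` steps after `w` once `l` steps are removed.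
  rcases Nat.lt_or_ge i (N * l + l) with hi | hi
  · refine ⟨i, j - l, by omega, h₁, walk_sub_of_cycle hc (show N * l ≤ j - l by omega) ?_⟩
    rwa [Nat.sub_add_cancel (by omega)]
  · refine ⟨i - l, j, by omega, ?_, h₂⟩
    rw [← walk_swap] at h₁ hc ⊢
    refine walk_sub_of_cycle hc (show N * l ≤ i - l by omega) ?_
    rwa [Nat.sub_add_cancel (by omega)]

/-- The powers of a relation become periodic after a quadratic number of steps. -/
theorem walk_add_iff {m L : ℕ} (hm : ∀ l, 0 < l → l ≤ Fintype.card V → l ∣ m)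
    (hL : 3 * Fintype.card V ^ 2 ≤ L) (u v : V) : Walk R (L + m) u v ↔ Walk R L u v := by
  have hN : Fintype.card V ≤ Fintype.card V ^ 2 := Nat.le_self_pow two_ne_zero _
  constructor
  · intro h
    obtain ⟨w, i, j, l, hij, hl, hl', h₁, h₂, hc⟩ := h.exists_cycle (by omega)
    obtain ⟨d, rfl⟩ := hm l hl hl'
    -- Since `m` is a multiple `l * d`, the `m` additional steps are removed in portions of `l`. The
    -- walks must be kept passing through `w`, for otherwise the next portion could not be removed
    -- at the same cycle.
    have down : ∀ d L, 3 * Fintype.card V ^ 2 ≤ L →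
        (∃ i j, i + j = L + l * d ∧ Walk R i u w ∧ Walk R j w v) →
        ∃ i j, i + j = L ∧ Walk R i u w ∧ Walk R j w v := by
      intro d
      induction d with
      | zero => intro L _ h; simpa using h
      | succ d ih =>
        intro L hL h
        refine walk_through_sub hl' hc hL (ih (L + l) (by omega) ?_)
        rwa [Nat.add_assoc, Nat.add_comm l, ← Nat.mul_succ]
    obtain ⟨i, j, rfl, h₁, h₂⟩ := down d L hL ⟨i, j, hij, h₁, h₂⟩
    exact walk_add.2 ⟨w, h₁, h₂⟩
  · intro h
    obtain ⟨w, i, j, l, hij, hl, hl', h₁, h₂, hc⟩ := h.exists_cycle (by omega)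
    obtain ⟨d, rfl⟩ := hm l hl hl'
    have pump : ∀ d, Walk R (l * d) w w := by
      intro d
      induction d with
      | zero => rfl
      | succ d ih => exact walk_add.2 ⟨w, ih, hc⟩
    rw [← hij, show i + j + l * d = i + (l * d + j) by ring]
    exact walk_add.2 ⟨w, h₁, walk_add.2 ⟨w, pump d, h₂⟩⟩

end Relation

/-! ### Transients of the network: zeros as walks on pairs of a node and a phase. -/

section Transient

variable {p n : ℕ} (G : UGraph n) (x : Fin n → PerState Bool p)

/-- A zero of the first node at the first time, modulo `p`, leads to a zero of the second node one
step later. -/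
def ZeroStep (a b : Fin n × Fin p) : Prop :=
  b.2.val = (a.2.val + 1) % p ∧
    if (⟨((x b.1).2.1.val + a.2.val) % p, Nat.mod_lt _ a.2.pos⟩ : Fin p) ∈ (x b.1).2.2 then
      G.adj b.1 a.1 = true else a.1 = b.1

theorem Walk.snd_eq {G : UGraph n} {x : Fin n → PerState Bool p} {t : ℕ} {a b : Fin n × Fin p}
    (h : Walk (ZeroStep G x) t a b) : b.2.val = (a.2.val + t) % p := by
  induction t generalizing b with
  | zero => rw [← (show a = b from h), Nat.add_zero, Nat.mod_eq_of_lt a.2.2]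
  | succ t ih =>
    obtain ⟨c, hc, hb⟩ := h
    rw [hb.1, ih hc, Nat.mod_add_mod, Nat.add_assoc]

/-- The phase counts the time from the start, so all walks begin with phase `0`. The different
clocks of the nodes enter only as offsets in `ZeroStep`. -/
theorem iterate_fst_eq_false_iff (hp : 0 < p) (t : ℕ) (v : Fin n) :
    (((symConjPeriodic p G)^[t] x) v).1 = false ↔ ∃ u, (x u).1 = false ∧
      Walk (ZeroStep G x) t (u, ⟨0, hp⟩) (v, ⟨t % p, Nat.mod_lt _ hp⟩) := by
  induction t generalizing v with
  | zero =>
    simp [Walk]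
  | succ t ih =>
    rw [symConjPeriodic_iterate_succ_fst]
    constructor
    · rintro ⟨u, hu, h⟩
      obtain ⟨u₀, h₀, hw⟩ := (ih u).1 hu
      refine ⟨u₀, h₀, _, hw, by simp, ?_⟩
      simpa only [Nat.add_mod_mod] using h
    · rintro ⟨u₀, h₀, ⟨u, φ⟩, hw, -, h⟩
      have hφ : φ = ⟨t % p, Nat.mod_lt _ hp⟩ := Fin.ext (by simpa using hw.snd_eq)
      subst hφ
      refine ⟨u, (ih u).2 ⟨u₀, h₀, hw⟩, ?_⟩
      simpa only [Nat.add_mod_mod] using h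

/-- After a quadratic number of steps the configuration is periodic. -/
theorem iterate_mem_periodicPts :
    (symConjPeriodic p G)^[3 * (n * p) ^ 2] x ∈ Function.periodicPts (symConjPeriodic p G) := by
  rcases Nat.eq_zero_or_pos n with rfl | hn
  · exact Function.mk_mem_periodicPts one_pos (Subsingleton.elim _ _)
  have hp : 0 < p := (x ⟨0, hn⟩).2.1.pos
  set τ := 3 * (n * p) ^ 2 with hτ
  -- The factorial is divisible by the length of every cycle, and the factor `p` makes the phases
  -- and the clocks return.
  set m := (n * p).factorial * p with hm
  refine Function.mk_mem_periodicPts (n := m) (Nat.mul_pos (Nat.factorial_pos _) hp) ?_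
  rw [Function.IsPeriodicPt, Function.IsFixedPt, ← Function.iterate_add_apply, Nat.add_comm]
  have hmod : (τ + m) % p = τ % p := by rw [hm, Nat.add_mul_mod_self_right]
  funext v
  refine Prod.ext ?_ ?_
  · refine Bool.eq_iff_iff.2 (not_iff_not.1 ?_)
    rw [Bool.not_eq_true, Bool.not_eq_true, iterate_fst_eq_false_iff G x hp,
      iterate_fst_eq_false_iff G x hp]
    refine exists_congr fun u => and_congr_right fun _ => ?_
    simp only [hmod]
    refine walk_add_iff (fun l hl hl' => ?_) (by simp [hτ]) _ _
    rw [Fintype.card_prod, Fintype.card_fin, Fintype.card_fin] at hl'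
    exact (Nat.dvd_factorial hl hl').trans (Nat.dvd_mul_right _ _)
  · rw [symConjPeriodic_iterate_snd, symConjPeriodic_iterate_snd]
    ext1
    · ext1
      change (_ + (τ + m)) % p = (_ + τ) % p
      rw [← Nat.add_mod_mod, hmod, Nat.add_mod_mod]
    · rfl

end Transient

theorem mainTheorem7 (p : ℕ) :
    (∃ c : ℕ, ∀ (n : ℕ) (G : UGraph n) (x : Fin n → PerState Bool p),
      ∃ τ ≤ c * n ^ 2,
        (symConjPeriodic p G)^[τ] x ∈ Function.periodicPts (symConjPeriodic p G)) ∧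
    InNC 2 (unaryPrediction p) ∧
    InPolyTime (binaryPrediction p) :=
  ⟨⟨3 * p ^ 2, fun n G x => ⟨3 * (n * p) ^ 2, (by ring : _ = _).le, iterate_mem_periodicPts G x⟩⟩,
    Prediction.inNC_unaryPrediction p, Prediction.inPolyTime_binaryPrediction p⟩
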